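/- **Setting.** Let $n\ge 2$, $p\ge 1$. Agents $i=1,\dots,n$ communicate over a connected undirected graph with symmetric weighted adjacency matrix $A=(a_{ij})$ ($a_{ij}>0$ on edges, $a_{ij}=0$ otherwise, $a_{ii}=0$) and Laplacian $L=\mathrm{diag}(\sum_j a_{ij})-A$; $\rho(\cdot)$ is the spectral radius and $\rho_2(L)$ the least positive eigenvalue of $L$. Let $\xi_i$ be a random variable with law $\mu_i$, $f_i(x)=\mathbb E[F_i(x,\xi_i)]$ for $x\in\mathbb R^p$ (the expectations exist), $f=\frac1n\sum_i f_i$ and $f^*=\inf f$. Assume that $f^*>-\infty$; for almost every value of $\xi_i$ the function $F_i(\cdot,\xi_i)$ is differentiable with $L_f$-Lipschitz gradient ($L_f>0$); $\mathbb E[(\nabla_xF_i(x,\xi_i)-\nabla f_i(x))_j^2]\le\zeta^2$ for all $i$, all coordinates $j$ and all $x$; and $\|\nabla f_i(x)-\nabla f(x)\|^2\le\sigma_2^2$ for all $i,x$. Let $\sigma_1$ be such that $p\zeta^2\le\sigma_1^2$. **Algorithm (ZODIAC).** Let $1\le n_c\le p$. For each agent $i$ and iteration $k\ge0$ draw a sample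 $\xi_{i,k}\sim\mu_i$ and a random set $S_{i,k}\subseteq\{1,\dots,p\}$ with $|S_{i,k}|=n_c$ and $\Pr(j\in S_{i,k})=n_c/p$ for every $j$, all draws being mutually independent. Starting from $x_{i,0}\in\mathbb R^p$ and $v_{i,0}\in\mathbb R^p$ with $\sum_i v_{i,0}=0$ (e.g. $v_{i,0}=0$), iterate $$x_{i,k+1}=x_{i,k}-\eta\Big(\alpha\sum_j L_{ij}x_{j,k}+\beta v_{i,k}+g^e_{i,k}\Big),\qquad v_{i,k+1}=v_{i,k}+\eta\beta\sum_j L_{ij}x_{j,k},$$ where, with smoothing parameters $\delta_{i,j,k}>0$ and $e_j$ the $j$-th unit vector, $g^e_{i,k}$ is either $\frac{p}{n_c}\sum_{j\in S_{i,k}}\frac{F_i(x_{i,k}+\delta_{i,j,k}e_j,\xi_{i,k})-F_i(x_{i,k},\xi_{i,k})}{\delta_{i,j,k}}e_j$ or $\frac{p}{n_c}\sum_{j\in S_{i,k}}\frac{F_i(x_{i,k}+\delta_{i,j,k}e_j,\xi_{i,k})-F_i(x_{i,k}-\delta_{i,j,k}e_j,\xi_{i,k})}{2\delta_{i,j,k}}e_j$.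 Put $\bar x_k=\frac1n\sum_i x_{i,k}$. **Theorem.** Let $T$ be an integer with $T>n^3/p$, and run ZODIAC with $$\alpha=\kappa_1\beta,\quad \beta=\frac{\kappa_2\sqrt{pT}}{\sqrt n},\quad \eta=\frac{\kappa_2}{\beta},\quad \delta_{i,j,k}\le\frac{\kappa_\delta}{p^{1/4}n^{1/4}(k+1)^{1/4}}\ \ (k\le T),$$ where $\kappa_1>\frac1{\rho_2(L)}+1$, $0<\kappa_2<\min\Big\{\frac{(\kappa_1-1)\rho_2(L)-1}{\rho(L)+(2\kappa_1^2+1)\rho(L^2)+1},\frac15\Big\}$ and $\kappa_\delta>0$. Suppose that $\frac1n\sum_i\|x_{i,0}-\bar x_0\|^2$, $\frac1n\sum_i\|v_{i,0}\|^2$ and $f(\bar x_0)-f^*$ are at most $R$. Then all the expectations below are finite and $$\frac1T\sum_{k=0}^{T-1}\mathbb E\|\nabla f(\bar x_k)\|^2=O\Big(\frac{\sqrt p}{\sqrt T}\Big)+O\Big(\frac nT\Big),\qquad \mathbb E[f(\bar x_T)]-f^*=O(1),$$ $$\frac1T\sum_{k=0}^{T-1}\mathbb E\Big[\frac1n\sum_{i=1}^n\|x_{i,k}-\bar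 x_k\|^2\Big]=O\Big(\frac nT\Big).$$ The constant in each $O$-term is $C(p/T)$ for a positive nondecreasing function $C$ that depends only on $L_f,\sigma_1,\sigma_2,\kappa_1,\kappa_2,\kappa_\delta,\rho(L),\rho_2(L)$ and $R$. In particular, for fixed $p$ the constants are uniform over all $n$ and all $T>n^3/p$ (they are at most $C(p)$), and they do not depend on $p$ either as long as $T\ge p$ (they are at most $C(1)$). -/

import Mathlib

open MeasureTheory ProbabilityTheory Finset
open scoped Gradient ENNReal

noncomputable section

/-- `g : ℝ^p → ℝ` is smooth with constant `c`: differentiable with `c`-Lipschitz gradient. -/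
def IsSmoothWith {p : ℕ} (c : ℝ) (g : EuclideanSpace ℝ (Fin p) → ℝ) : Prop :=
  Differentiable ℝ g ∧ ∀ x y, ‖∇ g x - ∇ g y‖ ≤ c * ‖x - y‖

/-- `A` is a weighted adjacency matrix of the undirected graph `G`: it is symmetric, its entries
are positive on the edges and zero elsewhere (in particular on the diagonal). -/
structure IsWeightedAdjMatrix {n : ℕ} (G : SimpleGraph (Fin n)) (A : Matrix (Fin n) (Fin n) ℝ) :
    Prop where
  symm : A.IsSymm
  pos_of_adj : ∀ i j, G.Adj i j → 0 < A i j
  zero_of_not_adj : ∀ i j, ¬ G.Adj i j → A i j = 0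

/-- The weighted Laplacian `Deg - A`, where `Deg` is the diagonal matrix of the row sums of `A`. -/
def weightedLaplacian {n : ℕ} (A : Matrix (Fin n) (Fin n) ℝ) : Matrix (Fin n) (Fin n) ℝ :=
  Matrix.diagonal (fun i => ∑ j, A i j) - A

/-- The spectral radius of a matrix. It is only used for symmetric real matrices, whose complex
eigenvalues are all real, so that the real spectrum suffices. -/
def specRad {n : ℕ} (M : Matrix (Fin n) (Fin n) ℝ) : ℝ :=
  (spectralRadius ℝ M).toReal

/-- The least positive eigenvalue of a matrix that has positive eigenvalues. -/
def minPosEigenvalue {n : ℕ} (M : Matrix (Fin n) (Fin n) ℝ) : ℝ :=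
  sInf {l : ℝ | l ∈ spectrum ℝ M ∧ 0 < l}

/-- The average of `n` vectors in `ℝ^p`. -/
def avg {n p : ℕ} (x : Fin n → EuclideanSpace ℝ (Fin p)) : EuclideanSpace ℝ (Fin p) :=
  (1 / (n : ℝ)) • ∑ i, x i

/-- The local cost `f_i(x) = 𝔼[F_i(x, ξ_i)]`, where `ξ_i` has law `μ`. -/
def localCost {p : ℕ} {Ξ : Type*} [MeasurableSpace Ξ] (F : EuclideanSpace ℝ (Fin p) → Ξ → ℝ)
    (μ : Measure Ξ) (x : EuclideanSpace ℝ (Fin p)) : ℝ :=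
  ∫ z, F x z ∂μ

/-- The global cost `f(x) = (1/n) ∑_i f_i(x)`. -/
def globalCost {n p : ℕ} {Ξ : Type*} [MeasurableSpace Ξ]
    (F : Fin n → EuclideanSpace ℝ (Fin p) → Ξ → ℝ) (μ : Fin n → Measure Ξ)
    (x : EuclideanSpace ℝ (Fin p)) : ℝ :=
  (1 / (n : ℝ)) * ∑ i, localCost (F i) (μ i) x

/-- The standing assumptions on the stochastic functions `F_i` and on the laws `μ_i` of `ξ_i`:
the expectations defining `f_i` exist, the `F_i(·, ξ_i)` are almost surely smooth with constant
`Lf`, every coordinate of the stochastic gradient has variance at most `ζ ^ 2`, the local gradients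
are within `σ₂` of the global one, and the global cost is bounded below. -/
structure CostAssumptions {n p : ℕ} {Ξ : Type*} [MeasurableSpace Ξ]
    (F : Fin n → EuclideanSpace ℝ (Fin p) → Ξ → ℝ) (μ : Fin n → Measure Ξ)
    (Lf ζ σ₂ : ℝ) : Prop where
  prob : ∀ i, IsProbabilityMeasure (μ i)
  measurable : ∀ i, Measurable (fun q : EuclideanSpace ℝ (Fin p) × Ξ => F i q.1 q.2)
  integrable : ∀ i x, Integrable (fun z => F i x z) (μ i)
  bddBelow : BddBelow (Set.range (globalCost F μ))
  smooth : ∀ i, ∀ᵐ z ∂(μ i), IsSmoothWith Lf (fun x => F i x z)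
  variance_integrable : ∀ i x j,
    Integrable (fun z => ((∇ (fun y => F i y z) x - ∇ (localCost (F i) (μ i)) x) j) ^ 2) (μ i)
  variance_le : ∀ i x j,
    ∫ z, ((∇ (fun y => F i y z) x - ∇ (localCost (F i) (μ i)) x) j) ^ 2 ∂(μ i) ≤ ζ ^ 2
  similar : ∀ i x,
    ‖∇ (localCost (F i) (μ i)) x - ∇ (globalCost F μ) x‖ ^ 2 ≤ σ₂ ^ 2

/-- The two options for the difference quotients. -/
inductive DiffScheme where
  | forward
  | central

/-- The difference quotient of `h` at `x` along the `j`-th coordinate with smoothing `d`. -/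
def diffQuot {p : ℕ} (o : DiffScheme) (h : EuclideanSpace ℝ (Fin p) → ℝ) (d : ℝ)
    (x : EuclideanSpace ℝ (Fin p)) (j : Fin p) : ℝ :=
  match o with
  | .forward => (h (x + EuclideanSpace.single j d) - h x) / d
  | .central => (h (x + EuclideanSpace.single j d) - h (x - EuclideanSpace.single j d)) / (2 * d)

/-- The zeroth-order coordinate gradient estimator of `h` at `x` on the set `s` of `nc` selected
coordinates: `(p / nc) ∑_{j ∈ s} (difference quotient along j) e_j`. -/
def coordGradEst {p : ℕ} (o : DiffScheme) (nc : ℕ) (h : EuclideanSpace ℝ (Fin p) → ℝ)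
    (d : Fin p → ℝ) (s : Finset (Fin p)) (x : EuclideanSpace ℝ (Fin p)) :
    EuclideanSpace ℝ (Fin p) :=
  ((p : ℝ) / (nc : ℝ)) • ∑ j ∈ s, diffQuot o h (d j) x j • EuclideanSpace.single j (1 : ℝ)

/-- The randomness of the algorithm: agent `i` uses at iteration `k` the sample `ξ i k`, of law
`μ i`, and the set `S i k` of `nc` coordinates, each coordinate being selected with probability
`nc / p`. All these selections are mutually independent. -/
structure IsSampling {n p : ℕ} {Ξ Ω : Type*} [MeasurableSpace Ξ] [MeasurableSpace Ω]
    (P : Measure Ω) (μ : Fin n → Measure Ξ) (nc : ℕ)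
    (ξ : Fin n → ℕ → Ω → Ξ) (S : Fin n → ℕ → Ω → Finset (Fin p)) : Prop where
  measurable_sample : ∀ i k, Measurable (ξ i k)
  measurable_coord : ∀ i k, Measurable (S i k)
  law_sample : ∀ i k, P.map (ξ i k) = μ i
  card_coord : ∀ i k ω, (S i k ω).card = nc
  uniform_coord : ∀ i k j, P.real {ω | j ∈ S i k ω} = (nc : ℝ) / (p : ℝ)
  indep_pair : ∀ i k, IndepFun (ξ i k) (S i k) P
  indep_all : iIndepFun (fun (a : Fin n × ℕ) (ω : Ω) => (ξ a.1 a.2 ω, S a.1 a.2 ω)) P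

/-- The primal-dual iteration: `zodiac L α β η g x₀ v₀ k` is the pair `(x_k, v_k)`, where
`g k x i` is the gradient estimate of agent `i` at iteration `k` if the current primal iterate
is `x`. -/
def zodiac {n p : ℕ} (L : Matrix (Fin n) (Fin n) ℝ) (α β η : ℝ)
    (g : ℕ → (Fin n → EuclideanSpace ℝ (Fin p)) → Fin n → EuclideanSpace ℝ (Fin p))
    (x₀ v₀ : Fin n → EuclideanSpace ℝ (Fin p)) :
    ℕ → (Fin n → EuclideanSpace ℝ (Fin p)) × (Fin n → EuclideanSpace ℝ (Fin p))
  | 0 => (x₀, v₀)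
  | k + 1 =>
    let x := (zodiac L α β η g x₀ v₀ k).1
    let v := (zodiac L α β η g x₀ v₀ k).2
    (fun i => x i - η • (α • (∑ j, L i j • x j) + β • v i + g k x i),
      fun i => v i + (η * β) • ∑ j, L i j • x j)

/-- The primal iterate `x_k` of the algorithm with the random coordinate estimators, as a random
variable. -/
def zodiacX {n p : ℕ} {Ξ Ω : Type*} (L : Matrix (Fin n) (Fin n) ℝ) (α β η : ℝ)
    (F : Fin n → EuclideanSpace ℝ (Fin p) → Ξ → ℝ) (o : DiffScheme) (nc : ℕ)
    (δ : Fin n → Fin p → ℕ → ℝ)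
    (ξ : Fin n → ℕ → Ω → Ξ) (S : Fin n → ℕ → Ω → Finset (Fin p))
    (x₀ v₀ : Fin n → EuclideanSpace ℝ (Fin p)) (k : ℕ) (ω : Ω) :
    Fin n → EuclideanSpace ℝ (Fin p) :=
  (zodiac L α β η
    (fun k x i =>
      coordGradEst o nc (fun y => F i y (ξ i k ω)) (fun j => δ i j k) (S i k ω) (x i))
    x₀ v₀ k).1

/-- The consensus error `(1/n) ∑_i ‖x_i - x̄‖ ^ 2`. -/
def consensusError {n p : ℕ} (x : Fin n → EuclideanSpace ℝ (Fin p)) : ℝ :=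
  (1 / (n : ℝ)) * ∑ i, ‖x i - avg x‖ ^ 2

end

/-! ### The weighted Laplacian of a graph: quadratic form and kernel. -/

section Laplacian

variable {n : ℕ} {G : SimpleGraph (Fin n)} {A : Matrix (Fin n) (Fin n) ℝ}

/-! The iteration splits into the average of the agents and the deviations from it. The columns of
`L` sum to zero and so do the dual variables, hence the average performs a plain stochastic gradient
step, `x̄ - η • avg g` (`avg_zodiac_succ`). For the deviations, let `y` be their stacked vector,
write `v = L u` with a potential `u` (possible because `L` is invertible on zero-sum vectors of a
connected graph), and put `h = η β = κ₂`. Then `y` moves to `y - h L (κ₁ y + u) - η dev g` and `u`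
to `u + h y`: a linear system whose step `h` does not depend on `T`, driven by the estimator. The
quadratic form `½‖y‖² + ⟪y, u⟫ + (1 + κ₁)/2 ⟪u, L u⟫` is a Lyapunov function: its cross terms `⟪y, L
u⟫` cancel to first order in `h`, and the condition on `κ₂` controls the second order. It contracts
by a factor `1 - c` up to a multiple of the squared noise, with constants depending on `κ₁`, `κ₂`,
`ρ`, `ρ₂` only (`exists_lyapunov_contraction`).

Given the current iterate, the estimator of an agent has as mean the vector of difference quotients
of `f_i`, which differs from the gradient by at most `Lf √p δ`, and its second moment is `p` times a
quantity controlled by the gradient and the variance. As the agents sample independently, the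
fluctuation of the averaged estimator carries `1/n²` times the sum of these second moments
(`integral_normSq_avg_sub_le`).

Let `a` be the expected gap, `W` the expected Lyapunov function divided by `n`, `g` the expected
squared gradient norm and `b` the smoothing contribution. Because `η² p = n / T`, these facts become
`W' ≤ (1 - c) W + B (n/T) (1 + a + W + b)` and, if `η Lf ≤ 1`, `a' ≤ a - (η/2) g + η A (W + b) +
(D/T) (1 + a + W + b)`, see `descentRecursion_of_isFreshSample`. What remains concerns real
sequences only.

If `n/T` is small, the potential `a + λ (η + 1/T) W` grows by a factor `1 + E/T` per step, apart
from noise of bounded sum: the feedback of `a` through `W` costs `(η + 1/T) n/T`, which is `O(1/T)`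
because `η n ≤ 1`, that is, because `n³ ≤ p T`. Over `T` steps the factor is at most `exp E`, and
telescoping bounds the sums of `g` and `W` (`exists_bound_of_small_ratio`). If `n/T` exceeds a fixed
`ε`, then `n³ < p T ≤ N T²` forces `T ≤ N / ε³`; the number of iterations is bounded and any
exponential growth estimate is enough (`exists_bound_of_large_ratio`). Both constants see `p/T` only
through an integer `N ≥ p/T`, which is how the function `C` arises. -/

theorem isHermitian_weightedLaplacian (hA : IsWeightedAdjMatrix G A) :
    (weightedLaplacian A).IsHermitian := by
  rw [Matrix.IsHermitian, Matrix.conjTranspose_eq_transpose_of_trivial, weightedLaplacian,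
    Matrix.transpose_sub, Matrix.diagonal_transpose, hA.symm]

theorem weightedLaplacian_mulVec_apply (A : Matrix (Fin n) (Fin n) ℝ) (x : Fin n → ℝ) (i : Fin n) :
    (weightedLaplacian A).mulVec x i = ∑ j, A i j * (x i - x j) := by
  simp only [weightedLaplacian, Matrix.sub_mulVec, Pi.sub_apply, Matrix.mulVec_diagonal, mul_sub,
    Finset.sum_sub_distrib, Finset.sum_mul]
  rfl

theorem two_mul_dotProduct_weightedLaplacian (hA : IsWeightedAdjMatrix G A) (x : Fin n → ℝ) :
    2 * dotProduct x ((weightedLaplacian A).mulVec x) =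
      ∑ i, ∑ j, A i j * (x i - x j) ^ 2 := by
  have h1 : dotProduct x ((weightedLaplacian A).mulVec x) =
      ∑ i, ∑ j, x i * (A i j * (x i - x j)) := by
    simp only [dotProduct, weightedLaplacian_mulVec_apply, Finset.mul_sum]
  have h2 : dotProduct x ((weightedLaplacian A).mulVec x) =
      ∑ i, ∑ j, x j * (A i j * (x j - x i)) := by
    rw [h1, Finset.sum_comm]
    refine Finset.sum_congr rfl fun i _ => Finset.sum_congr rfl fun j _ => ?_
    rw [hA.symm.apply i j]
  rw [two_mul]
  nth_rewrite 1 [h1]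
  rw [h2, ← Finset.sum_add_distrib]
  refine Finset.sum_congr rfl fun i _ => ?_
  rw [← Finset.sum_add_distrib]
  refine Finset.sum_congr rfl fun j _ => ?_
  ring

theorem IsWeightedAdjMatrix.nonneg (hA : IsWeightedAdjMatrix G A) (i j : Fin n) : 0 ≤ A i j := by
  by_cases h : G.Adj i j
  · exact (hA.pos_of_adj i j h).le
  · exact (hA.zero_of_not_adj i j h).ge

theorem dotProduct_weightedLaplacian_nonneg (hA : IsWeightedAdjMatrix G A) (x : Fin n → ℝ) :
    0 ≤ dotProduct x ((weightedLaplacian A).mulVec x) := by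
  have h := two_mul_dotProduct_weightedLaplacian hA x
  have : 0 ≤ ∑ i, ∑ j, A i j * (x i - x j) ^ 2 :=
    Finset.sum_nonneg fun i _ => Finset.sum_nonneg fun j _ =>
      mul_nonneg (hA.nonneg i j) (sq_nonneg _)
  linarith

/-- A vanishing sum of the nonnegative terms `A i j * (x i - x j) ^ 2` makes `x` agree across every
edge, and a walk between two vertices propagates the equality. -/
theorem eq_of_dotProduct_weightedLaplacian_eq_zero (hA : IsWeightedAdjMatrix G A)
    (hG : G.Connected) {x : Fin n → ℝ}
    (hx : dotProduct x ((weightedLaplacian A).mulVec x) = 0) (i j : Fin n) : x i = x j := by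
  have h := two_mul_dotProduct_weightedLaplacian hA x
  rw [hx, mul_zero] at h
  have hadj : ∀ a b, G.Adj a b → x a = x b := by
    intro a b hab
    have h1 := (Finset.sum_eq_zero_iff_of_nonneg (fun i _ => Finset.sum_nonneg fun j _ =>
      mul_nonneg (hA.nonneg i j) (sq_nonneg (x i - x j)))).1 h.symm a (Finset.mem_univ _)
    have h2 := (Finset.sum_eq_zero_iff_of_nonneg (fun j _ =>
      mul_nonneg (hA.nonneg a j) (sq_nonneg (x a - x j)))).1 h1 b (Finset.mem_univ _)
    rcases mul_eq_zero.1 h2 with h3 | h3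
    · exact absurd h3 (hA.pos_of_adj a b hab).ne'
    · exact sub_eq_zero.1 (pow_eq_zero_iff two_ne_zero |>.1 h3)
  obtain ⟨w⟩ := hG.preconnected i j
  induction w with
  | nil => rfl
  | cons h _ ih => exact (hadj _ _ h).trans ih

theorem sum_weightedLaplacian_mulVec (hA : IsWeightedAdjMatrix G A) (x : Fin n → ℝ) :
    ∑ i, (weightedLaplacian A).mulVec x i = 0 := by
  simp only [weightedLaplacian_mulVec_apply]
  have : ∑ i, ∑ j, A i j * (x i - x j) = -∑ i, ∑ j, A i j * (x i - x j) := by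
    rw [← Finset.sum_neg_distrib, Finset.sum_comm]
    refine Finset.sum_congr rfl fun i _ => ?_
    rw [← Finset.sum_neg_distrib]
    refine Finset.sum_congr rfl fun j _ => ?_
    rw [hA.symm.apply i j]
    ring
  linarith

end Laplacian

/-! ### Eigenbasis expansions and the spectral radius of a symmetric matrix. -/

section Spectral

variable {n : ℕ} {M : Matrix (Fin n) (Fin n) ℝ}

theorem dotProduct_eq_sum_eigenvectorBasis (hM : M.IsHermitian) (x y : Fin n → ℝ) :
    dotProduct x y = ∑ i, dotProduct (hM.eigenvectorBasis i).ofLp x *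
      dotProduct (hM.eigenvectorBasis i).ofLp y := by
  have h := hM.eigenvectorBasis.sum_inner_mul_inner (WithLp.toLp 2 x) (WithLp.toLp 2 y)
  simp only [EuclideanSpace.inner_eq_star_dotProduct, star_trivial] at h
  rw [dotProduct_comm, ← h]
  refine Finset.sum_congr rfl fun i _ => ?_
  rw [dotProduct_comm y]

theorem dotProduct_eigenvectorBasis_mulVec (hM : M.IsHermitian) (x : Fin n → ℝ) (i : Fin n) :
    dotProduct (hM.eigenvectorBasis i).ofLp (M.mulVec x) =
      hM.eigenvalues i * dotProduct (hM.eigenvectorBasis i).ofLp x := by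
  have hs : M.transpose = M := by
    rw [← Matrix.conjTranspose_eq_transpose_of_trivial]; exact hM
  rw [Matrix.dotProduct_mulVec, ← Matrix.mulVec_transpose, hs, hM.mulVec_eigenvectorBasis,
    smul_dotProduct, smul_eq_mul]

theorem eigenvalues_eq_dotProduct (hM : M.IsHermitian) (i : Fin n) :
    hM.eigenvalues i = dotProduct (hM.eigenvectorBasis i).ofLp
      (M.mulVec (hM.eigenvectorBasis i).ofLp) := by
  have h : dotProduct (hM.eigenvectorBasis i).ofLp (hM.eigenvectorBasis i).ofLp = 1 := by
    have h2 := hM.eigenvectorBasis.inner_eq_one i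
    rwa [EuclideanSpace.inner_eq_star_dotProduct, star_trivial] at h2
  rw [dotProduct_eigenvectorBasis_mulVec, h, mul_one]

theorem abs_le_specRad (hM : M.IsHermitian) {l : ℝ} (hl : l ∈ spectrum ℝ M) : |l| ≤ specRad M := by
  -- `specRad` is a `toReal`, which would be `0` at `∞`, so finiteness has to come first.
  have hfin : spectralRadius ℝ M ≠ ∞ := by
    have hs := hM.spectrum_real_eq_range_eigenvalues
    have hb : spectralRadius ℝ M ≤ ∑ i, (‖hM.eigenvalues i‖₊ : ℝ≥0∞) := by
      refine iSup₂_le fun k hk => ?_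
      rw [hs] at hk
      obtain ⟨i, rfl⟩ := hk
      exact Finset.single_le_sum (f := fun i => (‖hM.eigenvalues i‖₊ : ℝ≥0∞))
        (fun _ _ => zero_le) (Finset.mem_univ i)
    refine ne_top_of_le_ne_top ?_ hb
    exact ENNReal.sum_ne_top.2 fun i _ => ENNReal.coe_ne_top
  have h1 : (‖l‖₊ : ℝ≥0∞) ≤ spectralRadius ℝ M :=
    le_iSup₂ (f := fun k (_ : k ∈ spectrum ℝ M) => (‖k‖₊ : ℝ≥0∞)) l hl
  have h2 := ENNReal.toReal_mono hfin h1
  simpa [specRad] using h2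

/-- The admissible range of `κ₂` involves the spectral radius of `L * L`, while the Lyapunov
estimate uses the square of that of `L`; only this direction is needed. It holds because the square
of an eigenvalue of largest modulus lies in the spectrum of `M * M`. -/
theorem specRad_sq_le (hM : M.IsHermitian) (hn : 0 < n) :
    specRad M ^ 2 ≤ specRad (M * M) := by
  have : Nonempty (Fin n) := ⟨⟨0, hn⟩⟩
  have hs := hM.spectrum_real_eq_range_eigenvalues
  have hMM : (M * M).IsHermitian := by
    rw [Matrix.IsHermitian, Matrix.conjTranspose_mul, hM]
  have hmem : ∀ i, hM.eigenvalues i ^ 2 ∈ spectrum ℝ (M * M) := by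
    intro i
    have h := spectrum.pow_mem_pow (𝕜 := ℝ) M 2
      (show hM.eigenvalues i ∈ spectrum ℝ M by rw [hs]; exact ⟨i, rfl⟩)
    rwa [pow_two M] at h
  obtain ⟨i, hi⟩ := Finite.exists_max (fun i => |hM.eigenvalues i|)
  have h1 : specRad M ≤ |hM.eigenvalues i| := by
    rw [specRad]
    refine ENNReal.toReal_le_of_le_ofReal (abs_nonneg _) ?_
    refine iSup₂_le fun k hk => ?_
    rw [hs] at hk
    obtain ⟨j, rfl⟩ := hk
    rw [← enorm_eq_nnnorm, ← ofReal_norm, Real.norm_eq_abs]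
    exact ENNReal.ofReal_le_ofReal (hi j)
  have h2 := abs_le_specRad hMM (hmem i)
  have h0 : 0 ≤ specRad M := ENNReal.toReal_nonneg
  calc specRad M ^ 2 ≤ |hM.eigenvalues i| ^ 2 := by gcongr
    _ ≤ _ := by rwa [abs_pow] at h2

end Spectral

/-! ### The spectral gap of the Laplacian of a connected graph. -/

section LaplacianSpectrum

variable {n : ℕ} {G : SimpleGraph (Fin n)} {A : Matrix (Fin n) (Fin n) ℝ}

theorem eigenvalues_weightedLaplacian_nonneg (hA : IsWeightedAdjMatrix G A) (i : Fin n) :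
    0 ≤ (isHermitian_weightedLaplacian hA).eigenvalues i := by
  rw [eigenvalues_eq_dotProduct]
  exact dotProduct_weightedLaplacian_nonneg hA _

theorem minPosEigenvalue_pos (hA : IsWeightedAdjMatrix G A) (hG : G.Connected) (hn : 2 ≤ n) :
    0 < minPosEigenvalue (weightedLaplacian A) := by
  have hH := isHermitian_weightedLaplacian hA
  have hs := hH.spectrum_real_eq_range_eigenvalues
  set S := {l : ℝ | l ∈ spectrum ℝ (weightedLaplacian A) ∧ 0 < l} with hS
  have hfin : S.Finite := by
    refine Set.Finite.subset (s := spectrum ℝ (weightedLaplacian A)) ?_ fun l hl => hl.1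
    rw [hs]
    exact Set.finite_range _
  -- An infimum over the empty set would be `0`. If no eigenvalue were positive, the quadratic form
  -- would vanish identically, and the indicator of a single vertex would have to be constant.
  have hne : S.Nonempty := by
    by_contra hcon
    have h0 : ∀ i, hH.eigenvalues i = 0 := by
      intro i
      refine le_antisymm ?_ (eigenvalues_weightedLaplacian_nonneg hA i)
      by_contra hlt
      exact hcon ⟨hH.eigenvalues i, by rw [hs]; exact ⟨i, rfl⟩, not_le.1 hlt⟩
    let a : Fin n := ⟨0, by omega⟩
    let b : Fin n := ⟨1, by omega⟩
    have hz : dotProduct (Pi.single a (1 : ℝ))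
        ((weightedLaplacian A).mulVec (Pi.single a (1 : ℝ))) = 0 := by
      rw [dotProduct_eq_sum_eigenvectorBasis hH]
      refine Finset.sum_eq_zero fun i _ => ?_
      rw [dotProduct_eigenvectorBasis_mulVec, h0, zero_mul, mul_zero]
    have hab := eq_of_dotProduct_weightedLaplacian_eq_zero hA hG hz a b
    have hne : b ≠ a := by simp [a, b, Fin.ext_iff]
    rw [Pi.single_eq_same, Pi.single_eq_of_ne hne] at hab
    exact one_ne_zero hab
  exact (hne.csInf_mem hfin).2

/-- In the eigenbasis, eigenvectors with eigenvalue `0` are constant and hence orthogonal to a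
zero-sum `x`; all other eigenvalues are at least the least positive one. -/
theorem minPosEigenvalue_mul_le (hA : IsWeightedAdjMatrix G A) (hG : G.Connected)
    {x : Fin n → ℝ} (hx : ∑ i, x i = 0) :
    minPosEigenvalue (weightedLaplacian A) * dotProduct x x ≤
      dotProduct x ((weightedLaplacian A).mulVec x) := by
  have hH := isHermitian_weightedLaplacian hA
  have hs := hH.spectrum_real_eq_range_eigenvalues
  rw [dotProduct_eq_sum_eigenvectorBasis hH x x,
    dotProduct_eq_sum_eigenvectorBasis hH x ((weightedLaplacian A).mulVec x), Finset.mul_sum]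
  refine Finset.sum_le_sum fun i _ => ?_
  rw [dotProduct_eigenvectorBasis_mulVec]
  rcases (eigenvalues_weightedLaplacian_nonneg hA i).eq_or_lt with h0 | hpos
  · have hz : dotProduct (hH.eigenvectorBasis i).ofLp x = 0 := by
      have hc := eq_of_dotProduct_weightedLaplacian_eq_zero hA hG
        ((eigenvalues_eq_dotProduct hH i).symm.trans h0.symm)
      rw [dotProduct, Finset.sum_congr rfl fun j _ => by rw [hc j i], ← Finset.mul_sum, hx,
        mul_zero]
    rw [hz]
    simp
  · have hle : minPosEigenvalue (weightedLaplacian A) ≤ hH.eigenvalues i :=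
      csInf_le ⟨0, fun l hl => hl.2.le⟩ ⟨by rw [hs]; exact ⟨i, rfl⟩, hpos⟩
    nlinarith [mul_self_nonneg (dotProduct (hH.eigenvectorBasis i).ofLp x)]

theorem eigenvalues_weightedLaplacian_le (hA : IsWeightedAdjMatrix G A) (i : Fin n) :
    (isHermitian_weightedLaplacian hA).eigenvalues i ≤ specRad (weightedLaplacian A) := by
  have hH := isHermitian_weightedLaplacian hA
  have hs := hH.spectrum_real_eq_range_eigenvalues
  exact (le_abs_self _).trans (abs_le_specRad hH (by rw [hs]; exact ⟨i, rfl⟩))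

theorem dotProduct_weightedLaplacian_le (hA : IsWeightedAdjMatrix G A) (x : Fin n → ℝ) :
    dotProduct x ((weightedLaplacian A).mulVec x) ≤
      specRad (weightedLaplacian A) * dotProduct x x := by
  have hH := isHermitian_weightedLaplacian hA
  rw [dotProduct_eq_sum_eigenvectorBasis hH x x,
    dotProduct_eq_sum_eigenvectorBasis hH x ((weightedLaplacian A).mulVec x), Finset.mul_sum]
  refine Finset.sum_le_sum fun i _ => ?_
  rw [dotProduct_eigenvectorBasis_mulVec]
  nlinarith [mul_self_nonneg (dotProduct (hH.eigenvectorBasis i).ofLp x),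
    eigenvalues_weightedLaplacian_le hA i]

theorem dotProduct_weightedLaplacian_self_le (hA : IsWeightedAdjMatrix G A) (x : Fin n → ℝ) :
    dotProduct ((weightedLaplacian A).mulVec x) ((weightedLaplacian A).mulVec x) ≤
      specRad (weightedLaplacian A) * dotProduct x ((weightedLaplacian A).mulVec x) := by
  have hH := isHermitian_weightedLaplacian hA
  rw [dotProduct_eq_sum_eigenvectorBasis hH ((weightedLaplacian A).mulVec x)
      ((weightedLaplacian A).mulVec x),
    dotProduct_eq_sum_eigenvectorBasis hH x ((weightedLaplacian A).mulVec x), Finset.mul_sum]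
  refine Finset.sum_le_sum fun i _ => ?_
  rw [dotProduct_eigenvectorBasis_mulVec]
  have h0 := eigenvalues_weightedLaplacian_nonneg hA i
  have h1 := eigenvalues_weightedLaplacian_le hA i
  have h2 := mul_nonneg h0 (mul_self_nonneg (dotProduct (hH.eigenvectorBasis i).ofLp x))
  nlinarith

/-- The spectral gap makes the Laplacian injective on the finite-dimensional space of zero-sum
vectors, hence surjective there. This provides the potential of the dual variables. -/
theorem exists_weightedLaplacian_mulVec_eq (hA : IsWeightedAdjMatrix G A) (hG : G.Connected)
    (hn : 2 ≤ n) {v : Fin n → ℝ} (hv : ∑ i, v i = 0) :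
    ∃ u : Fin n → ℝ, ∑ i, u i = 0 ∧ (weightedLaplacian A).mulVec u = v := by
  let K : Submodule ℝ (Fin n → ℝ) :=
    { carrier := {x | ∑ i, x i = 0}
      add_mem' := fun {a b} ha hb => by
        simp only [Set.mem_ofPred_eq, Pi.add_apply, Finset.sum_add_distrib] at *
        rw [ha, hb, add_zero]
      zero_mem' := by simp
      smul_mem' := fun c x hx => by
        simp only [Set.mem_ofPred_eq, Pi.smul_apply, smul_eq_mul, ← Finset.mul_sum] at *
        rw [hx, mul_zero] }
  let T : K →ₗ[ℝ] K := ((weightedLaplacian A).mulVecLin.restrict (p := K) (q := K)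
    fun x _ => sum_weightedLaplacian_mulVec hA x)
  have hinj : Function.Injective T := by
    rw [injective_iff_map_eq_zero]
    rintro ⟨x, hx⟩ h
    have h1 : (weightedLaplacian A).mulVec x = 0 := congrArg Subtype.val h
    have h2 := minPosEigenvalue_mul_le hA hG hx
    rw [h1, dotProduct_zero] at h2
    have h3 : dotProduct x x ≤ 0 := by
      by_contra hcon
      exact absurd h2 (not_le.2 (mul_pos (minPosEigenvalue_pos hA hG hn) (not_le.1 hcon)))
    have h4 : dotProduct x x = 0 :=
      le_antisymm h3 (Finset.sum_nonneg fun i _ => mul_self_nonneg (x i))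
    exact Subtype.ext (dotProduct_self_eq_zero.1 h4)
  obtain ⟨u, hu⟩ := LinearMap.injective_iff_surjective.1 hinj ⟨v, hv⟩
  exact ⟨u.1, u.2, congrArg Subtype.val hu⟩

end LaplacianSpectrum

/-! ### The Laplacian acting on stacked vectors. -/

section BlockLaplacian

/-- The stacked vectors `(x_1, …, x_n)` with `x_i ∈ ℝ^p`. -/
abbrev BlockVec (n p : ℕ) : Type := PiLp 2 (fun _ : Fin n => EuclideanSpace ℝ (Fin p))

variable {n p : ℕ}

/-- The action `x ↦ (L ⊗ I) x` of a matrix on stacked vectors. -/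
def blockMap (L : Matrix (Fin n) (Fin n) ℝ) : BlockVec n p →ₗ[ℝ] BlockVec n p where
  toFun x := WithLp.toLp 2 fun i => ∑ j, L i j • x j
  map_add' x y := by
    ext1 i
    simp [smul_add, Finset.sum_add_distrib]
  map_smul' c x := by
    ext1 i
    simp only [PiLp.smul_apply, RingHom.id_apply, Finset.smul_sum]
    exact Finset.sum_congr rfl fun j _ => smul_comm _ _ _

theorem blockMap_apply (L : Matrix (Fin n) (Fin n) ℝ) (x : BlockVec n p) (i : Fin n) :
    blockMap L x i = ∑ j, L i j • x j := rfl

theorem blockMap_apply_apply (L : Matrix (Fin n) (Fin n) ℝ) (x : BlockVec n p) (k : Fin p)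
    (i : Fin n) : blockMap L x i k = L.mulVec (fun j => x j k) i := by
  rw [blockMap_apply]
  simp [Matrix.mulVec, dotProduct]

theorem inner_blockVec_eq_sum (x y : BlockVec n p) :
    inner ℝ x y = ∑ k, dotProduct (fun i => x i k) (fun i => y i k) := by
  rw [PiLp.inner_apply]
  simp only [EuclideanSpace.inner_eq_star_dotProduct, star_trivial, dotProduct]
  rw [Finset.sum_comm]
  exact Finset.sum_congr rfl fun k _ => Finset.sum_congr rfl fun i _ => mul_comm _ _

/-- The `p` coordinates decouple, so each spectral estimate on stacked vectors is a sum of scalar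
ones. -/
theorem inner_blockMap_eq_sum (L : Matrix (Fin n) (Fin n) ℝ) (x y : BlockVec n p) :
    inner ℝ x (blockMap L y) =
      ∑ k, dotProduct (fun i => x i k) (L.mulVec fun i => y i k) := by
  rw [inner_blockVec_eq_sum]
  exact Finset.sum_congr rfl fun k _ => by simp only [blockMap_apply_apply]

variable {G : SimpleGraph (Fin n)} {A : Matrix (Fin n) (Fin n) ℝ}

theorem inner_blockMap_comm (hA : IsWeightedAdjMatrix G A) (x y : BlockVec n p) :
    inner ℝ x (blockMap (weightedLaplacian A) y) =
      inner ℝ y (blockMap (weightedLaplacian A) x) := by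
  have hs : (weightedLaplacian A).transpose = weightedLaplacian A := by
    rw [← Matrix.conjTranspose_eq_transpose_of_trivial]
    exact isHermitian_weightedLaplacian hA
  simp only [inner_blockMap_eq_sum]
  refine Finset.sum_congr rfl fun k _ => ?_
  rw [Matrix.dotProduct_mulVec, ← Matrix.mulVec_transpose, hs, dotProduct_comm]

theorem sum_blockMap (hA : IsWeightedAdjMatrix G A) (x : BlockVec n p) :
    ∑ i, blockMap (weightedLaplacian A) x i = 0 := by
  ext k
  rw [WithLp.ofLp_sum, Finset.sum_apply]
  simp only [blockMap_apply_apply]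
  exact sum_weightedLaplacian_mulVec hA _

theorem blockMap_const (A : Matrix (Fin n) (Fin n) ℝ) (c : EuclideanSpace ℝ (Fin p)) :
    blockMap (weightedLaplacian A) (WithLp.toLp 2 fun _ => c) = 0 := by
  ext i k
  rw [blockMap_apply_apply, weightedLaplacian_mulVec_apply]
  simp

theorem sum_apply_eq_zero {x : BlockVec n p} (hx : ∑ i, x i = 0) (k : Fin p) :
    ∑ i, x i k = 0 := by
  have h := congrArg (fun z : EuclideanSpace ℝ (Fin p) => z k) hx
  simpa [WithLp.ofLp_sum, Finset.sum_apply] using h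

theorem minPosEigenvalue_mul_normSq_le (hA : IsWeightedAdjMatrix G A) (hG : G.Connected)
    {x : BlockVec n p} (hx : ∑ i, x i = 0) :
    minPosEigenvalue (weightedLaplacian A) * ‖x‖ ^ 2 ≤
      inner ℝ x (blockMap (weightedLaplacian A) x) := by
  rw [← real_inner_self_eq_norm_sq, inner_blockMap_eq_sum, inner_blockVec_eq_sum, Finset.mul_sum]
  exact Finset.sum_le_sum fun k _ => minPosEigenvalue_mul_le hA hG (sum_apply_eq_zero hx k)

theorem inner_blockMap_le (hA : IsWeightedAdjMatrix G A) (x : BlockVec n p) :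
    inner ℝ x (blockMap (weightedLaplacian A) x) ≤ specRad (weightedLaplacian A) * ‖x‖ ^ 2 := by
  rw [← real_inner_self_eq_norm_sq, inner_blockMap_eq_sum, inner_blockVec_eq_sum, Finset.mul_sum]
  exact Finset.sum_le_sum fun k _ => dotProduct_weightedLaplacian_le hA _

theorem normSq_blockMap_le (hA : IsWeightedAdjMatrix G A) (x : BlockVec n p) :
    ‖blockMap (weightedLaplacian A) x‖ ^ 2 ≤
      specRad (weightedLaplacian A) * inner ℝ x (blockMap (weightedLaplacian A) x) := by
  rw [← real_inner_self_eq_norm_sq, inner_blockMap_eq_sum, inner_blockVec_eq_sum, Finset.mul_sum]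
  refine Finset.sum_le_sum fun k _ => ?_
  simp only [blockMap_apply_apply]
  exact dotProduct_weightedLaplacian_self_le hA _

theorem exists_blockMap_eq (hA : IsWeightedAdjMatrix G A) (hG : G.Connected) (hn : 2 ≤ n)
    {v : BlockVec n p} (hv : ∑ i, v i = 0) :
    ∃ u : BlockVec n p, ∑ i, u i = 0 ∧ blockMap (weightedLaplacian A) u = v := by
  choose u hu0 hu using fun k =>
    exists_weightedLaplacian_mulVec_eq hA hG hn (sum_apply_eq_zero hv k)
  refine ⟨WithLp.toLp 2 fun i => WithLp.toLp 2 fun k => u k i, ?_, ?_⟩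
  · ext k
    rw [WithLp.ofLp_sum, Finset.sum_apply]
    exact hu0 k
  · ext i k
    rw [blockMap_apply_apply]
    exact congrFun (hu k) i

end BlockLaplacian

/-! ### Functions with Lipschitz gradient and their difference quotients. -/

section Smooth

variable {p : ℕ} {c : ℝ} {g : EuclideanSpace ℝ (Fin p) → ℝ}

theorem IsSmoothWith.hasDerivAt_line (hg : IsSmoothWith c g) (x h : EuclideanSpace ℝ (Fin p))
    (t : ℝ) : HasDerivAt (fun t : ℝ => g (x + t • h)) (inner ℝ (∇ g (x + t • h)) h) t := by
  have h1 : HasDerivAt (fun t : ℝ => x + t • h) h t := by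
    simpa using ((hasDerivAt_id t).smul_const h).const_add x
  rw [inner_gradient_left]
  exact (hg.1 (x + t • h)).hasFDerivAt.comp_hasDerivAt t h1

theorem IsSmoothWith.upper (hg : IsSmoothWith c g) (x h : EuclideanSpace ℝ (Fin p)) :
    g (x + h) ≤ g x + inner ℝ (∇ g x) h + c / 2 * ‖h‖ ^ 2 := by
  -- The value of `g` along the segment minus its quadratic upper model, up to a constant; the
  -- Lipschitz bound makes the derivative nonpositive on `(0, 1)`.
  let φ : ℝ → ℝ := fun t => g (x + t • h) - t * inner ℝ (∇ g x) h - c / 2 * ‖h‖ ^ 2 * t ^ 2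
  have hφ : ∀ t, HasDerivAt φ (inner ℝ (∇ g (x + t • h)) h - inner ℝ (∇ g x) h
      - c * ‖h‖ ^ 2 * t) t := by
    intro t
    have h1 := ((hg.hasDerivAt_line x h t).sub
      ((hasDerivAt_id t).mul_const (inner ℝ (∇ g x) h))).sub
      ((hasDerivAt_pow 2 t).const_mul (c / 2 * ‖h‖ ^ 2))
    refine h1.congr_deriv ?_
    simp
    ring
  have hanti : AntitoneOn φ (Set.Icc 0 1) := by
    refine antitoneOn_of_deriv_nonpos (convex_Icc 0 1)
      (fun t _ => (hφ t).continuousAt.continuousWithinAt)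
      (fun t _ => (hφ t).differentiableAt.differentiableWithinAt) fun t ht => ?_
    rw [interior_Icc] at ht
    rw [(hφ t).deriv, ← inner_sub_left]
    have h1 := real_inner_le_norm (∇ g (x + t • h) - ∇ g x) h
    have h2 := hg.2 (x + t • h) x
    rw [add_sub_cancel_left, norm_smul, Real.norm_eq_abs, abs_of_pos ht.1] at h2
    nlinarith [mul_le_mul_of_nonneg_right h2 (norm_nonneg h)]
  have h01 := hanti (Set.left_mem_Icc.2 zero_le_one) (Set.right_mem_Icc.2 zero_le_one) zero_le_one
  simp only [φ, one_smul, zero_smul, add_zero] at h01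
  linarith

theorem IsSmoothWith.neg (hg : IsSmoothWith c g) : IsSmoothWith c (fun x => -g x) := by
  have h : ∀ x, ∇ (fun x => -g x) x = -∇ g x := by
    intro x
    have h1 := (hg.1 x).hasGradientAt.hasFDerivAt.neg
    refine HasGradientAt.gradient (hasGradientAt_iff_hasFDerivAt.2 ?_)
    rw [map_neg]
    exact h1
  refine ⟨hg.1.neg, fun x y => ?_⟩
  rw [h, h, neg_sub_neg, norm_sub_rev]
  exact hg.2 x y

theorem IsSmoothWith.abs_sub_le (hg : IsSmoothWith c g) (x h : EuclideanSpace ℝ (Fin p)) :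
    |g (x + h) - g x - inner ℝ (∇ g x) h| ≤ c / 2 * ‖h‖ ^ 2 := by
  have h1 := hg.upper x h
  have h2 := hg.neg.upper x h
  have h3 : ∇ (fun x => -g x) x = -∇ g x := by
    refine HasGradientAt.gradient (hasGradientAt_iff_hasFDerivAt.2 ?_)
    rw [map_neg]
    exact (hg.1 x).hasGradientAt.hasFDerivAt.neg
  rw [h3, inner_neg_left] at h2
  rw [abs_le]
  constructor <;> linarith

theorem IsSmoothWith.continuous_gradient (hg : IsSmoothWith c g) : Continuous (∇ g) := by
  refine (LipschitzWith.of_dist_le_mul (K := c.toNNReal) fun x y => ?_).continuous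
  rw [dist_eq_norm, dist_eq_norm]
  exact (hg.2 x y).trans (mul_le_mul_of_nonneg_right (Real.le_coe_toNNReal c) (norm_nonneg _))

/-- One gradient step of length `1 / c` lowers `g` by at least `‖∇ g x‖ ^ 2 / (2 * c)`, yet cannot
go below `m`. -/
theorem IsSmoothWith.normSq_gradient_le (hg : IsSmoothWith c g) (hc : 0 < c) {m : ℝ}
    (hm : ∀ x, m ≤ g x) (x : EuclideanSpace ℝ (Fin p)) : ‖∇ g x‖ ^ 2 ≤ 2 * c * (g x - m) := by
  have h1 := hg.upper x (-(1 / c) • ∇ g x)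
  have h2 := hm (x + -(1 / c) • ∇ g x)
  rw [inner_smul_right, real_inner_self_eq_norm_sq, norm_smul, mul_pow, Real.norm_eq_abs,
    sq_abs] at h1
  have h3 : c / 2 * ((-(1 / c)) ^ 2 * ‖∇ g x‖ ^ 2) = 1 / (2 * c) * ‖∇ g x‖ ^ 2 := by
    field_simp
  have h4 : -(1 / c) * ‖∇ g x‖ ^ 2 = -2 * (1 / (2 * c) * ‖∇ g x‖ ^ 2) := by
    field_simp
  have h5 : 1 / (2 * c) * ‖∇ g x‖ ^ 2 ≤ g x - m := by linarith
  rw [div_mul_eq_mul_div, one_mul, div_le_iff₀ (by positivity)] at h5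
  linarith

/-- A quadratic remainder identifies the candidate `G` as the gradient. Since such remainder bounds
survive integration and averaging, smoothness passes to `f_i` and `f` without differentiating under
the integral sign. -/
theorem isSmoothWith_of_abs_sub_le {G : EuclideanSpace ℝ (Fin p) → EuclideanSpace ℝ (Fin p)}
    (h : ∀ x d, |g (x + d) - g x - inner ℝ (G x) d| ≤ c / 2 * ‖d‖ ^ 2)
    (hG : ∀ x y, ‖G x - G y‖ ≤ c * ‖x - y‖) : IsSmoothWith c g ∧ ∀ x, ∇ g x = G x := by
  have hgrad : ∀ x, HasGradientAt g (G x) x := by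
    intro x
    rw [hasGradientAt_iff_isLittleO_nhds_zero]
    refine Asymptotics.IsBigO.trans_isLittleO (g := fun d => ‖d‖ ^ 2) ?_ ?_
    · refine Asymptotics.IsBigO.of_bound (c / 2) (Filter.Eventually.of_forall fun d => ?_)
      rw [Real.norm_eq_abs, Real.norm_eq_abs, abs_of_nonneg (sq_nonneg ‖d‖)]
      exact h x d
    · exact (Asymptotics.isLittleO_norm_pow_id one_lt_two)
  refine ⟨⟨fun x => (hgrad x).differentiableAt, fun x y => ?_⟩, fun x => (hgrad x).gradient⟩
  rw [(hgrad x).gradient, (hgrad y).gradient]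
  exact hG x y

/-- One remainder divided by `d`, or two divided by `2 * d`: both schemes give the same bound. -/
theorem IsSmoothWith.abs_diffQuot_sub_le (hg : IsSmoothWith c g) (o : DiffScheme) {d : ℝ}
    (hd : 0 < d) (x : EuclideanSpace ℝ (Fin p)) (j : Fin p) :
    |diffQuot o g d x j - ∇ g x j| ≤ c / 2 * d := by
  have hi : ∀ t : ℝ, inner ℝ (∇ g x) (EuclideanSpace.single j t) = t * ∇ g x j := by
    intro t
    rw [EuclideanSpace.inner_single_right]
    simp
  have hn : ∀ t : ℝ, ‖(EuclideanSpace.single j t : EuclideanSpace ℝ (Fin p))‖ ^ 2 = t ^ 2 := by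
    intro t
    rw [PiLp.norm_single, Real.norm_eq_abs, sq_abs]
  have h1 := hg.abs_sub_le x (EuclideanSpace.single j d)
  rw [hi, hn] at h1
  cases o with
  | forward =>
    have : diffQuot .forward g d x j - ∇ g x j =
        (g (x + EuclideanSpace.single j d) - g x - d * ∇ g x j) / d := by
      simp only [diffQuot]
      field_simp
    rw [this, abs_div, abs_of_pos hd, div_le_iff₀ hd]
    calc _ ≤ _ := h1
      _ = _ := by ring
  | central =>
    have h2 := hg.abs_sub_le x (EuclideanSpace.single j (-d))
    rw [hi, hn] at h2
    have hneg : x - EuclideanSpace.single j d = x + EuclideanSpace.single j (-d) := by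
      rw [sub_eq_add_neg]
      congr 1
      ext i
      by_cases hij : i = j <;> simp [hij]
    have : diffQuot .central g d x j - ∇ g x j =
        ((g (x + EuclideanSpace.single j d) - g x - d * ∇ g x j) -
          (g (x + EuclideanSpace.single j (-d)) - g x - -d * ∇ g x j)) / (2 * d) := by
      simp only [diffQuot, hneg]
      field_simp
      ring
    rw [this, abs_div, abs_of_pos (by positivity : 0 < 2 * d), div_le_iff₀ (by positivity)]
    refine (abs_sub _ _).trans ?_
    calc _ ≤ c / 2 * d ^ 2 + c / 2 * (-d) ^ 2 := add_le_add h1 h2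
      _ = _ := by ring

/-- The vector of all the difference quotients. -/
noncomputable def fullGradEst (o : DiffScheme) (h : EuclideanSpace ℝ (Fin p) → ℝ) (d : Fin p → ℝ)
    (x : EuclideanSpace ℝ (Fin p)) : EuclideanSpace ℝ (Fin p) :=
  WithLp.toLp 2 fun j => diffQuot o h (d j) x j

theorem IsSmoothWith.normSq_fullGradEst_sub_le (hg : IsSmoothWith c g) (o : DiffScheme) {D : ℝ}
    {d : Fin p → ℝ} (hd : ∀ j, 0 < d j) (hD : ∀ j, d j ^ 2 ≤ D) (x : EuclideanSpace ℝ (Fin p)) :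
    ‖fullGradEst o g d x - ∇ g x‖ ^ 2 ≤ c ^ 2 * (p * D) := by
  rw [EuclideanSpace.norm_sq_eq]
  calc ∑ j, ‖(fullGradEst o g d x - ∇ g x) j‖ ^ 2 ≤ ∑ _j : Fin p, c ^ 2 * D := by
        refine Finset.sum_le_sum fun j _ => ?_
        have h1 := hg.abs_diffQuot_sub_le o (hd j) x j
        have h2 : ‖(fullGradEst o g d x - ∇ g x) j‖ ≤ c / 2 * d j := h1
        calc _ ≤ (c / 2 * d j) ^ 2 := by gcongr
          _ = c ^ 2 / 4 * d j ^ 2 := by ring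
          _ ≤ c ^ 2 / 4 * D := by gcongr; exact hD j
          _ ≤ c ^ 2 * D := by
            have := mul_nonneg (sq_nonneg c) ((sq_nonneg _).trans (hD j))
            nlinarith
    _ = _ := by simp; ring

end Smooth

/-! ### Smoothness of the expected local costs. -/

section LocalCost

variable {p : ℕ} {Ξ : Type*} [MeasurableSpace Ξ] {c : ℝ}
  {F : EuclideanSpace ℝ (Fin p) → Ξ → ℝ} {μ : Measure Ξ}

theorem integrable_diffQuot (hi : ∀ x, Integrable (F x) μ) (o : DiffScheme) (d : ℝ)
    (x : EuclideanSpace ℝ (Fin p)) (j : Fin p) :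
    Integrable (fun z => diffQuot o (fun y => F y z) d x j) μ := by
  cases o with
  | forward => exact ((hi _).sub (hi _)).div_const d
  | central => exact ((hi _).sub (hi _)).div_const (2 * d)

theorem integral_diffQuot (hi : ∀ x, Integrable (F x) μ) (o : DiffScheme) (d : ℝ)
    (x : EuclideanSpace ℝ (Fin p)) (j : Fin p) :
    ∫ z, diffQuot o (fun y => F y z) d x j ∂μ = diffQuot o (localCost F μ) d x j := by
  cases o with
  | forward =>
    simp only [diffQuot, localCost]
    rw [integral_div, integral_sub (hi _) (hi _)]
  | central =>
    simp only [diffQuot, localCost]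
    rw [integral_div, integral_sub (hi _) (hi _)]

theorem integrable_fullGradEst (hi : ∀ x, Integrable (F x) μ) (o : DiffScheme) (d : Fin p → ℝ)
    (x : EuclideanSpace ℝ (Fin p)) :
    Integrable (fun z => fullGradEst o (fun y => F y z) d x) μ := by
  have h : (fun z => fullGradEst o (fun y => F y z) d x) =
      fun z => ∑ j, diffQuot o (fun y => F y z) (d j) x j • EuclideanSpace.single j (1 : ℝ) := by
    funext z
    ext k
    simp [fullGradEst, WithLp.ofLp_sum, Finset.sum_apply, Pi.single_apply]
  rw [h]
  exact integrable_finsetSum _ fun j _ => (integrable_diffQuot hi o (d j) x j).smul_const _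

/-- Measurability in `z` comes from writing the gradient as an almost sure limit of difference
quotients with step `1 / (m + 1)`, integrability from its bounded distance to the quotients with
step `1`. -/
theorem integrable_gradient [IsFiniteMeasure μ] (hi : ∀ x, Integrable (F x) μ)
    (hs : ∀ᵐ z ∂μ, IsSmoothWith c (fun x => F x z)) (x : EuclideanSpace ℝ (Fin p)) :
    Integrable (fun z => ∇ (fun y => F y z) x) μ := by
  have hbd : ∀ t : ℝ, 0 < t → ∀ᵐ z ∂μ,
      ‖fullGradEst .forward (fun y => F y z) (fun _ => t) x - ∇ (fun y => F y z) x‖ ≤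
        √(c ^ 2 * (p * t ^ 2)) := by
    intro t ht
    filter_upwards [hs] with z hz
    exact Real.le_sqrt_of_sq_le
      (hz.normSq_fullGradEst_sub_le .forward (fun _ => ht) (fun _ => le_rfl) x)
  have hmeas : AEStronglyMeasurable (fun z => ∇ (fun y => F y z) x) μ := by
    have ht : ∀ m : ℕ, (0 : ℝ) < 1 / ((m : ℝ) + 1) := fun m => by positivity
    refine aestronglyMeasurable_of_tendsto_ae Filter.atTop
      (f := fun (m : ℕ) z =>
        fullGradEst .forward (fun y => F y z) (fun _ => 1 / ((m : ℝ) + 1)) x)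
      (fun m => (integrable_fullGradEst hi _ _ x).aestronglyMeasurable) ?_
    filter_upwards [ae_all_iff.2 fun m => hbd _ (ht m)] with z hz
    rw [tendsto_iff_norm_sub_tendsto_zero]
    refine squeeze_zero (fun m => norm_nonneg _) hz ?_
    have h0 := tendsto_one_div_add_atTop_nhds_zero_nat (𝕜 := ℝ)
    have h1 := (((h0.pow 2).const_mul (p : ℝ)).const_mul (c ^ 2)).sqrt
    simpa using h1
  have h1 : Integrable (fun z => ∇ (fun y => F y z) x -
      fullGradEst .forward (fun y => F y z) (fun _ => 1) x) μ := by
    refine (integrable_const (√(c ^ 2 * (p * (1 : ℝ) ^ 2)))).mono'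
      (hmeas.sub (integrable_fullGradEst hi _ _ x).aestronglyMeasurable) ?_
    filter_upwards [hbd 1 one_pos] with z hz
    rwa [norm_sub_rev]
  refine (h1.add (integrable_fullGradEst hi .forward (fun _ => 1) x)).congr
    (Filter.Eventually.of_forall fun z => ?_)
  exact sub_add_cancel _ _

theorem isSmoothWith_localCost [IsProbabilityMeasure μ] (hi : ∀ x, Integrable (F x) μ)
    (hs : ∀ᵐ z ∂μ, IsSmoothWith c (fun x => F x z)) : IsSmoothWith c (localCost F μ) := by
  refine (isSmoothWith_of_abs_sub_le (G := fun x => ∫ z, ∇ (fun y => F y z) x ∂μ)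
    (fun x d => ?_) fun x y => ?_).1
  · have hg := integrable_gradient hi hs x
    have hin : Integrable (fun z => inner ℝ (∇ (fun y => F y z) x) d) μ := hg.inner_const d
    have h1 : localCost F μ (x + d) - localCost F μ x -
        inner ℝ (∫ z, ∇ (fun y => F y z) x ∂μ) d =
        ∫ z, (F (x + d) z - F x z - inner ℝ (∇ (fun y => F y z) x) d) ∂μ := by
      have hsub : Integrable (fun z => F (x + d) z - F x z) μ := (hi _).sub (hi _)
      rw [integral_sub hsub hin, integral_sub (hi _) (hi _),
        real_inner_comm, ← integral_inner hg]
      simp only [localCost, real_inner_comm]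
    rw [h1, ← Real.norm_eq_abs]
    refine (norm_integral_le_of_norm_le (integrable_const (c / 2 * ‖d‖ ^ 2)) ?_).trans ?_
    · filter_upwards [hs] with z hz
      exact hz.abs_sub_le x d
    · simp
  · rw [← integral_sub (integrable_gradient hi hs x) (integrable_gradient hi hs y)]
    refine (norm_integral_le_of_norm_le (integrable_const (c * ‖x - y‖)) ?_).trans ?_
    · filter_upwards [hs] with z hz
      exact hz.2 x y
    · simp

end LocalCost

/-! ### Averages over the agents and smoothness of the global cost. -/

section GlobalCost

variable {n p : ℕ} {Ξ : Type*} [MeasurableSpace Ξ] {c ζ σ₂ : ℝ}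
  {F : Fin n → EuclideanSpace ℝ (Fin p) → Ξ → ℝ} {μ : Fin n → Measure Ξ}

theorem CostAssumptions.isSmoothWith_localCost (hF : CostAssumptions F μ c ζ σ₂) (i : Fin n) :
    IsSmoothWith c (localCost (F i) (μ i)) := by
  have := hF.prob i
  exact _root_.isSmoothWith_localCost (hF.integrable i) (hF.smooth i)

theorem avg_sub_avg (x y : Fin n → EuclideanSpace ℝ (Fin p)) :
    avg x - avg y = avg fun i => x i - y i := by
  simp only [avg, ← smul_sub, Finset.sum_sub_distrib]

theorem inner_avg (x : Fin n → EuclideanSpace ℝ (Fin p)) (w : EuclideanSpace ℝ (Fin p)) :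
    inner ℝ w (avg x) = 1 / (n : ℝ) * ∑ i, inner ℝ w (x i) := by
  rw [avg, inner_smul_right, inner_sum]

theorem norm_avg_le (x : Fin n → EuclideanSpace ℝ (Fin p)) :
    ‖avg x‖ ≤ 1 / (n : ℝ) * ∑ i, ‖x i‖ := by
  rw [avg, norm_smul, Real.norm_eq_abs, abs_of_nonneg (by positivity)]
  gcongr
  exact norm_sum_le _ _

theorem normSq_avg_le (x : Fin n → EuclideanSpace ℝ (Fin p)) :
    ‖avg x‖ ^ 2 ≤ 1 / (n : ℝ) * ∑ i, ‖x i‖ ^ 2 := by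
  rcases Nat.eq_zero_or_pos n with rfl | hn
  · simp [avg]
  have hn' : (0 : ℝ) < n := by exact_mod_cast hn
  have h1 := sq_sum_le_card_mul_sum_sq (s := Finset.univ) (f := fun i => ‖x i‖)
  rw [Finset.card_univ, Fintype.card_fin] at h1
  calc ‖avg x‖ ^ 2 ≤ (1 / (n : ℝ) * ∑ i, ‖x i‖) ^ 2 := by gcongr; exact norm_avg_le x
    _ = (1 / (n : ℝ)) ^ 2 * (∑ i, ‖x i‖) ^ 2 := by ring
    _ ≤ (1 / (n : ℝ)) ^ 2 * (n * ∑ i, ‖x i‖ ^ 2) := by gcongr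
    _ = _ := by field_simp

theorem CostAssumptions.smooth_globalCost (hF : CostAssumptions F μ c ζ σ₂) (hn : 0 < n) :
    IsSmoothWith c (globalCost F μ) ∧
      ∀ x, ∇ (globalCost F μ) x = avg fun i => ∇ (localCost (F i) (μ i)) x := by
  have hn' : (0 : ℝ) < n := by exact_mod_cast hn
  refine isSmoothWith_of_abs_sub_le (fun x d => ?_) fun x y => ?_
  · have h1 : globalCost F μ (x + d) - globalCost F μ x -
        inner ℝ (avg fun i => ∇ (localCost (F i) (μ i)) x) d =
        1 / (n : ℝ) * ∑ i, (localCost (F i) (μ i) (x + d) - localCost (F i) (μ i) x -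
          inner ℝ (∇ (localCost (F i) (μ i)) x) d) := by
      rw [real_inner_comm, inner_avg]
      simp only [globalCost, Finset.sum_sub_distrib, real_inner_comm]
      ring
    rw [h1, abs_mul, abs_of_nonneg (by positivity)]
    calc _ ≤ 1 / (n : ℝ) * ∑ _i : Fin n, c / 2 * ‖d‖ ^ 2 := by
          gcongr
          refine (Finset.abs_sum_le_sum_abs _ _).trans (Finset.sum_le_sum fun i _ => ?_)
          exact (hF.isSmoothWith_localCost i).abs_sub_le x d
      _ = _ := by simp; field_simp
  · rw [avg_sub_avg]
    refine (norm_avg_le _).trans ?_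
    calc _ ≤ 1 / (n : ℝ) * ∑ _i : Fin n, c * ‖x - y‖ := by
          gcongr with i
          exact (hF.isSmoothWith_localCost i).2 x y
      _ = _ := by simp; field_simp

end GlobalCost

/-! ### Mean and second moment of the coordinate estimator at a fixed point. -/

section Estimator

variable {p : ℕ}

theorem coordGradEst_apply (o : DiffScheme) (nc : ℕ) (h : EuclideanSpace ℝ (Fin p) → ℝ)
    (d : Fin p → ℝ) (s : Finset (Fin p)) (x : EuclideanSpace ℝ (Fin p)) (j : Fin p) :
    coordGradEst o nc h d s x j =
      (p : ℝ) / nc * (diffQuot o h (d j) x j * if j ∈ s then 1 else 0) := by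
  simp only [coordGradEst, PiLp.smul_apply, smul_eq_mul, WithLp.ofLp_sum, Finset.sum_apply,
    WithLp.ofLp_smul, Pi.smul_apply]
  simp

theorem measurable_ite_mem (j : Fin p) :
    Measurable (fun s : Finset (Fin p) => if j ∈ s then (1 : ℝ) else 0) :=
  Measurable.ite (measurableSet_mem_finset j) measurable_const measurable_const

variable {Ξ : Type*} [MeasurableSpace Ξ] {c ζ : ℝ}
  {F : EuclideanSpace ℝ (Fin p) → Ξ → ℝ} {μ : Measure Ξ}

theorem measurable_diffQuot {α : Type*} [MeasurableSpace α]
    (hF : Measurable fun q : EuclideanSpace ℝ (Fin p) × Ξ => F q.1 q.2)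
    (o : DiffScheme) (d : ℝ) (j : Fin p) {X : α → EuclideanSpace ℝ (Fin p)} (hX : Measurable X)
    {z : α → Ξ} (hz : Measurable z) :
    Measurable fun a => diffQuot o (fun y => F y (z a)) d (X a) j := by
  have h : ∀ t : EuclideanSpace ℝ (Fin p), Measurable fun a => F (X a + t) (z a) := fun t =>
    hF.comp ((hX.add_const t).prodMk hz)
  have h0 : Measurable fun a => F (X a) (z a) := hF.comp (hX.prodMk hz)
  cases o with
  | forward => exact ((h _).sub h0).div_const d
  | central =>
    simp only [diffQuot, sub_eq_add_neg _ (EuclideanSpace.single j d)]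
    exact ((h _).sub (h _)).div_const (2 * d)

theorem measurable_coordGradEst {α : Type*} [MeasurableSpace α]
    (hF : Measurable fun q : EuclideanSpace ℝ (Fin p) × Ξ => F q.1 q.2)
    (o : DiffScheme) (nc : ℕ) (d : Fin p → ℝ) {X : α → EuclideanSpace ℝ (Fin p)}
    (hX : Measurable X) {z : α → Ξ} (hz : Measurable z) {s : α → Finset (Fin p)}
    (hs : Measurable s) :
    Measurable fun a => coordGradEst o nc (fun y => F y (z a)) d (s a) (X a) := by
  have h : ∀ a, coordGradEst o nc (fun y => F y (z a)) d (s a) (X a) = WithLp.toLp 2 fun j =>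
        (p : ℝ) / nc * (diffQuot o (fun y => F y (z a)) (d j) (X a) j *
          if j ∈ s a then 1 else 0) := fun a => by
    ext j
    rw [coordGradEst_apply]
  simp only [h]
  refine (WithLp.measurable_toLp 2 _).comp (measurable_pi_lambda _ fun j => ?_)
  exact ((measurable_diffQuot hF o (d j) j hX hz).mul ((measurable_ite_mem j).comp hs)).const_mul _

variable {τ : Measure (Finset (Fin p))} {nc : ℕ}

theorem integral_ite_mem (hτ : ∀ j, τ.real {s | j ∈ s} = (nc : ℝ) / p) (j : Fin p) :
    ∫ s, (if j ∈ s then (1 : ℝ) else 0) ∂τ = (nc : ℝ) / p := by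
  rw [← hτ j, ← integral_indicator_one (measurableSet_mem_finset j)]
  refine integral_congr_ae (Filter.Eventually.of_forall fun s => ?_)
  simp [Set.indicator_apply]

theorem integrable_ite_mem [IsFiniteMeasure τ] (j : Fin p) :
    Integrable (fun s : Finset (Fin p) => if j ∈ s then (1 : ℝ) else 0) τ := by
  refine (integrable_const (1 : ℝ)).mono' (measurable_ite_mem j).aestronglyMeasurable
    (Filter.Eventually.of_forall fun s => ?_)
  by_cases h : j ∈ s <;> simp [h]

/-- The factor `p / nc` cancels the selection probability `nc / p`, and difference quotients commute
with the expectation over the sample. Only the marginals of the coordinate set matter. -/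
theorem integral_inner_coordGradEst [IsFiniteMeasure τ] [SFinite μ] (hnc : 0 < nc)
    (hp : 0 < p) (hi : ∀ x, Integrable (F x) μ)
    (hτ : ∀ j, τ.real {s | j ∈ s} = (nc : ℝ) / p) (o : DiffScheme) (d : Fin p → ℝ)
    (x w : EuclideanSpace ℝ (Fin p)) :
    ∫ q, inner ℝ w (coordGradEst o nc (fun y => F y q.1) d q.2 x) ∂(μ.prod τ) =
      inner ℝ w (fullGradEst o (localCost F μ) d x) := by
  have hnc' : (nc : ℝ) ≠ 0 := by exact_mod_cast hnc.ne'
  have hp' : (p : ℝ) ≠ 0 := by exact_mod_cast hp.ne'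
  have hint : ∀ j, Integrable (fun q : Ξ × Finset (Fin p) =>
      diffQuot o (fun y => F y q.1) (d j) x j * if j ∈ q.2 then (1 : ℝ) else 0) (μ.prod τ) :=
    fun j => (integrable_diffQuot hi o (d j) x j).mul_prod (integrable_ite_mem j)
  simp only [PiLp.inner_apply, coordGradEst_apply, RCLike.inner_apply, conj_trivial]
  rw [integral_finsetSum _ fun j _ => ((hint j).const_mul _).mul_const _]
  refine Finset.sum_congr rfl fun j _ => ?_
  rw [integral_mul_const, integral_const_mul,
    integral_prod_mul (fun z => diffQuot o (fun y => F y z) (d j) x j)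
      (fun s => if j ∈ s then (1 : ℝ) else 0), integral_ite_mem hτ, integral_diffQuot hi]
  simp only [fullGradEst]
  field_simp

theorem normSq_coordGradEst (o : DiffScheme) (nc : ℕ) (h : EuclideanSpace ℝ (Fin p) → ℝ)
    (d : Fin p → ℝ) (s : Finset (Fin p)) (x : EuclideanSpace ℝ (Fin p)) :
    ‖coordGradEst o nc h d s x‖ ^ 2 =
      ∑ j, ((p : ℝ) / nc) ^ 2 * (diffQuot o h (d j) x j ^ 2 * if j ∈ s then 1 else 0) := by
  rw [EuclideanSpace.norm_sq_eq]
  refine Finset.sum_congr rfl fun j _ => ?_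
  rw [coordGradEst_apply, Real.norm_eq_abs, sq_abs, mul_pow, mul_pow]
  by_cases hj : j ∈ s <;> simp [hj]

/-- Two uses of `(a + b) ^ 2 ≤ 2 * a ^ 2 + 2 * b ^ 2`: first split off the discretization error,
then the deviation of the stochastic derivative from its mean. -/
theorem integrable_sq_diffQuot [IsProbabilityMeasure μ] (hi : ∀ x, Integrable (F x) μ)
    (hs : ∀ᵐ z ∂μ, IsSmoothWith c (fun x => F x z))
    (hvi : ∀ x j, Integrable
      (fun z => ((∇ (fun y => F y z) x - ∇ (localCost F μ) x) j) ^ 2) μ)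
    (hv : ∀ x j, ∫ z, ((∇ (fun y => F y z) x - ∇ (localCost F μ) x) j) ^ 2 ∂μ ≤ ζ ^ 2)
    (o : DiffScheme) {d : ℝ} (hd : 0 < d) (x : EuclideanSpace ℝ (Fin p)) (j : Fin p) :
    Integrable (fun z => diffQuot o (fun y => F y z) d x j ^ 2) μ ∧
      ∫ z, diffQuot o (fun y => F y z) d x j ^ 2 ∂μ ≤
        4 * ζ ^ 2 + (4 * (∇ (localCost F μ) x j) ^ 2 + c ^ 2 * d ^ 2) := by
  have hdom : Integrable (fun z => 4 * ((∇ (fun y => F y z) x - ∇ (localCost F μ) x) j) ^ 2 +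
      (4 * (∇ (localCost F μ) x j) ^ 2 + c ^ 2 * d ^ 2)) μ :=
    ((hvi x j).const_mul 4).add (integrable_const _)
  have hle : ∀ᵐ z ∂μ, diffQuot o (fun y => F y z) d x j ^ 2 ≤
      4 * ((∇ (fun y => F y z) x - ∇ (localCost F μ) x) j) ^ 2 +
      (4 * (∇ (localCost F μ) x j) ^ 2 + c ^ 2 * d ^ 2) := by
    filter_upwards [hs] with z hz
    have h1 := hz.abs_diffQuot_sub_le o hd x j
    have h2 : (diffQuot o (fun y => F y z) d x j - ∇ (fun y => F y z) x j) ^ 2 ≤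
        (c / 2 * d) ^ 2 := sq_le_sq' (abs_le.1 h1).1 (abs_le.1 h1).2
    rw [PiLp.sub_apply]
    nlinarith [sq_nonneg (2 * ∇ (fun y => F y z) x j - diffQuot o (fun y => F y z) d x j),
      sq_nonneg (∇ (fun y => F y z) x j - 2 * ∇ (localCost F μ) x j), sq_nonneg (c * d)]
  have hint : Integrable (fun z => diffQuot o (fun y => F y z) d x j ^ 2) μ := by
    refine hdom.mono' ((integrable_diffQuot hi o d x j).aestronglyMeasurable.pow 2) ?_
    filter_upwards [hle] with z hz
    rwa [Real.norm_eq_abs, abs_of_nonneg (sq_nonneg _)]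
  refine ⟨hint, (integral_mono_ae hint hdom hle).trans ?_⟩
  rw [integral_add ((hvi x j).const_mul 4) (integrable_const _), integral_const_mul,
    integral_const, probReal_univ, one_smul]
  linarith [hv x j]

/-- Distinct coordinates are orthogonal, so each contributes `(p / nc) ^ 2 * (nc / p) = p / nc ≤ p`
times its second moment: the loss is one factor `p`, not two. -/
theorem integral_normSq_coordGradEst_le [IsProbabilityMeasure μ] [IsFiniteMeasure τ]
    (hnc : 0 < nc) (hi : ∀ x, Integrable (F x) μ)
    (hs : ∀ᵐ z ∂μ, IsSmoothWith c (fun x => F x z))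
    (hvi : ∀ x j, Integrable
      (fun z => ((∇ (fun y => F y z) x - ∇ (localCost F μ) x) j) ^ 2) μ)
    (hv : ∀ x j, ∫ z, ((∇ (fun y => F y z) x - ∇ (localCost F μ) x) j) ^ 2 ∂μ ≤ ζ ^ 2)
    (hτ : ∀ j, τ.real {s | j ∈ s} = (nc : ℝ) / p) (o : DiffScheme) {d : Fin p → ℝ}
    (hd : ∀ j, 0 < d j) {D : ℝ} (hD : ∀ j, d j ^ 2 ≤ D) (x : EuclideanSpace ℝ (Fin p)) :
    Integrable (fun q => ‖coordGradEst o nc (fun y => F y q.1) d q.2 x‖ ^ 2) (μ.prod τ) ∧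
      ∫ q, ‖coordGradEst o nc (fun y => F y q.1) d q.2 x‖ ^ 2 ∂(μ.prod τ) ≤
        p * (4 * (p * ζ ^ 2) + 4 * ‖∇ (localCost F μ) x‖ ^ 2 + c ^ 2 * (p * D)) := by
  have hnc' : (1 : ℝ) ≤ nc := by exact_mod_cast hnc
  have hsq := fun j => integrable_sq_diffQuot hi hs hvi hv o (hd j) x j
  have hint : ∀ j, Integrable (fun q : Ξ × Finset (Fin p) => ((p : ℝ) / nc) ^ 2 *
      (diffQuot o (fun y => F y q.1) (d j) x j ^ 2 * if j ∈ q.2 then (1 : ℝ) else 0))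
      (μ.prod τ) :=
    fun j => ((hsq j).1.mul_prod (integrable_ite_mem j)).const_mul _
  simp only [normSq_coordGradEst]
  refine ⟨integrable_finsetSum _ fun j _ => hint j, ?_⟩
  rw [integral_finsetSum _ fun j _ => hint j]
  calc _ ≤ ∑ j, (p : ℝ) *
        (4 * ζ ^ 2 + (4 * (∇ (localCost F μ) x j) ^ 2 + c ^ 2 * D)) := by
        refine Finset.sum_le_sum fun j _ => ?_
        rw [integral_const_mul, integral_prod_mul
          (fun z => diffQuot o (fun y => F y z) (d j) x j ^ 2)
          (fun s => if j ∈ s then (1 : ℝ) else 0), integral_ite_mem hτ]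
        have hp : (0 : ℝ) < p := by exact_mod_cast (Nat.zero_le _).trans_lt j.2
        have h0 : 0 ≤ ∫ z, diffQuot o (fun y => F y z) (d j) x j ^ 2 ∂μ :=
          integral_nonneg fun z => sq_nonneg _
        have h1 : ((p : ℝ) / nc) ^ 2 *
            ((∫ z, diffQuot o (fun y => F y z) (d j) x j ^ 2 ∂μ) * (nc / p)) =
            p / nc * ∫ z, diffQuot o (fun y => F y z) (d j) x j ^ 2 ∂μ := by
          field_simp
        rw [h1]
        have h2 : (p : ℝ) / nc ≤ p := div_le_self hp.le hnc'
        refine (mul_le_mul_of_nonneg_right h2 h0).trans (mul_le_mul_of_nonneg_left ?_ hp.le)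
        refine (hsq j).2.trans ?_
        gcongr
        exact hD j
    _ = _ := by
        rw [← Finset.mul_sum, Finset.sum_add_distrib, Finset.sum_add_distrib,
          EuclideanSpace.norm_sq_eq]
        simp only [Finset.sum_const, Finset.card_univ, Fintype.card_fin, nsmul_eq_mul,
          Real.norm_eq_abs, sq_abs, ← Finset.mul_sum]
        ring

end Estimator

/-! ### Square integrable random vectors. -/

section SquareIntegrable

theorem MeasureTheory.MemLp.integrable_normSq {Ω E : Type*} [MeasurableSpace Ω] {P : Measure Ω}
    [NormedAddCommGroup E] {f : Ω → E} (hf : MemLp f 2 P) :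
    Integrable (fun ω => ‖f ω‖ ^ 2) P :=
  (memLp_two_iff_integrable_sq_norm hf.1).1 hf

variable {Ω E : Type*} [MeasurableSpace Ω] {P : Measure Ω} [NormedAddCommGroup E]
  [InnerProductSpace ℝ E]

theorem integrable_inner_of_memLp {f g : Ω → E} (hf : MemLp f 2 P) (hg : MemLp g 2 P) :
    Integrable (fun ω => inner ℝ (f ω) (g ω)) P := by
  refine (((memLp_two_iff_integrable_sq_norm hf.1).1 hf).add
    ((memLp_two_iff_integrable_sq_norm hg.1).1 hg)).mono' (hf.1.inner hg.1)
    (Filter.Eventually.of_forall fun ω => ?_)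
  refine (norm_inner_le_norm _ _).trans ?_
  simp only [Pi.add_apply]
  nlinarith [sq_nonneg (‖f ω‖ - ‖g ω‖), sq_nonneg ‖f ω‖, sq_nonneg ‖g ω‖]

theorem memLp_avg {n p : ℕ} {x : Fin n → Ω → EuclideanSpace ℝ (Fin p)}
    (h : ∀ i, MemLp (x i) 2 P) : MemLp (fun ω => avg fun i => x i ω) 2 P := by
  simp only [avg]
  exact (memLp_finsetSum Finset.univ fun i _ => h i).const_smul (1 / (n : ℝ))

theorem IsSmoothWith.memLp_gradient [IsFiniteMeasure P] {p : ℕ} {c : ℝ}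
    {f : EuclideanSpace ℝ (Fin p) → ℝ}
    (hf : IsSmoothWith c f) {X : Ω → EuclideanSpace ℝ (Fin p)} (hX : MemLp X 2 P) :
    MemLp (fun ω => ∇ f (X ω)) 2 P := by
  have h := (hX.norm.const_mul c).add (memLp_const (μ := P) (p := 2) ‖∇ f 0‖)
  refine h.mono (hf.continuous_gradient.comp_aestronglyMeasurable hX.1)
    (Filter.Eventually.of_forall fun ω => ?_)
  have h1 := hf.2 (X ω) 0
  rw [sub_zero] at h1
  have h2 := norm_le_norm_sub_add (∇ f (X ω)) (∇ f 0)
  refine le_trans ?_ (le_abs_self _)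
  simp only [Pi.add_apply]
  linarith

theorem IsSmoothWith.integrable_comp [IsFiniteMeasure P] {p : ℕ} {c : ℝ}
    {f : EuclideanSpace ℝ (Fin p) → ℝ}
    (hf : IsSmoothWith c f) {X : Ω → EuclideanSpace ℝ (Fin p)} (hX : MemLp X 2 P) :
    Integrable (fun ω => f (X ω)) P := by
  have h1 : Integrable (fun ω => |f 0| + ‖∇ f 0‖ * ‖X ω‖ + c / 2 * ‖X ω‖ ^ 2) P :=
    ((integrable_const _).add
      ((hX.integrable one_le_two).norm.const_mul _)).add (hX.integrable_normSq.const_mul _)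
  refine h1.mono' (hf.1.continuous.comp_aestronglyMeasurable hX.1)
    (Filter.Eventually.of_forall fun ω => ?_)
  have h2 := hf.abs_sub_le 0 (X ω)
  rw [zero_add] at h2
  have h3 := abs_real_inner_le_norm (∇ f 0) (X ω)
  have h4 : f (X ω) = (f (X ω) - f 0 - inner ℝ (∇ f 0) (X ω)) + f 0 + inner ℝ (∇ f 0) (X ω) := by
    ring
  rw [h4, Real.norm_eq_abs]
  refine (abs_add_le _ _).trans ?_
  have h5 := abs_add_le (f (X ω) - f 0 - inner ℝ (∇ f 0) (X ω)) (f 0)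
  linarith

end SquareIntegrable

/-! ### Integrating out an independent variable. -/

section Independence

variable {Ω 𝒰 𝒵 : Type*} [MeasurableSpace Ω] [MeasurableSpace 𝒰] [MeasurableSpace 𝒵]
  {P : Measure Ω} {U : Ω → 𝒰} {Z : Ω → 𝒵} {ν : Measure 𝒵}

theorem map_prodMk_of_indepFun [IsProbabilityMeasure P] (hU : Measurable U)
    (hZ : Measurable Z) (hUZ : IndepFun U Z P)
    (hν : P.map Z = ν) : P.map (fun ω => (U ω, Z ω)) = (P.map U).prod ν := by
  rw [← hν]
  exact (indepFun_iff_map_prod_eq_prod_map_map hU.aemeasurable hZ.aemeasurable).1 hUZ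

/-- The joint law is a product, so Fubini applies; this plays the role of conditioning on `U`. -/
theorem integral_comp_of_indepFun [IsProbabilityMeasure P] [SFinite ν]
    (hU : Measurable U) (hZ : Measurable Z)
    (hUZ : IndepFun U Z P) (hν : P.map Z = ν) {h : 𝒰 × 𝒵 → ℝ} (hh : Measurable h)
    (hi : Integrable (fun ω => h (U ω, Z ω)) P) :
    ∫ ω, h (U ω, Z ω) ∂P = ∫ ω, ∫ z, h (U ω, z) ∂ν ∂P := by
  have hmap := map_prodMk_of_indepFun hU hZ hUZ hν
  have hm : Measurable fun ω => (U ω, Z ω) := hU.prodMk hZ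
  have hi' : Integrable h ((P.map U).prod ν) := by
    rw [← hmap]
    exact (integrable_map_measure hh.aestronglyMeasurable hm.aemeasurable).2 hi
  rw [← integral_map hm.aemeasurable hh.aestronglyMeasurable, hmap, integral_prod _ hi',
    integral_map hU.aemeasurable hh.stronglyMeasurable.integral_prod_right'.aestronglyMeasurable]

theorem integrable_comp_of_indepFun [IsProbabilityMeasure P] [SFinite ν]
    (hU : Measurable U) (hZ : Measurable Z)
    (hUZ : IndepFun U Z P) (hν : P.map Z = ν) {h : 𝒰 × 𝒵 → ℝ} (hh : Measurable h)
    (h0 : ∀ q, 0 ≤ h q) (hi : ∀ u, Integrable (fun z => h (u, z)) ν) {B : 𝒰 → ℝ}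
    (hB : ∀ u, ∫ z, h (u, z) ∂ν ≤ B u) (hBi : Integrable (fun ω => B (U ω)) P) :
    Integrable (fun ω => h (U ω, Z ω)) P := by
  have hmap := map_prodMk_of_indepFun hU hZ hUZ hν
  have hm : Measurable fun ω => (U ω, Z ω) := hU.prodMk hZ
  rw [← Function.comp_def h, ← integrable_map_measure hh.aestronglyMeasurable hm.aemeasurable, hmap,
    integrable_prod_iff hh.aestronglyMeasurable]
  refine ⟨Filter.Eventually.of_forall hi, ?_⟩
  have hI : StronglyMeasurable fun u => ∫ z, ‖h (u, z)‖ ∂ν :=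
    hh.norm.stronglyMeasurable.integral_prod_right'
  rw [integrable_map_measure hI.aestronglyMeasurable hU.aemeasurable]
  refine hBi.mono' (hI.comp_measurable hU).aestronglyMeasurable
    (Filter.Eventually.of_forall fun ω => ?_)
  simp only [Function.comp, Real.norm_eq_abs, abs_of_nonneg (h0 _)]
  rw [abs_of_nonneg (integral_nonneg fun z => h0 _)]
  exact hB _

/-- Anything computed from the draws indexed by `T` is independent of a draw outside `T`; used for
the past against the present draw. -/
theorem indepFun_of_measurable_iSup {ι : Type*} {β : ι → Type*} [∀ a, MeasurableSpace (β a)]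
    {Y : ∀ a, Ω → β a} (hY : ∀ a, Measurable (Y a)) (hind : iIndepFun Y P) {T : Set ι}
    (hU : Measurable[⨆ a ∈ T, MeasurableSpace.comap (Y a) inferInstance] U) {b : ι} (hb : b ∉ T) :
    IndepFun U (Y b) P := by
  have h := indep_iSup_of_disjoint (fun a => (hY a).comap_le) hind.iIndep
    (Set.disjoint_singleton_right.2 hb)
  rw [IndepFun_iff_Indep]
  refine indep_of_indep_of_le_left (indep_of_indep_of_le_right h ?_) hU.comap_le
  exact le_iSup₂_of_le b rfl le_rfl

end Independence

/-! ### The estimator at a random point independent of the sample. -/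

section RandomEstimator

variable {p : ℕ} {Ξ Ω 𝒰 : Type*} [MeasurableSpace Ξ] [MeasurableSpace Ω] [MeasurableSpace 𝒰]
  {c ζ : ℝ} {F : EuclideanSpace ℝ (Fin p) → Ξ → ℝ} {μ : Measure Ξ} {P : Measure Ω}
  [IsProbabilityMeasure P] [IsProbabilityMeasure μ] {τ : Measure (Finset (Fin p))}
  [IsFiniteMeasure τ] {nc : ℕ} {U : Ω → 𝒰} {Z : Ω → Ξ × Finset (Fin p)}

theorem integral_inner_random_coordGradEst (hnc : 0 < nc) (hp : 0 < p)
    (hF : Measurable fun q : EuclideanSpace ℝ (Fin p) × Ξ => F q.1 q.2)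
    (hi : ∀ x, Integrable (F x) μ)
    (hτ : ∀ j, τ.real {s | j ∈ s} = (nc : ℝ) / p) (o : DiffScheme) (d : Fin p → ℝ)
    (hU : Measurable U) (hZ : Measurable Z) (hUZ : IndepFun U Z P) (hν : P.map Z = μ.prod τ)
    {X w : 𝒰 → EuclideanSpace ℝ (Fin p)} (hX : Measurable X) (hw : Measurable w)
    (hint : Integrable (fun ω => inner ℝ (w (U ω))
      (coordGradEst o nc (fun y => F y (Z ω).1) d (Z ω).2 (X (U ω)))) P) :
    ∫ ω, inner ℝ (w (U ω))
      (coordGradEst o nc (fun y => F y (Z ω).1) d (Z ω).2 (X (U ω))) ∂P =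
    ∫ ω, inner ℝ (w (U ω)) (fullGradEst o (localCost F μ) d (X (U ω))) ∂P := by
  have hm : Measurable fun q : 𝒰 × (Ξ × Finset (Fin p)) =>
      inner ℝ (w q.1) (coordGradEst o nc (fun y => F y q.2.1) d q.2.2 (X q.1)) :=
    (hw.comp measurable_fst).inner (measurable_coordGradEst hF o nc d (hX.comp measurable_fst)
      measurable_snd.fst measurable_snd.snd)
  rw [integral_comp_of_indepFun hU hZ hUZ hν hm hint]
  refine integral_congr_ae (Filter.Eventually.of_forall fun ω => ?_)
  exact integral_inner_coordGradEst (F := F) (μ := μ) (τ := τ) hnc hp hi hτ o d (X (U ω)) (w (U ω))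

theorem integral_normSq_random_coordGradEst_le (hnc : 0 < nc)
    (hF : Measurable fun q : EuclideanSpace ℝ (Fin p) × Ξ => F q.1 q.2)
    (hi : ∀ x, Integrable (F x) μ)
    (hs : ∀ᵐ z ∂μ, IsSmoothWith c (fun x => F x z))
    (hvi : ∀ x j, Integrable
      (fun z => ((∇ (fun y => F y z) x - ∇ (localCost F μ) x) j) ^ 2) μ)
    (hv : ∀ x j, ∫ z, ((∇ (fun y => F y z) x - ∇ (localCost F μ) x) j) ^ 2 ∂μ ≤ ζ ^ 2)
    (hτ : ∀ j, τ.real {s | j ∈ s} = (nc : ℝ) / p) (o : DiffScheme) {d : Fin p → ℝ}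
    (hd : ∀ j, 0 < d j) {D : ℝ} (hD : ∀ j, d j ^ 2 ≤ D)
    (hU : Measurable U) (hZ : Measurable Z) (hUZ : IndepFun U Z P) (hν : P.map Z = μ.prod τ)
    {X : 𝒰 → EuclideanSpace ℝ (Fin p)} (hX : Measurable X) (hX2 : MemLp (fun ω => X (U ω)) 2 P) :
    MemLp (fun ω => coordGradEst o nc (fun y => F y (Z ω).1) d (Z ω).2 (X (U ω))) 2 P ∧
    ∫ ω, ‖coordGradEst o nc (fun y => F y (Z ω).1) d (Z ω).2 (X (U ω))‖ ^ 2 ∂P ≤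
      p * (4 * (p * ζ ^ 2) + 4 * ∫ ω, ‖∇ (localCost F μ) (X (U ω))‖ ^ 2 ∂P +
        c ^ 2 * (p * D)) := by
  have hg : Measurable fun q : 𝒰 × (Ξ × Finset (Fin p)) =>
      coordGradEst o nc (fun y => F y q.2.1) d q.2.2 (X q.1) :=
    measurable_coordGradEst hF o nc d (hX.comp measurable_fst) measurable_snd.fst
      measurable_snd.snd
  have hfix := fun x =>
    integral_normSq_coordGradEst_le (F := F) (μ := μ) (τ := τ) hnc hi hs hvi hv hτ o hd hD x
  have hgrad := ((isSmoothWith_localCost hi hs).memLp_gradient hX2).integrable_normSq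
  have hB : Integrable (fun ω => (p : ℝ) * (4 * (p * ζ ^ 2) +
      4 * ‖∇ (localCost F μ) (X (U ω))‖ ^ 2 + c ^ 2 * (p * D))) P :=
    (((integrable_const _).add (hgrad.const_mul 4)).add (integrable_const _)).const_mul _
  have hint := integrable_comp_of_indepFun hU hZ hUZ hν (hg.norm.pow_const 2)
    (fun q => sq_nonneg _) (fun u => (hfix (X u)).1) (fun u => (hfix (X u)).2) hB
  refine ⟨(memLp_two_iff_integrable_sq_norm
    (hg.comp (hU.prodMk hZ)).aestronglyMeasurable).2 hint, ?_⟩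
  rw [integral_comp_of_indepFun hU hZ hUZ hν (hg.norm.pow_const 2) hint]
  have hI : Measurable fun ω => ∫ z,
      ‖coordGradEst o nc (fun y => F y z.1) d z.2 (X (U ω))‖ ^ 2 ∂(μ.prod τ) :=
    ((hg.norm.pow_const 2).stronglyMeasurable.integral_prod_right'.comp_measurable hU).measurable
  calc _ ≤ ∫ ω, (p : ℝ) * (4 * (p * ζ ^ 2) +
      4 * ‖∇ (localCost F μ) (X (U ω))‖ ^ 2 + c ^ 2 * (p * D)) ∂P := by
        refine integral_mono_ae ?_ hB (Filter.Eventually.of_forall fun ω => (hfix (X (U ω))).2)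
        refine hB.mono' hI.aestronglyMeasurable (Filter.Eventually.of_forall fun ω => ?_)
        rw [Real.norm_eq_abs, abs_of_nonneg (integral_nonneg fun z => sq_nonneg _)]
        exact (hfix (X (U ω))).2
    _ = _ := by
        have h4 : Integrable (fun ω => 4 * ‖∇ (localCost F μ) (X (U ω))‖ ^ 2) P :=
          hgrad.const_mul 4
        have h5 : Integrable (fun ω => 4 * ((p : ℝ) * ζ ^ 2) +
            4 * ‖∇ (localCost F μ) (X (U ω))‖ ^ 2) P := (integrable_const _).add h4
        rw [integral_const_mul, integral_add h5 (integrable_const _),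
          integral_add (integrable_const _) h4, integral_const, integral_const,
          integral_const_mul, probReal_univ, one_smul, one_smul]

end RandomEstimator

/-! ### Gradient size and gradient bias in terms of the consensus error. -/

section Averages

variable {n p : ℕ}

theorem consensusError_nonneg (x : Fin n → EuclideanSpace ℝ (Fin p)) : 0 ≤ consensusError x := by
  unfold consensusError
  positivity

variable {Ξ : Type*} [MeasurableSpace Ξ] {c ζ σ₂ : ℝ}
  {F : Fin n → EuclideanSpace ℝ (Fin p) → Ξ → ℝ} {μ : Fin n → Measure Ξ}

/-- Going from agent `i` at `x i` to agent `i` at the average, and then to the global gradient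
there, gives three terms, hence the factor `3`. -/
theorem avg_normSq_gradient_le (hF : CostAssumptions F μ c ζ σ₂) (hn : 0 < n)
    (x : Fin n → EuclideanSpace ℝ (Fin p)) :
    1 / (n : ℝ) * ∑ i, ‖∇ (localCost (F i) (μ i)) (x i)‖ ^ 2 ≤
      3 * (‖∇ (globalCost F μ) (avg x)‖ ^ 2 + σ₂ ^ 2 + c ^ 2 * consensusError x) := by
  have hn' : (0 : ℝ) < n := by exact_mod_cast hn
  calc _ ≤ 1 / (n : ℝ) * ∑ i, (3 * (‖∇ (globalCost F μ) (avg x)‖ ^ 2 + σ₂ ^ 2) +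
        3 * c ^ 2 * ‖x i - avg x‖ ^ 2) := by
        gcongr with i
        have h1 := norm_le_norm_sub_add (∇ (localCost (F i) (μ i)) (x i))
          (∇ (localCost (F i) (μ i)) (avg x))
        have h2 := norm_le_norm_sub_add (∇ (localCost (F i) (μ i)) (avg x))
          (∇ (globalCost F μ) (avg x))
        have h3 := (hF.isSmoothWith_localCost i).2 (x i) (avg x)
        have h4 := hF.similar i (avg x)
        have h5 : ‖∇ (localCost (F i) (μ i)) (x i) - ∇ (localCost (F i) (μ i)) (avg x)‖ ^ 2 ≤
            (c * ‖x i - avg x‖) ^ 2 := by gcongr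
        set a := ‖∇ (localCost (F i) (μ i)) (x i) - ∇ (localCost (F i) (μ i)) (avg x)‖
        set b := ‖∇ (localCost (F i) (μ i)) (avg x) - ∇ (globalCost F μ) (avg x)‖
        set e := ‖∇ (globalCost F μ) (avg x)‖
        calc _ ≤ (a + b + e) ^ 2 := by gcongr; linarith
          _ ≤ 3 * (a ^ 2 + b ^ 2 + e ^ 2) := by
            nlinarith [sq_nonneg (a - b), sq_nonneg (a - e), sq_nonneg (b - e)]
          _ ≤ _ := by nlinarith
    _ = _ := by
        unfold consensusError
        simp only [Finset.sum_add_distrib, ← Finset.mul_sum, Finset.sum_const, Finset.card_univ,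
          Fintype.card_fin, nsmul_eq_mul]
        field_simp

theorem normSq_gradient_sub_avg_le (hF : CostAssumptions F μ c ζ σ₂) (hn : 0 < n)
    (o : DiffScheme) {d : Fin n → Fin p → ℝ} (hd : ∀ i j, 0 < d i j) {D : ℝ}
    (hD : ∀ i j, d i j ^ 2 ≤ D) (x : Fin n → EuclideanSpace ℝ (Fin p)) :
    ‖∇ (globalCost F μ) (avg x) -
        avg fun i => fullGradEst o (localCost (F i) (μ i)) (d i) (x i)‖ ^ 2 ≤
      2 * c ^ 2 * consensusError x + 2 * c ^ 2 * (p * D) := by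
  have hn' : (0 : ℝ) < n := by exact_mod_cast hn
  rw [(hF.smooth_globalCost hn).2, avg_sub_avg]
  refine (normSq_avg_le _).trans ?_
  calc _ ≤ 1 / (n : ℝ) * ∑ i, (2 * c ^ 2 * ‖x i - avg x‖ ^ 2 + 2 * (c ^ 2 * (p * D))) := by
        gcongr with i
        have hs := hF.isSmoothWith_localCost i
        have h1 := norm_sub_le_norm_sub_add_norm_sub (∇ (localCost (F i) (μ i)) (avg x))
          (∇ (localCost (F i) (μ i)) (x i))
          (fullGradEst o (localCost (F i) (μ i)) (d i) (x i))
        have h2 := hs.normSq_fullGradEst_sub_le o (hd i) (hD i) (x i)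
        rw [norm_sub_rev] at h2
        have h3 := hs.2 (avg x) (x i)
        rw [norm_sub_rev (avg x)] at h3
        set a := ‖∇ (localCost (F i) (μ i)) (avg x) - ∇ (localCost (F i) (μ i)) (x i)‖
        set b := ‖∇ (localCost (F i) (μ i)) (x i) -
          fullGradEst o (localCost (F i) (μ i)) (d i) (x i)‖
        have h5 : a ^ 2 ≤ (c * ‖x i - avg x‖) ^ 2 := by gcongr
        calc _ ≤ (a + b) ^ 2 := by gcongr
          _ ≤ 2 * a ^ 2 + 2 * b ^ 2 := by nlinarith [sq_nonneg (a - b)]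
          _ ≤ _ := by nlinarith
    _ = _ := by
        unfold consensusError
        rw [Finset.sum_add_distrib, ← Finset.mul_sum]
        simp
        field_simp

theorem measurable_avg : Measurable fun x : Fin n → EuclideanSpace ℝ (Fin p) => avg x := by
  unfold avg
  exact (Finset.measurable_fun_sum _ fun i _ => measurable_pi_apply i).const_smul (1 / (n : ℝ))

theorem memLp_consensus {Ω : Type*} [MeasurableSpace Ω] {P : Measure Ω}
    {X : Ω → Fin n → EuclideanSpace ℝ (Fin p)} (hX : ∀ i, MemLp (fun ω => X ω i) 2 P) :
    Integrable (fun ω => consensusError (X ω)) P := by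
  unfold consensusError
  exact (integrable_finsetSum _ fun i _ =>
    ((hX i).sub (memLp_avg hX)).integrable_normSq).const_mul _

end Averages

/-! ### One iteration with fresh samples. -/

section Step

variable {n p : ℕ} {Ξ Ω : Type*} [MeasurableSpace Ξ] [MeasurableSpace Ω] {c ζ σ₂ : ℝ}
  {F : Fin n → EuclideanSpace ℝ (Fin p) → Ξ → ℝ} {μ : Fin n → Measure Ξ}
  {P : Measure Ω} [IsProbabilityMeasure P] {nc : ℕ} {τ : Fin n → Measure (Finset (Fin p))}
  {X : Ω → Fin n → EuclideanSpace ℝ (Fin p)} {Z : Fin n → Ω → Ξ × Finset (Fin p)}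

/-- The stochastic setting of one iteration: the samples `Z` drawn by the agents are mutually
independent and independent of the current square integrable iterate `X`. -/
structure IsFreshSample (P : Measure Ω) (μ : Fin n → Measure Ξ) (nc : ℕ)
    (τ : Fin n → Measure (Finset (Fin p))) (X : Ω → Fin n → EuclideanSpace ℝ (Fin p))
    (Z : Fin n → Ω → Ξ × Finset (Fin p)) : Prop where
  measurable_iterate : Measurable X
  memLp : ∀ i, MemLp (fun ω => X ω i) 2 P
  measurable_sample : ∀ i, Measurable (Z i)
  finite : ∀ i, IsFiniteMeasure (τ i)
  law : ∀ i, P.map (Z i) = (μ i).prod (τ i)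
  uniform : ∀ i j, (τ i).real {s | j ∈ s} = (nc : ℝ) / p
  indep : ∀ i, IndepFun X (Z i) P
  indep_other : ∀ i j, i ≠ j → IndepFun (fun ω => (X ω, Z j ω)) (Z i) P

/-- The gradient estimates computed by the agents from the samples `Z` at the iterate `X`. -/
noncomputable def sampleGrad (F : Fin n → EuclideanSpace ℝ (Fin p) → Ξ → ℝ) (o : DiffScheme)
    (nc : ℕ) (d : Fin n → Fin p → ℝ) (X : Ω → Fin n → EuclideanSpace ℝ (Fin p))
    (Z : Fin n → Ω → Ξ × Finset (Fin p)) (i : Fin n) (ω : Ω) : EuclideanSpace ℝ (Fin p) :=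
  coordGradEst o nc (fun y => F i y (Z i ω).1) (d i) (Z i ω).2 (X ω i)

/-- The conditional mean of the gradient estimates. -/
noncomputable def meanGrad (F : Fin n → EuclideanSpace ℝ (Fin p) → Ξ → ℝ) (μ : Fin n → Measure Ξ)
    (o : DiffScheme) (d : Fin n → Fin p → ℝ) (x : Fin n → EuclideanSpace ℝ (Fin p)) (i : Fin n) :
    EuclideanSpace ℝ (Fin p) :=
  fullGradEst o (localCost (F i) (μ i)) (d i) (x i)

theorem memLp_sampleGrad (hF : CostAssumptions F μ c ζ σ₂) (hnc : 0 < nc) (o : DiffScheme)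
    {d : Fin n → Fin p → ℝ} (hd : ∀ i j, 0 < d i j) {D : ℝ}
    (hD : ∀ i j, d i j ^ 2 ≤ D) (hZ : IsFreshSample P μ nc τ X Z) (i : Fin n) :
    MemLp (sampleGrad F o nc d X Z i) 2 P ∧
    ∫ ω, ‖sampleGrad F o nc d X Z i ω‖ ^ 2 ∂P ≤
      p * (4 * (p * ζ ^ 2) + 4 * ∫ ω, ‖∇ (localCost (F i) (μ i)) (X ω i)‖ ^ 2 ∂P +
        c ^ 2 * (p * D)) := by
  have := hF.prob i
  have := hZ.finite i
  exact integral_normSq_random_coordGradEst_le (F := F i) (μ := μ i) (τ := τ i) (U := X) (Z := Z i)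
    (X := fun x => x i) hnc (hF.measurable i)
    (hF.integrable i) (hF.smooth i) (hF.variance_integrable i) (hF.variance_le i) (hZ.uniform i)
    o (hd i) (hD i) hZ.measurable_iterate (hZ.measurable_sample i) (hZ.indep i) (hZ.law i)
    (measurable_pi_apply i) (hZ.memLp i)

theorem measurable_meanGrad (hF : CostAssumptions F μ c ζ σ₂) (o : DiffScheme)
    (d : Fin n → Fin p → ℝ) (i : Fin n) : Measurable fun x => meanGrad F μ o d x i := by
  have hm : Measurable (localCost (F i) (μ i)) :=
    (hF.isSmoothWith_localCost i).1.continuous.measurable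
  unfold meanGrad fullGradEst
  refine (WithLp.measurable_toLp 2 _).comp (measurable_pi_lambda _ fun j => ?_)
  exact measurable_diffQuot (F := fun x (_ : Unit) => localCost (F i) (μ i) x)
    (hm.comp measurable_fst) o (d i j) j (measurable_pi_apply i)
    (z := fun _ => ()) measurable_const

theorem memLp_meanGrad (hF : CostAssumptions F μ c ζ σ₂) (o : DiffScheme)
    {d : Fin n → Fin p → ℝ} (hd : ∀ i j, 0 < d i j) {D : ℝ}
    (hD : ∀ i j, d i j ^ 2 ≤ D) (hZ : IsFreshSample P μ nc τ X Z) (i : Fin n) :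
    MemLp (fun ω => meanGrad F μ o d (X ω) i) 2 P := by
  have hs := hF.isSmoothWith_localCost i
  have h1 := hs.memLp_gradient (hZ.memLp i)
  have hm : Measurable fun ω => meanGrad F μ o d (X ω) i :=
    (measurable_meanGrad hF o d i).comp hZ.measurable_iterate
  have h2 : MemLp (fun ω => meanGrad F μ o d (X ω) i - ∇ (localCost (F i) (μ i)) (X ω i)) 2 P := by
    refine MemLp.of_bound (hm.aestronglyMeasurable.sub h1.1) (√(c ^ 2 * (p * D)))
      (Filter.Eventually.of_forall fun ω => ?_)
    exact Real.le_sqrt_of_sq_le (hs.normSq_fullGradEst_sub_le o (hd i) (hD i) (X ω i))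
  refine (h2.add h1).ae_eq (Filter.Eventually.of_forall fun ω => ?_)
  exact sub_add_cancel _ _

theorem integral_inner_sampleGrad (hF : CostAssumptions F μ c ζ σ₂) (hnc : 0 < nc) (hp : 0 < p)
    (o : DiffScheme) {d : Fin n → Fin p → ℝ} (hd : ∀ i j, 0 < d i j) {D : ℝ}
    (hD : ∀ i j, d i j ^ 2 ≤ D) (hZ : IsFreshSample P μ nc τ X Z) (i : Fin n)
    {w : (Fin n → EuclideanSpace ℝ (Fin p)) → EuclideanSpace ℝ (Fin p)} (hw : Measurable w)
    (hw2 : MemLp (fun ω => w (X ω)) 2 P) :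
    ∫ ω, inner ℝ (w (X ω)) (sampleGrad F o nc d X Z i ω) ∂P =
      ∫ ω, inner ℝ (w (X ω)) (meanGrad F μ o d (X ω) i) ∂P := by
  have := hF.prob i
  have := hZ.finite i
  exact integral_inner_random_coordGradEst (F := F i) (μ := μ i) (τ := τ i) (U := X) (Z := Z i)
    (X := fun x => x i) (w := w) hnc hp (hF.measurable i) (hF.integrable i) (hZ.uniform i) o (d i)
    hZ.measurable_iterate (hZ.measurable_sample i) (hZ.indep i) (hZ.law i)
    (measurable_pi_apply i) hw
    (integrable_inner_of_memLp hw2 (memLp_sampleGrad hF hnc o hd hD hZ i).1)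

/-- Freeze the pair `(X, Z j)`, which is independent of `Z i`, and average over `Z i`. This makes
the errors of different agents uncorrelated. -/
theorem integral_inner_sampleGrad_of_ne (hF : CostAssumptions F μ c ζ σ₂) (hnc : 0 < nc)
    (hp : 0 < p) (o : DiffScheme) {d : Fin n → Fin p → ℝ} (hd : ∀ i j, 0 < d i j) {D : ℝ}
    (hD : ∀ i j, d i j ^ 2 ≤ D) (hZ : IsFreshSample P μ nc τ X Z) {i j : Fin n} (hij : i ≠ j) :
    ∫ ω, inner ℝ (sampleGrad F o nc d X Z j ω - meanGrad F μ o d (X ω) j)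
        (sampleGrad F o nc d X Z i ω) ∂P =
      ∫ ω, inner ℝ (sampleGrad F o nc d X Z j ω - meanGrad F μ o d (X ω) j)
        (meanGrad F μ o d (X ω) i) ∂P := by
  have := hF.prob i
  have := hZ.finite i
  have hwm : Measurable fun u : (Fin n → EuclideanSpace ℝ (Fin p)) × (Ξ × Finset (Fin p)) =>
      coordGradEst o nc (fun y => F j y u.2.1) (d j) u.2.2 (u.1 j) - meanGrad F μ o d u.1 j :=
    (measurable_coordGradEst (hF.measurable j) o nc (d j)
      ((measurable_pi_apply j).comp measurable_fst) measurable_snd.fst measurable_snd.snd).sub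
      ((measurable_meanGrad hF o d j).comp measurable_fst)
  exact integral_inner_random_coordGradEst (F := F i) (μ := μ i) (τ := τ i)
    (U := fun ω => (X ω, Z j ω)) (Z := Z i)
    (X := fun u => u.1 i)
    (w := fun u => coordGradEst o nc (fun y => F j y u.2.1) (d j) u.2.2 (u.1 j) -
      meanGrad F μ o d u.1 j)
    hnc hp (hF.measurable i) (hF.integrable i) (hZ.uniform i) o (d i)
    (hZ.measurable_iterate.prodMk (hZ.measurable_sample j)) (hZ.measurable_sample i)
    (hZ.indep_other i j hij) (hZ.law i)
    ((measurable_pi_apply i).comp measurable_fst) hwm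
    (integrable_inner_of_memLp
      ((memLp_sampleGrad hF hnc o hd hD hZ j).1.sub (memLp_meanGrad hF o hd hD hZ j))
      (memLp_sampleGrad hF hnc o hd hD hZ i).1)

end Step

/-! ### Integrals of linear combinations. -/

section LinearCombination

variable {Ω : Type*} [MeasurableSpace Ω] {P : Measure Ω} {f g : Ω → ℝ}

theorem integrable_add_mul (hf : Integrable f P) (hg : Integrable g P) (r : ℝ) :
    Integrable (fun ω => f ω + r * g ω) P :=
  hf.add (hg.const_mul r)

theorem integral_add_mul (hf : Integrable f P) (hg : Integrable g P) (r : ℝ) :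
    ∫ ω, (f ω + r * g ω) ∂P = ∫ ω, f ω ∂P + r * ∫ ω, g ω ∂P := by
  rw [integral_add hf (hg.const_mul r), integral_const_mul]

end LinearCombination

/-! ### Expected decrease of the global cost in one step. -/

section Descent

variable {n p : ℕ} {Ξ Ω : Type*} [MeasurableSpace Ξ] [MeasurableSpace Ω] {c ζ σ₂ : ℝ}
  {F : Fin n → EuclideanSpace ℝ (Fin p) → Ξ → ℝ} {μ : Fin n → Measure Ξ}
  {P : Measure Ω} [IsProbabilityMeasure P] {nc : ℕ} {τ : Fin n → Measure (Finset (Fin p))}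
  {X : Ω → Fin n → EuclideanSpace ℝ (Fin p)} {Z : Fin n → Ω → Ξ × Finset (Fin p)}

theorem integral_normSq_sampleGrad_sub_le (hF : CostAssumptions F μ c ζ σ₂) (hnc : 0 < nc)
    (hp : 0 < p) (o : DiffScheme) {d : Fin n → Fin p → ℝ} (hd : ∀ i j, 0 < d i j) {D : ℝ}
    (hD : ∀ i j, d i j ^ 2 ≤ D) (hZ : IsFreshSample P μ nc τ X Z) (i : Fin n) :
    ∫ ω, ‖sampleGrad F o nc d X Z i ω - meanGrad F μ o d (X ω) i‖ ^ 2 ∂P ≤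
      ∫ ω, ‖sampleGrad F o nc d X Z i ω‖ ^ 2 ∂P := by
  have hg := (memLp_sampleGrad hF hnc o hd hD hZ i).1
  have hm := memLp_meanGrad hF o hd hD hZ i
  have h1 := integral_inner_sampleGrad hF hnc hp o hd hD hZ i (measurable_meanGrad hF o d i) hm
  have hgm := integrable_inner_of_memLp hm hg
  have hmm := integrable_inner_of_memLp hm hm
  have h2 : ∀ ω, ‖sampleGrad F o nc d X Z i ω - meanGrad F μ o d (X ω) i‖ ^ 2 =
      ‖sampleGrad F o nc d X Z i ω‖ ^ 2 -
        2 * inner ℝ (meanGrad F μ o d (X ω) i) (sampleGrad F o nc d X Z i ω) +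
        inner ℝ (meanGrad F μ o d (X ω) i) (meanGrad F μ o d (X ω) i) := fun ω => by
    rw [norm_sub_sq_real, real_inner_self_eq_norm_sq, real_inner_comm]
  simp only [h2]
  have hsub : Integrable (fun ω => ‖sampleGrad F o nc d X Z i ω‖ ^ 2 -
      2 * inner ℝ (meanGrad F μ o d (X ω) i) (sampleGrad F o nc d X Z i ω)) P :=
    hg.integrable_normSq.sub (hgm.const_mul 2)
  rw [integral_add hsub hmm, integral_sub hg.integrable_normSq (hgm.const_mul 2),
    integral_const_mul, h1]
  have h3 : 0 ≤ ∫ ω, inner ℝ (meanGrad F μ o d (X ω) i) (meanGrad F μ o d (X ω) i) ∂P :=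
    integral_nonneg fun ω => real_inner_self_nonneg
  linarith

/-- The cross terms between agents vanish, leaving `n` diagonal terms with weight `1 / n ^ 2`. The
gain of a factor `n` over the convexity bound is what later turns `n / T` into `1 / T` in the
descent inequality. -/
theorem integral_normSq_avg_sub_le (hF : CostAssumptions F μ c ζ σ₂) (hnc : 0 < nc)
    (hp : 0 < p) (o : DiffScheme) {d : Fin n → Fin p → ℝ} (hd : ∀ i j, 0 < d i j) {D : ℝ}
    (hD : ∀ i j, d i j ^ 2 ≤ D) (hZ : IsFreshSample P μ nc τ X Z) :
    ∫ ω, ‖avg fun i => sampleGrad F o nc d X Z i ω - meanGrad F μ o d (X ω) i‖ ^ 2 ∂P ≤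
      (1 / (n : ℝ)) ^ 2 * ∑ i, ∫ ω, ‖sampleGrad F o nc d X Z i ω‖ ^ 2 ∂P := by
  have hg := fun i => (memLp_sampleGrad hF hnc o hd hD hZ i).1
  have hm := fun i => memLp_meanGrad hF o hd hD hZ i
  set Y : Fin n → Ω → EuclideanSpace ℝ (Fin p) := fun i ω =>
    sampleGrad F o nc d X Z i ω - meanGrad F μ o d (X ω) i with hY
  have hYm : ∀ i, MemLp (Y i) 2 P := fun i => (hg i).sub (hm i)
  have hexp : ∀ ω, ‖avg fun i => Y i ω‖ ^ 2 =
      (1 / (n : ℝ)) ^ 2 * ∑ j, ∑ i, inner ℝ (Y j ω) (Y i ω) := fun ω => by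
    rw [avg, norm_smul, mul_pow, Real.norm_eq_abs, sq_abs, ← real_inner_self_eq_norm_sq, sum_inner]
    simp only [inner_sum]
  have hoff : ∀ j i, i ≠ j → ∫ ω, inner ℝ (Y j ω) (Y i ω) ∂P = 0 := fun j i hij => by
    have h1 := integral_inner_sampleGrad_of_ne hF hnc hp o hd hD hZ hij
    simp only [hY, inner_sub_right (𝕜 := ℝ) _ (sampleGrad F o nc d X Z i _)]
    rw [integral_sub (integrable_inner_of_memLp (hYm j) (hg i))
      (integrable_inner_of_memLp (hYm j) (hm i)), h1, sub_self]
  change ∫ ω, ‖avg fun i => Y i ω‖ ^ 2 ∂P ≤ _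
  simp only [hexp]
  rw [integral_const_mul, integral_finsetSum _ fun j _ => integrable_finsetSum _ fun i _ =>
    integrable_inner_of_memLp (hYm j) (hYm i)]
  refine mul_le_mul_of_nonneg_left (Finset.sum_le_sum fun j _ => ?_) (sq_nonneg _)
  rw [integral_finsetSum _ fun i _ => integrable_inner_of_memLp (hYm j) (hYm i),
    Finset.sum_eq_single j (fun i _ hij => hoff j i hij) (fun h => absurd (Finset.mem_univ j) h)]
  simp only [real_inner_self_eq_norm_sq]
  exact integral_normSq_sampleGrad_sub_le hF hnc hp o hd hD hZ j

theorem integral_inner_avg_sampleGrad (hF : CostAssumptions F μ c ζ σ₂) (hnc : 0 < nc)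
    (hp : 0 < p) (o : DiffScheme) {d : Fin n → Fin p → ℝ} (hd : ∀ i j, 0 < d i j) {D : ℝ}
    (hD : ∀ i j, d i j ^ 2 ≤ D) (hZ : IsFreshSample P μ nc τ X Z)
    {w : (Fin n → EuclideanSpace ℝ (Fin p)) → EuclideanSpace ℝ (Fin p)} (hw : Measurable w)
    (hw2 : MemLp (fun ω => w (X ω)) 2 P) :
    ∫ ω, inner ℝ (w (X ω)) (avg fun i => sampleGrad F o nc d X Z i ω) ∂P =
      ∫ ω, inner ℝ (w (X ω)) (avg (meanGrad F μ o d (X ω))) ∂P := by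
  have hg := fun i => (memLp_sampleGrad hF hnc o hd hD hZ i).1
  have hm := fun i => memLp_meanGrad hF o hd hD hZ i
  simp only [inner_avg]
  rw [integral_const_mul, integral_const_mul,
    integral_finsetSum _ fun i _ => integrable_inner_of_memLp hw2 (hg i),
    integral_finsetSum _ fun i _ => integrable_inner_of_memLp hw2 (hm i)]
  congr 1
  exact Finset.sum_congr rfl fun i _ => integral_inner_sampleGrad hF hnc hp o hd hD hZ i hw hw2

theorem integral_normSq_avg_sampleGrad_le (hF : CostAssumptions F μ c ζ σ₂) (hnc : 0 < nc)
    (hp : 0 < p) (o : DiffScheme) {d : Fin n → Fin p → ℝ} (hd : ∀ i j, 0 < d i j) {D : ℝ}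
    (hD : ∀ i j, d i j ^ 2 ≤ D) (hZ : IsFreshSample P μ nc τ X Z) :
    ∫ ω, ‖avg fun i => sampleGrad F o nc d X Z i ω‖ ^ 2 ∂P ≤
      ∫ ω, ‖avg (meanGrad F μ o d (X ω))‖ ^ 2 ∂P +
      (1 / (n : ℝ)) ^ 2 * ∑ i, ∫ ω, ‖sampleGrad F o nc d X Z i ω‖ ^ 2 ∂P := by
  have hg := memLp_avg fun i => (memLp_sampleGrad hF hnc o hd hD hZ i).1
  have hm : MemLp (fun ω => avg (meanGrad F μ o d (X ω))) 2 P :=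
    memLp_avg fun i => memLp_meanGrad hF o hd hD hZ i
  have hmm : Measurable fun x => avg (meanGrad F μ o d x) :=
    measurable_avg.comp (measurable_pi_lambda _ fun i => measurable_meanGrad hF o d i)
  have h1 := integral_inner_avg_sampleGrad hF hnc hp o hd hD hZ hmm hm
  have h2 := integral_normSq_avg_sub_le hF hnc hp o hd hD hZ
  have hi := integrable_inner_of_memLp hm hg
  have hs : Integrable (fun ω => ‖(avg fun i => sampleGrad F o nc d X Z i ω) -
      avg (meanGrad F μ o d (X ω))‖ ^ 2) P := (hg.sub hm).integrable_normSq
  have h3 : ∀ ω, ‖avg fun i => sampleGrad F o nc d X Z i ω‖ ^ 2 =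
      ‖(avg fun i => sampleGrad F o nc d X Z i ω) - avg (meanGrad F μ o d (X ω))‖ ^ 2 +
      2 * inner ℝ (avg (meanGrad F μ o d (X ω))) (avg fun i => sampleGrad F o nc d X Z i ω) +
      (-1) * ‖avg (meanGrad F μ o d (X ω))‖ ^ 2 := fun ω => by
    rw [norm_sub_sq_real, real_inner_comm]
    ring
  simp only [h3]
  rw [integral_add_mul (integrable_add_mul hs hi 2) hm.integrable_normSq,
    integral_add_mul hs hi, h1]
  simp only [avg_sub_avg, real_inner_self_eq_norm_sq]
  linarith

/-- In the quadratic upper bound the estimator may be replaced by its conditional mean `m` in the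
linear term, and `-2⟪∇f, m⟫ = -‖∇f‖² - ‖m‖² + ‖∇f - m‖²`. The restriction `η * c ≤ 1` lets `-‖m‖²`
absorb the squared mean in the quadratic term, so only the fluctuation remains there. -/
theorem integral_globalCost_step_le (hF : CostAssumptions F μ c ζ σ₂) (hc : 0 < c) (hn : 0 < n)
    (hnc : 0 < nc) (hp : 0 < p) (o : DiffScheme) {d : Fin n → Fin p → ℝ} (hd : ∀ i j, 0 < d i j)
    {D : ℝ} (hD : ∀ i j, d i j ^ 2 ≤ D) (hZ : IsFreshSample P μ nc τ X Z) {η : ℝ} (hη : 0 ≤ η)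
    (hηc : η * c ≤ 1) :
    ∫ ω, globalCost F μ (avg (X ω) - η • avg fun i => sampleGrad F o nc d X Z i ω) ∂P ≤
      ∫ ω, globalCost F μ (avg (X ω)) ∂P -
        η / 2 * ∫ ω, ‖∇ (globalCost F μ) (avg (X ω))‖ ^ 2 ∂P +
        η * c ^ 2 * (∫ ω, consensusError (X ω) ∂P + p * D) +
        c * η ^ 2 / (2 * n) * (1 / (n : ℝ) * ∑ i, ∫ ω, ‖sampleGrad F o nc d X Z i ω‖ ^ 2 ∂P) := by
  have hn' : (0 : ℝ) < n := by exact_mod_cast hn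
  have hs := (hF.smooth_globalCost hn).1
  have hX : MemLp (fun ω => avg (X ω)) 2 P := memLp_avg hZ.memLp
  have hg := memLp_avg fun i => (memLp_sampleGrad hF hnc o hd hD hZ i).1
  have hm : MemLp (fun ω => avg (meanGrad F μ o d (X ω))) 2 P :=
    memLp_avg fun i => memLp_meanGrad hF o hd hD hZ i
  have hG := hs.memLp_gradient hX
  have hGm : Measurable fun x : Fin n → EuclideanSpace ℝ (Fin p) => ∇ (globalCost F μ) (avg x) :=
    hs.continuous_gradient.measurable.comp measurable_avg
  have h1 := integral_inner_avg_sampleGrad hF hnc hp o hd hD hZ hGm hG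
  have h2 := integral_normSq_avg_sampleGrad_le hF hnc hp o hd hD hZ
  have hf := hs.integrable_comp hX
  have hf' := hs.integrable_comp (hX.sub (hg.const_smul η))
  have hGg := integrable_inner_of_memLp hG hg
  have hGM := integrable_inner_of_memLp hG hm
  have hcons := memLp_consensus hZ.memLp
  have hA : ∫ ω, globalCost F μ (avg (X ω) - η • avg fun i => sampleGrad F o nc d X Z i ω) ∂P ≤
      ∫ ω, globalCost F μ (avg (X ω)) ∂P - η * ∫ ω, inner ℝ (∇ (globalCost F μ) (avg (X ω)))
        (avg fun i => sampleGrad F o nc d X Z i ω) ∂P +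
      c / 2 * η ^ 2 * ∫ ω, ‖avg fun i => sampleGrad F o nc d X Z i ω‖ ^ 2 ∂P := by
    have hi := integrable_add_mul (integrable_add_mul hf hGg (-η)) hg.integrable_normSq
      (c / 2 * η ^ 2)
    have hle := integral_mono hf' hi fun ω => (by
      have h := hs.upper (avg (X ω)) (-(η • avg fun i => sampleGrad F o nc d X Z i ω))
      rw [← sub_eq_add_neg, inner_neg_right, inner_smul_right, norm_neg, norm_smul, mul_pow,
        Real.norm_eq_abs, sq_abs] at h
      simp only [Pi.sub_apply, Pi.smul_apply]
      linarith)
    rw [integral_add_mul (integrable_add_mul hf hGg (-η)) hg.integrable_normSq,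
      integral_add_mul hf hGg] at hle
    simp only [Pi.sub_apply, Pi.smul_apply] at hle
    linarith
  have hB : -(2 * ∫ ω, inner ℝ (∇ (globalCost F μ) (avg (X ω))) (avg (meanGrad F μ o d (X ω))) ∂P) ≤
      -(∫ ω, ‖∇ (globalCost F μ) (avg (X ω))‖ ^ 2 ∂P) -
        ∫ ω, ‖avg (meanGrad F μ o d (X ω))‖ ^ 2 ∂P +
        (2 * c ^ 2 * ∫ ω, consensusError (X ω) ∂P + 2 * c ^ 2 * (p * D)) := by
    have hdiff : ∫ ω, ‖∇ (globalCost F μ) (avg (X ω)) - avg (meanGrad F μ o d (X ω))‖ ^ 2 ∂P ≤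
        2 * c ^ 2 * ∫ ω, consensusError (X ω) ∂P + 2 * c ^ 2 * (p * D) := by
      have h5 : Integrable (fun ω => 2 * c ^ 2 * consensusError (X ω) + 2 * c ^ 2 * (p * D)) P :=
        (hcons.const_mul _).add (integrable_const _)
      refine (integral_mono (hG.sub hm).integrable_normSq h5 fun ω =>
        normSq_gradient_sub_avg_le hF hn o hd hD (X ω)).trans_eq ?_
      rw [integral_add (hcons.const_mul _) (integrable_const _), integral_const_mul, integral_const,
        probReal_univ, one_smul]
    have h6 : ∫ ω, ‖∇ (globalCost F μ) (avg (X ω)) - avg (meanGrad F μ o d (X ω))‖ ^ 2 ∂P =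
        ∫ ω, ‖∇ (globalCost F μ) (avg (X ω))‖ ^ 2 ∂P -
        2 * ∫ ω, inner ℝ (∇ (globalCost F μ) (avg (X ω))) (avg (meanGrad F μ o d (X ω))) ∂P +
        ∫ ω, ‖avg (meanGrad F μ o d (X ω))‖ ^ 2 ∂P := by
      have h7 : ∀ ω, ‖∇ (globalCost F μ) (avg (X ω)) - avg (meanGrad F μ o d (X ω))‖ ^ 2 =
          ‖∇ (globalCost F μ) (avg (X ω))‖ ^ 2 +
          (-2) * inner ℝ (∇ (globalCost F μ) (avg (X ω))) (avg (meanGrad F μ o d (X ω))) +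
          1 * ‖avg (meanGrad F μ o d (X ω))‖ ^ 2 := fun ω => by
        rw [norm_sub_sq_real]
        ring
      simp only [h7]
      rw [integral_add_mul (integrable_add_mul hG.integrable_normSq hGM (-2))
        hm.integrable_normSq, integral_add_mul hG.integrable_normSq hGM]
      ring
    linarith
  rw [h1] at hA
  set s : ℝ := ∑ i, ∫ ω, ‖sampleGrad F o nc d X Z i ω‖ ^ 2 ∂P
  set M : ℝ := ∫ ω, ‖avg (meanGrad F μ o d (X ω))‖ ^ 2 ∂P with hMdef
  have hM : 0 ≤ M := integral_nonneg fun ω => sq_nonneg _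
  have h8 : c * η ^ 2 / (2 * n) * (1 / (n : ℝ) * s) = c / 2 * η ^ 2 * ((1 / (n : ℝ)) ^ 2 * s) := by
    field_simp
  rw [h8]
  have h9 := mul_le_mul_of_nonneg_left h2 (show 0 ≤ c / 2 * η ^ 2 by positivity)
  have h10 := mul_le_mul_of_nonneg_left hB (show 0 ≤ η / 2 by positivity)
  have h11 : c / 2 * η ^ 2 * M ≤ η / 2 * M := by
    refine mul_le_mul_of_nonneg_right ?_ hM
    nlinarith
  linarith

/-- A crude bound by Young's inequality, free of any restriction on `η`, for the regime where `n /
T` is not small. -/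
theorem integral_globalCost_step_le' (hF : CostAssumptions F μ c ζ σ₂) (hc : 0 < c) (hn : 0 < n)
    (hnc : 0 < nc) (o : DiffScheme) {d : Fin n → Fin p → ℝ} (hd : ∀ i j, 0 < d i j)
    {D : ℝ} (hD : ∀ i j, d i j ^ 2 ≤ D) (hZ : IsFreshSample P μ nc τ X Z) (η : ℝ) :
    ∫ ω, globalCost F μ (avg (X ω) - η • avg fun i => sampleGrad F o nc d X Z i ω) ∂P ≤
      ∫ ω, globalCost F μ (avg (X ω)) ∂P +
        1 / 2 * ∫ ω, ‖∇ (globalCost F μ) (avg (X ω))‖ ^ 2 ∂P +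
        (c + 1) / 2 * η ^ 2 *
          (1 / (n : ℝ) * ∑ i, ∫ ω, ‖sampleGrad F o nc d X Z i ω‖ ^ 2 ∂P) := by
  have hs := (hF.smooth_globalCost hn).1
  have hX : MemLp (fun ω => avg (X ω)) 2 P := memLp_avg hZ.memLp
  have hgi := fun i => (memLp_sampleGrad hF hnc o hd hD hZ i).1
  have hg := memLp_avg hgi
  have hG := (hs.memLp_gradient hX).integrable_normSq
  have hf := hs.integrable_comp hX
  have hf' := hs.integrable_comp (hX.sub (hg.const_smul η))
  have hsum : Integrable (fun ω => 1 / (n : ℝ) * ∑ i, ‖sampleGrad F o nc d X Z i ω‖ ^ 2) P :=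
    (integrable_finsetSum _ fun i _ => (hgi i).integrable_normSq).const_mul _
  rw [← integral_finsetSum _ fun i _ => (hgi i).integrable_normSq,
    ← integral_const_mul (1 / (n : ℝ)), ← integral_add_mul hf hG,
    ← integral_add_mul (integrable_add_mul hf hG _) hsum]
  refine integral_mono hf' (integrable_add_mul (integrable_add_mul hf hG _) hsum _) fun ω => ?_
  have h := hs.upper (avg (X ω)) (-(η • avg fun i => sampleGrad F o nc d X Z i ω))
  have h1 := abs_real_inner_le_norm (∇ (globalCost F μ) (avg (X ω)))
    (-(η • avg fun i => sampleGrad F o nc d X Z i ω))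
  have h2 := normSq_avg_le fun i => sampleGrad F o nc d X Z i ω
  have h3 := le_abs_self (inner ℝ (∇ (globalCost F μ) (avg (X ω)))
    (-(η • avg fun i => sampleGrad F o nc d X Z i ω)))
  rw [← sub_eq_add_neg] at h
  have h4 : ‖-(η • avg fun i => sampleGrad F o nc d X Z i ω)‖ ^ 2 =
      η ^ 2 * ‖avg fun i => sampleGrad F o nc d X Z i ω‖ ^ 2 := by
    rw [norm_neg, norm_smul, mul_pow, Real.norm_eq_abs, sq_abs]
  have h5 := mul_le_mul_of_nonneg_left h2 (show 0 ≤ (c + 1) / 2 * η ^ 2 by positivity)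
  have h6 := sq_nonneg (‖∇ (globalCost F μ) (avg (X ω))‖ -
    ‖-(η • avg fun i => sampleGrad F o nc d X Z i ω)‖)
  beta_reduce
  nlinarith

theorem avg_integral_normSq_sampleGrad_le (hF : CostAssumptions F μ c ζ σ₂) (hn : 0 < n)
    (hnc : 0 < nc) (o : DiffScheme) {d : Fin n → Fin p → ℝ} (hd : ∀ i j, 0 < d i j)
    {D : ℝ} (hD : ∀ i j, d i j ^ 2 ≤ D) (hZ : IsFreshSample P μ nc τ X Z) {σ₁ : ℝ}
    (hσ₁ : p * ζ ^ 2 ≤ σ₁ ^ 2) :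
    1 / (n : ℝ) * ∑ i, ∫ ω, ‖sampleGrad F o nc d X Z i ω‖ ^ 2 ∂P ≤
      p * (4 * σ₁ ^ 2 + 12 * (∫ ω, ‖∇ (globalCost F μ) (avg (X ω))‖ ^ 2 ∂P + σ₂ ^ 2 +
        c ^ 2 * ∫ ω, consensusError (X ω) ∂P) + c ^ 2 * (p * D)) := by
  have hn' : (0 : ℝ) < n := by exact_mod_cast hn
  have hG := ((hF.smooth_globalCost hn).1.memLp_gradient (memLp_avg hZ.memLp)).integrable_normSq
  have hGi := fun i => ((hF.isSmoothWith_localCost i).memLp_gradient (hZ.memLp i)).integrable_normSq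
  have hcons := memLp_consensus hZ.memLp
  have h1 : 1 / (n : ℝ) * ∑ i, ∫ ω, ‖∇ (localCost (F i) (μ i)) (X ω i)‖ ^ 2 ∂P ≤
      3 * (∫ ω, ‖∇ (globalCost F μ) (avg (X ω))‖ ^ 2 ∂P + σ₂ ^ 2 +
        c ^ 2 * ∫ ω, consensusError (X ω) ∂P) := by
    have h2 : Integrable (fun ω => ‖∇ (globalCost F μ) (avg (X ω))‖ ^ 2 + σ₂ ^ 2) P :=
      hG.add (integrable_const _)
    rw [← integral_finsetSum _ fun i _ => hGi i, ← integral_const_mul]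
    refine (integral_mono ((integrable_finsetSum _ fun i _ => hGi i).const_mul _)
      ((h2.add (hcons.const_mul (c ^ 2))).const_mul 3) fun ω =>
        avg_normSq_gradient_le hF hn (X ω)).trans_eq ?_
    rw [integral_const_mul, integral_add' h2 (hcons.const_mul _), integral_add hG
      (integrable_const _), integral_const, probReal_univ, one_smul, integral_const_mul]
  calc _ ≤ 1 / (n : ℝ) * ∑ i, ((p : ℝ) * (4 * σ₁ ^ 2 + c ^ 2 * (p * D)) +
        4 * p * ∫ ω, ‖∇ (localCost (F i) (μ i)) (X ω i)‖ ^ 2 ∂P) := by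
        gcongr with i
        refine (memLp_sampleGrad hF hnc o hd hD hZ i).2.trans ?_
        have hp : (0 : ℝ) ≤ p := by positivity
        nlinarith
    _ = p * (4 * σ₁ ^ 2 + c ^ 2 * (p * D)) +
        4 * p * (1 / (n : ℝ) * ∑ i, ∫ ω, ‖∇ (localCost (F i) (μ i)) (X ω i)‖ ^ 2 ∂P) := by
        simp only [Finset.sum_add_distrib, ← Finset.mul_sum, Finset.sum_const, Finset.card_univ,
          Fintype.card_fin, nsmul_eq_mul]
        field_simp
    _ ≤ p * (4 * σ₁ ^ 2 + c ^ 2 * (p * D)) + 4 * p *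
        (3 * (∫ ω, ‖∇ (globalCost F μ) (avg (X ω))‖ ^ 2 ∂P + σ₂ ^ 2 +
        c ^ 2 * ∫ ω, consensusError (X ω) ∂P)) := by gcongr
    _ = _ := by ring

end Descent

/-! ### The Lyapunov function of the deviation dynamics. -/

section Lyapunov

/-- A symmetric positive semidefinite operator whose norm is at most `ρ`. -/
structure IsPSDWith {H : Type*} [NormedAddCommGroup H] [InnerProductSpace ℝ H] (Λ : H →ₗ[ℝ] H)
    (ρ : ℝ) : Prop where
  symm : ∀ x y, inner ℝ x (Λ y) = inner ℝ y (Λ x)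
  nonneg : ∀ x, 0 ≤ inner ℝ x (Λ x)
  le : ∀ x, inner ℝ x (Λ x) ≤ ρ * ‖x‖ ^ 2
  normSq_le : ∀ x, ‖Λ x‖ ^ 2 ≤ ρ * inner ℝ x (Λ x)

variable {H : Type*} [NormedAddCommGroup H] [InnerProductSpace ℝ H] {Λ : H →ₗ[ℝ] H}
  {κ₁ h ρ ρ₂ : ℝ} {y u w : H}

/-- The Lyapunov function of the primal-dual consensus dynamics. -/
noncomputable def lyapunov (Λ : H →ₗ[ℝ] H) (κ₁ : ℝ) (y u : H) : ℝ :=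
  1 / 2 * ‖y‖ ^ 2 + inner ℝ y u + (1 + κ₁) / 2 * inner ℝ u (Λ u)

/-- Completing the square with `‖y + (1 + ρ₂) • u‖ ^ 2` bounds the mixed term; the condition on `κ₁`
makes the form in `u` exceed what this consumes by `ρ₂ / 2 * ‖u‖ ^ 2`. -/
theorem le_lyapunov (hρ₂ : 0 < ρ₂) (hκ : 1 + ρ₂ < κ₁ * ρ₂)
    (hu : ρ₂ * ‖u‖ ^ 2 ≤ inner ℝ u (Λ u)) :
    ρ₂ / (2 * (1 + ρ₂)) * (‖y‖ ^ 2 + ‖u‖ ^ 2) ≤ lyapunov Λ κ₁ y u := by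
  have hκ1 : 0 < κ₁ := by
    by_contra hcon
    nlinarith
  have h1 : (1 + κ₁) / 2 * (ρ₂ * ‖u‖ ^ 2) ≤ (1 + κ₁) / 2 * inner ℝ u (Λ u) :=
    mul_le_mul_of_nonneg_left hu (by linarith)
  have h2 : 0 ≤ ‖y + (1 + ρ₂) • u‖ ^ 2 := sq_nonneg _
  rw [norm_add_sq_real, inner_smul_right, norm_smul, mul_pow, Real.norm_eq_abs, sq_abs] at h2
  have h3 : (1 + 2 * ρ₂) / 2 * ‖u‖ ^ 2 ≤ (1 + κ₁) / 2 * (ρ₂ * ‖u‖ ^ 2) := by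
    nlinarith [sq_nonneg ‖u‖]
  have h4 : -(1 / (2 * (1 + ρ₂)) * ‖y‖ ^ 2 + (1 + ρ₂) / 2 * ‖u‖ ^ 2) ≤ inner ℝ y u := by
    have h5 := mul_nonneg (show 0 ≤ 1 / (2 * (1 + ρ₂)) by positivity) h2
    have h6 : 1 / (2 * (1 + ρ₂)) *
        (‖y‖ ^ 2 + 2 * ((1 + ρ₂) * inner ℝ y u) + (1 + ρ₂) ^ 2 * ‖u‖ ^ 2) =
        1 / (2 * (1 + ρ₂)) * ‖y‖ ^ 2 + inner ℝ y u + (1 + ρ₂) / 2 * ‖u‖ ^ 2 := by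
      field_simp
    linarith
  have h7 : ρ₂ / (2 * (1 + ρ₂)) = 1 / 2 - 1 / (2 * (1 + ρ₂)) := by
    field_simp
    ring
  have h8 : ρ₂ / (2 * (1 + ρ₂)) ≤ ρ₂ / 2 := by
    apply div_le_div_of_nonneg_left hρ₂.le (by norm_num)
    linarith
  have h9 := mul_le_mul_of_nonneg_right h8 (sq_nonneg ‖u‖)
  have h10 : ρ₂ / (2 * (1 + ρ₂)) * ‖y‖ ^ 2 = 1 / 2 * ‖y‖ ^ 2 - 1 / (2 * (1 + ρ₂)) * ‖y‖ ^ 2 := by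
    rw [h7]
    ring
  unfold lyapunov
  rw [mul_add, h10]
  linarith

theorem lyapunov_le (hρ₂ : 0 < ρ₂) (hu : ρ₂ * ‖u‖ ^ 2 ≤ inner ℝ u (Λ u)) :
    lyapunov Λ κ₁ y u ≤ ‖y‖ ^ 2 + (1 / (2 * ρ₂) + (1 + κ₁) / 2) * inner ℝ u (Λ u) := by
  have h1 := norm_sub_sq_real y u
  have h2 : 0 ≤ ‖y - u‖ ^ 2 := sq_nonneg _
  have h3 : 1 / 2 * ‖u‖ ^ 2 ≤ 1 / (2 * ρ₂) * inner ℝ u (Λ u) := by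
    have := mul_le_mul_of_nonneg_left hu (show 0 ≤ 1 / (2 * ρ₂) by positivity)
    calc 1 / 2 * ‖u‖ ^ 2 = 1 / (2 * ρ₂) * (ρ₂ * ‖u‖ ^ 2) := by field_simp
      _ ≤ _ := this
  unfold lyapunov
  linarith

/-- To first order in `h` the three terms contribute `-1`, `-κ₁` and `1 + κ₁` times `⟪y, Λ u⟫`,
which cancel: this dictates the weight `(1 + κ₁) / 2`. What is left is `h * (‖y‖ ^ 2 - κ₁ * A - C)`
plus second order terms, bounded by `A` and `C` and absorbed through `hcond`. -/
theorem lyapunov_step_le (hΛ : IsPSDWith Λ ρ) (hh : 0 < h) (hh5 : h < 1 / 5) (hκ : 1 < κ₁)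
    (hρ₂ : 0 < ρ₂) (hρ : ρ₂ ≤ ρ)
    (hcond : h * (ρ + (2 * κ₁ ^ 2 + 1) * ρ ^ 2 + 1) < (κ₁ - 1) * ρ₂ - 1)
    (hy : ρ₂ * ‖y‖ ^ 2 ≤ inner ℝ y (Λ y)) :
    lyapunov Λ κ₁ (y - h • Λ (κ₁ • y + u)) (u + h • y) ≤
      lyapunov Λ κ₁ y u - h * (ρ₂ * ‖y‖ ^ 2 + 1 / 2 * inner ℝ u (Λ u)) := by
  have hρ0 : 0 < ρ := hρ₂.trans_le hρ
  have hsym := hΛ.symm u y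
  set A := inner ℝ y (Λ y) with hA
  set B := inner ℝ y (Λ u) with hB
  set C := inner ℝ u (Λ u) with hC
  have hAle : A ≤ ρ * ‖y‖ ^ 2 := hΛ.le y
  have hA0 : 0 ≤ A := hΛ.nonneg y
  have hC0 : 0 ≤ C := hΛ.nonneg u
  have hyN : ‖Λ y‖ ^ 2 ≤ ρ * A := hΛ.normSq_le y
  have huN : ‖Λ u‖ ^ 2 ≤ ρ * C := hΛ.normSq_le u
  have hBge : -(A + C) ≤ 2 * B := by
    have h1 := hΛ.nonneg (y + u)
    rw [map_add, inner_add_left, inner_add_right, inner_add_right, hsym] at h1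
    linarith
  have hN : ‖κ₁ • Λ y + Λ u‖ ^ 2 ≤ 2 * κ₁ ^ 2 * (ρ * A) + 2 * (ρ * C) := by
    have h1 := parallelogram_law_with_norm ℝ (κ₁ • Λ y) (Λ u)
    have h2 : ‖κ₁ • Λ y‖ ^ 2 = κ₁ ^ 2 * ‖Λ y‖ ^ 2 := by
      rw [norm_smul, mul_pow, Real.norm_eq_abs, sq_abs]
    have h3 := mul_le_mul_of_nonneg_left hyN (sq_nonneg κ₁)
    nlinarith [mul_self_nonneg ‖κ₁ • Λ y - Λ u‖]
  have e1 : ‖y - h • Λ (κ₁ • y + u)‖ ^ 2 = ‖y‖ ^ 2 - 2 * (h * (κ₁ * A + B)) +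
      h ^ 2 * ‖κ₁ • Λ y + Λ u‖ ^ 2 := by
    rw [map_add, map_smul, norm_sub_sq_real, inner_smul_right, inner_add_right, inner_smul_right,
      norm_smul, mul_pow, Real.norm_eq_abs, sq_abs]
  have e2 : inner ℝ (y - h • Λ (κ₁ • y + u)) (u + h • y) = inner ℝ y u + h * ‖y‖ ^ 2 -
      h * (κ₁ * B + C) - h ^ 2 * (κ₁ * A + B) := by
    simp only [map_add, map_smul, inner_sub_left, inner_add_right, inner_add_left, inner_smul_left,
      inner_smul_right, real_inner_self_eq_norm_sq, conj_trivial, real_inner_comm _ (Λ y),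
      real_inner_comm _ (Λ u), hsym]
    rw [← hA, ← hB, ← hC]
    ring
  have e3 : inner ℝ (u + h • y) (Λ (u + h • y)) = C + 2 * (h * B) + h ^ 2 * A := by
    simp only [map_add, map_smul, inner_add_right, inner_add_left, inner_smul_left,
      inner_smul_right, conj_trivial, hsym]
    ring
  unfold lyapunov
  rw [e1, e2, e3]
  -- `hcond` gives `h ρ (2κ₁² + 1) ≤ κ₁`, and `2κ₁² + 1 ≥ (14/5) κ₁`, so `h ρ ≤ 5/14`. Together with
  -- `h / 2 < 1/10` this keeps the second order terms in `C` below `h / 2 * C`.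
  have hhρ : h * ρ ≤ 9 / 25 := by
    have h1 : h * ρ * (2 * κ₁ ^ 2 + 1) * ρ ≤ κ₁ * ρ := by
      have h2 : (κ₁ - 1) * ρ₂ ≤ (κ₁ - 1) * ρ := mul_le_mul_of_nonneg_left hρ (by linarith)
      have h7 : 0 < h * (ρ + 1) := by positivity
      linarith
    have h3 : h * ρ * (2 * κ₁ ^ 2 + 1) ≤ κ₁ := le_of_mul_le_mul_right h1 hρ0
    have h4 : 14 / 5 * κ₁ ≤ 2 * κ₁ ^ 2 + 1 := by nlinarith [sq_nonneg (κ₁ - 7 / 10)]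
    have h5 : h * ρ * (14 / 5 * κ₁) ≤ κ₁ :=
      (mul_le_mul_of_nonneg_left h4 (mul_pos hh hρ0).le).trans h3
    have h6 : h * ρ * (14 / 5) * κ₁ ≤ 1 * κ₁ := by linarith
    have h7 := le_of_mul_le_mul_right h6 (by linarith)
    linarith
  have hu1 : h ^ 2 * (ρ * C) + h ^ 2 / 2 * C ≤ h / 2 * C := by
    have h1 : h * ρ + h / 2 ≤ 1 / 2 := by linarith
    have h2 := mul_le_mul_of_nonneg_right h1 (mul_nonneg hh.le hC0)
    linarith
  have hy1 : h ^ 2 * κ₁ ^ 2 * (ρ * A) + h ^ 2 * A + h * ‖y‖ ^ 2 - h * κ₁ * A ≤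
      -(h * (ρ₂ * ‖y‖ ^ 2)) := by
    have h1 : h * (κ₁ ^ 2 * ρ ^ 2 + ρ) ≤ (κ₁ - 1) * ρ₂ - 1 := by
      have h6 : 0 ≤ h * (κ₁ ^ 2 * ρ ^ 2 + ρ ^ 2 + 1) := by positivity
      linarith
    have h2 := mul_le_mul_of_nonneg_right h1 (mul_nonneg hh.le (sq_nonneg ‖y‖))
    have h3 : h ^ 2 * κ₁ ^ 2 * ρ * A ≤ h ^ 2 * κ₁ ^ 2 * ρ * (ρ * ‖y‖ ^ 2) :=
      mul_le_mul_of_nonneg_left hAle (by positivity)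
    have h4 : h ^ 2 * A ≤ h ^ 2 * (ρ * ‖y‖ ^ 2) := mul_le_mul_of_nonneg_left hAle (by positivity)
    have h5 : h * κ₁ * (ρ₂ * ‖y‖ ^ 2) ≤ h * κ₁ * A := mul_le_mul_of_nonneg_left hy (by positivity)
    linarith
  have hN1 := mul_le_mul_of_nonneg_left hN (show 0 ≤ h ^ 2 / 2 by positivity)
  have hB1 := mul_le_mul_of_nonneg_left hBge (show 0 ≤ h ^ 2 / 2 by positivity)
  have hκA : 0 ≤ h ^ 2 * (κ₁ * A) := by positivity
  linarith

/-- Only `y` is perturbed, so the linear term is `⟪y + u, w⟫`; Young's inequality with weight `s`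
and coercivity turn it into a relative increase `s / c₀`. -/
theorem lyapunov_sub_le {s c₀ : ℝ} (hs : 0 < s) (hc₀ : 0 < c₀)
    (hlow : c₀ * (‖y‖ ^ 2 + ‖u‖ ^ 2) ≤ lyapunov Λ κ₁ y u) :
    lyapunov Λ κ₁ (y - w) u ≤
      (1 + s / c₀) * lyapunov Λ κ₁ y u + (1 / 2 + 1 / (2 * s)) * ‖w‖ ^ 2 := by
  have h1 : lyapunov Λ κ₁ (y - w) u =
      lyapunov Λ κ₁ y u - inner ℝ (y + u) w + 1 / 2 * ‖w‖ ^ 2 := by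
    unfold lyapunov
    rw [norm_sub_sq_real, inner_sub_left, inner_add_left, real_inner_comm w u]
    ring
  have h2 : -inner ℝ (y + u) w ≤ s / 2 * ‖y + u‖ ^ 2 + 1 / (2 * s) * ‖w‖ ^ 2 := by
    have h3 : 0 ≤ ‖s • (y + u) + w‖ ^ 2 := sq_nonneg _
    rw [norm_add_sq_real, inner_smul_left, norm_smul, mul_pow, Real.norm_eq_abs, sq_abs,
      conj_trivial] at h3
    have h4 := mul_nonneg (show 0 ≤ 1 / (2 * s) by positivity) h3
    have h5 : 1 / (2 * s) * (s ^ 2 * ‖y + u‖ ^ 2 + 2 * (s * inner ℝ (y + u) w) + ‖w‖ ^ 2) =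
        s / 2 * ‖y + u‖ ^ 2 + inner ℝ (y + u) w + 1 / (2 * s) * ‖w‖ ^ 2 := by
      field_simp
    linarith
  have h6 : ‖y + u‖ ^ 2 ≤ 2 * (‖y‖ ^ 2 + ‖u‖ ^ 2) := by
    have := parallelogram_law_with_norm ℝ y u
    nlinarith [mul_self_nonneg ‖y - u‖]
  have h7 : s / 2 * ‖y + u‖ ^ 2 ≤ s / c₀ * lyapunov Λ κ₁ y u := by
    calc s / 2 * ‖y + u‖ ^ 2 ≤ s / 2 * (2 * (‖y‖ ^ 2 + ‖u‖ ^ 2)) := by gcongr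
      _ = s / c₀ * (c₀ * (‖y‖ ^ 2 + ‖u‖ ^ 2)) := by field_simp
      _ ≤ _ := by gcongr
  rw [h1]
  linarith

/-- The constants precede the space `H`, which makes them uniform in `n` and `p`. The spectral gap
is required of the vectors involved only, since it fails outside the zero-sum ones. -/
theorem exists_lyapunov_contraction (hh : 0 < h) (hh5 : h < 1 / 5)
    (hρ₂ : 0 < ρ₂) (hρ : ρ₂ ≤ ρ)
    (hcond : h * (ρ + (2 * κ₁ ^ 2 + 1) * ρ ^ 2 + 1) < (κ₁ - 1) * ρ₂ - 1) :
    ∃ c K c₀ C₀ : ℝ, 0 < c ∧ c ≤ 1 ∧ 0 ≤ K ∧ 0 < c₀ ∧ 0 ≤ C₀ ∧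
      ∀ (H : Type) [NormedAddCommGroup H] [InnerProductSpace ℝ H] (Λ : H →ₗ[ℝ] H),
        IsPSDWith Λ ρ → ∀ y u w : H, ρ₂ * ‖y‖ ^ 2 ≤ inner ℝ y (Λ y) →
        ρ₂ * ‖u‖ ^ 2 ≤ inner ℝ u (Λ u) →
        ρ₂ * ‖u + h • y‖ ^ 2 ≤ inner ℝ (u + h • y) (Λ (u + h • y)) →
        c₀ * ‖y‖ ^ 2 ≤ lyapunov Λ κ₁ y u ∧
        lyapunov Λ κ₁ y u ≤ C₀ * (‖y‖ ^ 2 + ‖Λ u‖ ^ 2) ∧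
        lyapunov Λ κ₁ (y - h • Λ (κ₁ • y + u) - w) (u + h • y) ≤
          (1 - c) * lyapunov Λ κ₁ y u + K * ‖w‖ ^ 2 := by
  have hρ0 : 0 < ρ := hρ₂.trans_le hρ
  have hκ1 : 1 + ρ₂ < κ₁ * ρ₂ := by
    have : 0 < h * (ρ + (2 * κ₁ ^ 2 + 1) * ρ ^ 2 + 1) := by positivity
    linarith
  have hκ : 1 < κ₁ := by
    by_contra hcon
    nlinarith
  set K₂ := 1 / (2 * ρ₂) + (1 + κ₁) / 2 with hK₂
  have hK₂1 : 1 ≤ K₂ := by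
    have : 0 < 1 / (2 * ρ₂) := by positivity
    linarith
  -- Half of the noiseless rate: the step without noise contracts by `1 - 2c`, Young's inequality
  -- with weight `c * c₀` costs a factor `1 + c`, and `(1 + c)(1 - 2c) ≤ 1 - c`.
  set c := h / (2 * (1 / ρ₂ + 2 * K₂)) with hc
  have hden : 0 < 1 / ρ₂ + 2 * K₂ := by positivity
  have hc0 : 0 < c := by positivity
  have hc1 : c ≤ 1 := by
    rw [hc, div_le_one (by positivity)]
    have : 0 < 1 / ρ₂ := by positivity
    linarith
  set c₀ := ρ₂ / (2 * (1 + ρ₂)) with hc₀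
  have hc₀0 : 0 < c₀ := by positivity
  refine ⟨c, 1 / 2 + 1 / (2 * (c * c₀)), c₀, 1 + K₂ / ρ₂, hc0, hc1, by positivity, hc₀0,
    by positivity, ?_⟩
  intro H _ _ Λ hΛ y u w hy hu hu'
  have hV := le_lyapunov (y := y) hρ₂ hκ1 hu
  have hup : lyapunov Λ κ₁ y u ≤ ‖y‖ ^ 2 + K₂ * inner ℝ u (Λ u) := lyapunov_le hρ₂ hu
  have hC0 := hΛ.nonneg u
  refine ⟨?_, ?_, ?_⟩
  · have : 0 ≤ c₀ * ‖u‖ ^ 2 := by positivity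
    linarith
  · have h1 : inner ℝ u (Λ u) ≤ ‖Λ u‖ ^ 2 / ρ₂ := by
      rw [le_div_iff₀ hρ₂]
      have h2 := real_inner_le_norm u (Λ u)
      rcases (norm_nonneg u).eq_or_lt with h0 | h0
      · rw [← h0, zero_mul] at h2
        nlinarith [sq_nonneg ‖Λ u‖]
      · have h3 : ρ₂ * ‖u‖ ≤ ‖Λ u‖ := by
          have : ρ₂ * ‖u‖ * ‖u‖ ≤ ‖Λ u‖ * ‖u‖ := by linarith
          exact le_of_mul_le_mul_right this h0
        nlinarith [norm_nonneg (Λ u)]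
    calc lyapunov Λ κ₁ y u ≤ ‖y‖ ^ 2 + K₂ * inner ℝ u (Λ u) := hup
      _ ≤ ‖y‖ ^ 2 + K₂ * (‖Λ u‖ ^ 2 / ρ₂) := by gcongr
      _ ≤ _ := by
        have h3 : 0 ≤ K₂ / ρ₂ * ‖y‖ ^ 2 := by positivity
        have h4 : K₂ * (‖Λ u‖ ^ 2 / ρ₂) = K₂ / ρ₂ * ‖Λ u‖ ^ 2 := by ring
        nlinarith [sq_nonneg ‖Λ u‖]
  · have hstep := lyapunov_step_le (u := u) hΛ hh hh5 hκ hρ₂ hρ hcond hy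
    have hlow' := le_lyapunov (y := y - h • Λ (κ₁ • y + u)) hρ₂ hκ1 hu'
    have hnoise := lyapunov_sub_le (w := w) (mul_pos hc0 hc₀0) hc₀0 hlow'
    rw [mul_div_assoc, div_self hc₀0.ne', mul_one] at hnoise
    have hdec : 2 * c * lyapunov Λ κ₁ y u ≤ h * (ρ₂ * ‖y‖ ^ 2 + 1 / 2 * inner ℝ u (Λ u)) := by
      have h1 : lyapunov Λ κ₁ y u ≤
          (1 / ρ₂ + 2 * K₂) * (ρ₂ * ‖y‖ ^ 2 + 1 / 2 * inner ℝ u (Λ u)) := by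
        have h2 : (1 / ρ₂ + 2 * K₂) * (ρ₂ * ‖y‖ ^ 2 + 1 / 2 * inner ℝ u (Λ u)) =
            ‖y‖ ^ 2 + K₂ * inner ℝ u (Λ u) + (1 / (2 * ρ₂) * inner ℝ u (Λ u) +
              2 * K₂ * ρ₂ * ‖y‖ ^ 2) := by
          field_simp
          ring
        have h3 : 0 ≤ 1 / (2 * ρ₂) * inner ℝ u (Λ u) + 2 * K₂ * ρ₂ * ‖y‖ ^ 2 := by positivity
        linarith
      calc 2 * c * lyapunov Λ κ₁ y u ≤ 2 * c *
            ((1 / ρ₂ + 2 * K₂) * (ρ₂ * ‖y‖ ^ 2 + 1 / 2 * inner ℝ u (Λ u))) := by gcongr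
        _ = _ := by
          rw [hc]
          field_simp
    have hV0 : 0 ≤ lyapunov Λ κ₁ y u := le_trans (by positivity) hV
    have h5 : (1 + c) * lyapunov Λ κ₁ (y - h • Λ (κ₁ • y + u)) (u + h • y) ≤
        (1 + c) * ((1 - 2 * c) * lyapunov Λ κ₁ y u) := by
      refine mul_le_mul_of_nonneg_left ?_ (by linarith)
      linarith
    have h6 : (1 + c) * ((1 - 2 * c) * lyapunov Λ κ₁ y u) ≤ (1 - c) * lyapunov Λ κ₁ y u := by
      nlinarith [mul_nonneg (sq_nonneg c) hV0]
    linarith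

end Lyapunov

/-! ### The coupled recursion of gap, Lyapunov function and gradient norm. -/

section Recursion

/-- The contribution of the smoothing parameters at iteration `k`. -/
noncomputable def smoothingTerm (s : ℝ) (n p k : ℕ) : ℝ :=
  s * (√p / (√n * √((k : ℝ) + 1)))

theorem smoothingTerm_nonneg {s : ℝ} (hs : 0 ≤ s) (n p k : ℕ) : 0 ≤ smoothingTerm s n p k := by
  unfold smoothingTerm
  positivity

theorem sum_one_div_sqrt_le (T : ℕ) :
    ∑ k ∈ Finset.range T, 1 / √((k : ℝ) + 1) ≤ 2 * √(T : ℝ) := by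
  induction T with
  | zero => simp
  | succ m ih =>
    rw [Finset.sum_range_succ]
    have h1 : 0 < √((m : ℝ) + 1) := Real.sqrt_pos.2 (by positivity)
    have h2 : √((m : ℝ) + 1) ^ 2 = (m : ℝ) + 1 := Real.sq_sqrt (by positivity)
    have h3 : √(m : ℝ) ^ 2 = (m : ℝ) := Real.sq_sqrt (by positivity)
    -- The comparison of `1 / √x` with the increments of `2√x`, which telescope.
    have h4 : 1 / √((m : ℝ) + 1) ≤ 2 * √((m : ℝ) + 1) - 2 * √(m : ℝ) := by
      rw [div_le_iff₀ h1]
      nlinarith [sq_nonneg (√((m : ℝ) + 1) - √(m : ℝ))]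
    push_cast
    linarith

theorem sum_smoothingTerm_le {s : ℝ} (hs : 0 ≤ s) (n p T : ℕ) :
    ∑ k ∈ Finset.range T, smoothingTerm s n p k ≤ 2 * s * (√p * √T / √n) := by
  have h : ∀ k, smoothingTerm s n p k = s * (√p / √n) * (1 / √((k : ℝ) + 1)) := fun k => by
    unfold smoothingTerm
    rw [div_mul_eq_div_div]
    ring
  simp only [h, ← Finset.mul_sum]
  calc _ ≤ s * (√p / √n) * (2 * √(T : ℝ)) := by
        gcongr
        exact sum_one_div_sqrt_le T
    _ = _ := by ring

/-- A discrete Grönwall inequality. -/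
theorem le_pow_mul_add_sum {Φ s : ℕ → ℝ} {E : ℝ} (hE : 0 ≤ E) (hs : ∀ k, 0 ≤ s k) {T : ℕ}
    (h : ∀ k < T, Φ (k + 1) ≤ (1 + E) * Φ k + s k) {m : ℕ} (hm : m ≤ T) :
    Φ m ≤ (1 + E) ^ m * (Φ 0 + ∑ k ∈ Finset.range m, s k) := by
  induction m with
  | zero => simp
  | succ m ih =>
    have h1 := ih (by omega)
    have h2 := h m (by omega)
    have h3 : s m ≤ (1 + E) ^ (m + 1) * s m :=
      le_mul_of_one_le_left (hs m) (one_le_pow₀ (by linarith))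
    have h4 : (1 + E) * Φ m ≤ (1 + E) * ((1 + E) ^ m * (Φ 0 + ∑ k ∈ Finset.range m, s k)) :=
      mul_le_mul_of_nonneg_left h1 (by linarith)
    rw [Finset.sum_range_succ, ← add_assoc, mul_add]
    calc _ ≤ _ := h2
      _ ≤ (1 + E) * ((1 + E) ^ m * (Φ 0 + ∑ k ∈ Finset.range m, s k)) +
          (1 + E) ^ (m + 1) * s m := add_le_add h4 h3
      _ = _ := by ring

/-- The recursive inequalities satisfied by the expected optimality gap `a`, the expected Lyapunov
function `W` and the expected squared gradient norm `g`. -/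
structure DescentRecursion (c B D A l s R N : ℝ) (n p T : ℕ) (η : ℝ) (a W g : ℕ → ℝ) : Prop where
  one_le_n : 1 ≤ n
  one_le_p : 1 ≤ p
  one_le_T : 1 ≤ T
  cube_lt : (n : ℝ) ^ 3 < p * T
  p_le : (p : ℝ) ≤ N * T
  η_pos : 0 < η
  η_sq : η ^ 2 = n / (p * T)
  a_nonneg : ∀ k, 0 ≤ a k
  W_nonneg : ∀ k, 0 ≤ W k
  g_nonneg : ∀ k, 0 ≤ g k
  g_le : ∀ k, g k ≤ 2 * l * a k
  a_zero : a 0 ≤ R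
  W_zero : W 0 ≤ R
  W_step : ∀ k < T, W (k + 1) ≤
    (1 - c) * W k + B * (n / T) * (1 + a k + W k + smoothingTerm s n p k)
  a_step : η * l ≤ 1 → ∀ k < T, a (k + 1) ≤
    a k - η / 2 * g k + η * A * (W k + smoothingTerm s n p k) +
      D / T * (1 + a k + W k + smoothingTerm s n p k)
  a_growth : ∀ k < T, a (k + 1) ≤
    (1 + A) * a k + D * (n / T) * (1 + a k + W k + smoothingTerm s n p k)

variable {c B D A l s R N : ℝ}

namespace DescentRecursion

variable {n p T : ℕ} {η : ℝ} {a W g : ℕ → ℝ}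

theorem n_pos (h : DescentRecursion c B D A l s R N n p T η a W g) : (0 : ℝ) < n := by
  have := h.one_le_n
  exact_mod_cast this

theorem p_pos (h : DescentRecursion c B D A l s R N n p T η a W g) : (0 : ℝ) < p := by
  have := h.one_le_p
  exact_mod_cast this

theorem T_pos (h : DescentRecursion c B D A l s R N n p T η a W g) : (0 : ℝ) < T := by
  have := h.one_le_T
  exact_mod_cast this

/-- Equivalent to `n ^ 3 ≤ p * T`: the role of the lower bound on `T` when `n / T` is small. -/
theorem η_mul_n_le (h : DescentRecursion c B D A l s R N n p T η a W g) : η * n ≤ 1 := by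
  have h0 := mul_pos h.p_pos h.T_pos
  have h1 : (η * n) ^ 2 ≤ 1 := by
    rw [mul_pow, h.η_sq, div_mul_eq_mul_div, div_le_one h0]
    calc (n : ℝ) * n ^ 2 = n ^ 3 := by ring
      _ ≤ _ := h.cube_lt.le
  nlinarith [mul_pos h.η_pos h.n_pos]

theorem η_eq (h : DescentRecursion c B D A l s R N n p T η a W g) : η * (√p * √T) = √n := by
  have h1 : η = √(n / (p * T)) := by rw [← h.η_sq, Real.sqrt_sq h.η_pos.le]
  have h2 : 0 < √(p : ℝ) := Real.sqrt_pos.2 h.p_pos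
  have h3 : 0 < √(T : ℝ) := Real.sqrt_pos.2 h.T_pos
  rw [h1, Real.sqrt_div h.n_pos.le, Real.sqrt_mul h.p_pos.le]
  field_simp

theorem one_le_sqrt_n (h : DescentRecursion c B D A l s R N n p T η a W g) : 1 ≤ √(n : ℝ) := by
  rw [Real.one_le_sqrt]
  exact_mod_cast h.one_le_n

theorem N_nonneg (h : DescentRecursion c B D A l s R N n p T η a W g) : 0 ≤ N := by
  have := h.p_pos.trans_le h.p_le
  exact (pos_of_mul_pos_left this h.T_pos.le).le

theorem sqrt_p_le (h : DescentRecursion c B D A l s R N n p T η a W g) : √p ≤ √N * √T := by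
  rw [← Real.sqrt_mul h.N_nonneg]
  exact Real.sqrt_le_sqrt h.p_le

theorem sum_smoothing_le (h : DescentRecursion c B D A l s R N n p T η a W g) (hs : 0 ≤ s) :
    ∑ k ∈ Finset.range T, smoothingTerm s n p k ≤ 2 * s * √N * T := by
  have h1 := h.one_le_sqrt_n
  have h2 : √(T : ℝ) * √T = T := Real.mul_self_sqrt h.T_pos.le
  refine (sum_smoothingTerm_le hs n p T).trans ?_
  calc 2 * s * (√p * √T / √n) ≤ 2 * s * (√p * √T) := by
        gcongr
        exact div_le_self (by positivity) h1
    _ ≤ 2 * s * (√N * √T * √T) := by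
        gcongr
        exact h.sqrt_p_le
    _ = 2 * s * √N * (√T * √T) := by ring
    _ = _ := by rw [h2]

/-- The sum is of order `√(p T / n)`, which is `1 / η`; the decay of the smoothing parameters is
tuned to this. -/
theorem η_mul_sum_smoothing_le (h : DescentRecursion c B D A l s R N n p T η a W g) (hs : 0 ≤ s) :
    η * ∑ k ∈ Finset.range T, smoothingTerm s n p k ≤ 2 * s := by
  have h1 : 0 < √(n : ℝ) := one_pos.trans_le h.one_le_sqrt_n
  refine (mul_le_mul_of_nonneg_left (sum_smoothingTerm_le hs n p T) h.η_pos.le).trans_eq ?_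
  calc η * (2 * s * (√p * √T / √n)) = 2 * s * (η * (√p * √T) / √n) := by ring
    _ = 2 * s := by rw [h.η_eq, div_self h1.ne', mul_one]

theorem W_step_of_small_ratio (h : DescentRecursion c B D A l s R N n p T η a W g)
    (hBn : B * (n / T) ≤ c / 2) : ∀ k < T, W (k + 1) ≤
      (1 - c / 2) * W k + B * (n / T) * (1 + a k + smoothingTerm s n p k) := by
  intro k hk
  have h1 := h.W_step k hk
  have h2 := mul_le_mul_of_nonneg_right hBn (h.W_nonneg k)
  linarith

/-- The weight `lam * (η + 1 / T)` is such that half of the contraction of `W` pays for both `η * A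
* W` and `D / T * W` in the descent. The reverse feedback, of `a` into `W`, is weighted by `(η + 1 /
T) * (n / T) ≤ 2 / T`, using `η * n ≤ 1` and `n / T ≤ 1`. -/
theorem potential_step (h : DescentRecursion c B D A l s R N n p T η a W g) (hs : 0 ≤ s)
    (hB : 0 ≤ B) (hD : 0 ≤ D) (hA : 0 ≤ A) {lam : ℝ} (hlam : 0 ≤ lam)
    (hlamc : lam * (c / 2) = A + D) (hηl : η * l ≤ 1) (hnT : (n : ℝ) / T ≤ 1)
    (hBn : B * (n / T) ≤ c / 2) {E : ℝ} (hE : E = D + 2 * lam * B) : ∀ k < T,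
      a (k + 1) + lam * (η + 1 / T) * W (k + 1) ≤
        (1 + E / T) * (a k + lam * (η + 1 / T) * W k) +
          (E / T + (E / T + η * A) * smoothingTerm s n p k) - η / 2 * g k := by
  intro k hk
  have hT := h.T_pos
  have hη := h.η_pos
  have hW := h.W_nonneg k
  have ha := h.a_nonneg k
  have hb := smoothingTerm_nonneg hs n p k
  have h1 := h.a_step hηl k hk
  have hWs := h.W_step_of_small_ratio hBn k hk
  set b := smoothingTerm s n p k
  set r := η + 1 / (T : ℝ) with hr
  have hr0 : 0 < r := by positivity
  have h2 := mul_le_mul_of_nonneg_left hWs (show 0 ≤ lam * r by positivity)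
  have h3 : lam * r * (B * (n / T) * (1 + a k + b)) ≤ 2 * lam * B / T * (1 + a k + b) := by
    have h4 : r * (n / T) ≤ 2 / T := by
      rw [hr, add_mul]
      have h5 : η * (n / T) ≤ 1 / T := by
        rw [← mul_div_assoc]
        gcongr
        exact h.η_mul_n_le
      have h6 : 1 / (T : ℝ) * (n / T) ≤ 1 / T * 1 := by gcongr
      calc _ ≤ 1 / (T : ℝ) + 1 / T * 1 := add_le_add h5 h6
        _ = _ := by ring
    calc _ = lam * B * (r * (n / T)) * (1 + a k + b) := by ring
      _ ≤ lam * B * (2 / T) * (1 + a k + b) := by gcongr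
      _ = _ := by ring
  have h8 : η * A * W k + D / T * W k ≤ lam * r * (c / 2) * W k := by
    have h9 : lam * r * (c / 2) = (A + D) * r := by rw [← hlamc]; ring
    have h10 : 0 ≤ (η * D + 1 / T * A) * W k := by positivity
    have h11 : D / T * W k = D * (1 / T) * W k := by ring
    rw [h9, hr, h11]
    linarith
  have hE0 : 0 ≤ E := by rw [hE]; positivity
  have h12 : E / T * a k ≤ E / T * (a k + lam * r * W k) := by
    refine mul_le_mul_of_nonneg_left ?_ (by positivity)
    have : 0 ≤ lam * r * W k := by positivity
    linarith
  have h13 : E / T = D / T + 2 * lam * B / T := by rw [hE, add_div]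
  have h14 : E / T * (1 + a k + b) = D / T * (1 + a k + b) + 2 * lam * B / T * (1 + a k + b) := by
    rw [h13]
    ring
  linarith

theorem sum_noise_le (h : DescentRecursion c B D A l s R N n p T η a W g) (hs : 0 ≤ s)
    (hA : 0 ≤ A) {E : ℝ} (hE : 0 ≤ E) :
    ∑ k ∈ Finset.range T, (E / T + (E / T + η * A) * smoothingTerm s n p k) ≤
      E + (E * (2 * s * √N) + A * (2 * s)) := by
  have hT := h.T_pos
  rw [Finset.sum_add_distrib, ← Finset.mul_sum, Finset.sum_const, Finset.card_range,
    nsmul_eq_mul, add_mul, mul_div_cancel₀ _ hT.ne']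
  have h1 := mul_le_mul_of_nonneg_left (h.sum_smoothing_le hs) (show 0 ≤ E / T by positivity)
  have h2 := mul_le_mul_of_nonneg_left (h.η_mul_sum_smoothing_le hs) hA
  have h3 : E / T * (2 * s * √N * T) = E * (2 * s * √N) := by field_simp
  linarith

theorem sum_W_le (h : DescentRecursion c B D A l s R N n p T η a W g) (hc : 0 < c) (hs : 0 ≤ s)
    (hB : 0 ≤ B) (hR : 0 ≤ R) (hBn : B * (n / T) ≤ c / 2) {M : ℝ} (haM : ∀ m ≤ T, a m ≤ M) :
    ∑ k ∈ Finset.range T, W k ≤ 2 / c * (R + B * (1 + M) + B * (2 * s * √N)) * n := by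
  have hT := h.T_pos
  have hn := h.n_pos
  have hn1 : (1 : ℝ) ≤ n := by exact_mod_cast h.one_le_n
  have h1 : ∑ k ∈ Finset.range T, c / 2 * W k ≤ R + B * (1 + M) * n + B * (2 * s * √N) * n := by
    have h2 : ∀ k ∈ Finset.range T, c / 2 * W k ≤
        (W k - W (k + 1)) + B * (n / T) * (1 + M) + B * (n / T) * smoothingTerm s n p k :=
        fun k hk => by
      have hk' := Finset.mem_range.1 hk
      have h3 := h.W_step_of_small_ratio hBn k hk'
      have h4 := mul_le_mul_of_nonneg_left (haM k hk'.le)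
        (show 0 ≤ B * ((n : ℝ) / T) by positivity)
      linarith
    refine (Finset.sum_le_sum h2).trans ?_
    rw [Finset.sum_add_distrib, Finset.sum_add_distrib, Finset.sum_range_sub', Finset.sum_const,
      Finset.card_range, nsmul_eq_mul, ← Finset.mul_sum]
    have h5 : (T : ℝ) * (B * (n / T) * (1 + M)) = B * (1 + M) * n := by field_simp
    have h6 := mul_le_mul_of_nonneg_left (h.sum_smoothing_le hs)
      (show 0 ≤ B * ((n : ℝ) / T) by positivity)
    have h7 : B * ((n : ℝ) / T) * (2 * s * √N * T) = B * (2 * s * √N) * n := by field_simp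
    rw [h5]
    linarith [h.W_nonneg T, h.W_zero]
  rw [← Finset.mul_sum] at h1
  have h9 : R ≤ R * n := le_mul_of_one_le_right hR hn1
  have h10 : c / 2 * (2 / c * (R + B * (1 + M) + B * (2 * s * √N)) * n) =
      (R + B * (1 + M) + B * (2 * s * √N)) * n := by
    field_simp
  have h11 : c / 2 * ∑ k ∈ Finset.range T, W k ≤
      c / 2 * (2 / c * (R + B * (1 + M) + B * (2 * s * √N)) * n) := by
    rw [h10]
    linarith
  exact le_of_mul_le_mul_left h11 (by positivity)

end DescentRecursion

/-- Since `(1 + E / T) ^ T ≤ exp E`, the potential stays bounded up to time `T`; inserting this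
bound and telescoping controls the sum of `g`. -/
theorem perturbed_descent_bound {Φ s' g : ℕ → ℝ} {E S Φ₀ κ : ℝ} {T : ℕ} (hT : 0 < T) (hE : 0 ≤ E)
    (hs : ∀ k, 0 ≤ s' k) (hg : ∀ k, 0 ≤ κ * g k) (hΦ : ∀ k, 0 ≤ Φ k) (hΦ0 : Φ 0 ≤ Φ₀)
    (hS : ∑ k ∈ Finset.range T, s' k ≤ S)
    (h : ∀ k < T, Φ (k + 1) ≤ (1 + E / T) * Φ k + s' k - κ * g k) :
    (∀ m ≤ T, Φ m ≤ Real.exp E * (Φ₀ + S)) ∧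
      κ * ∑ k ∈ Finset.range T, g k ≤ Φ₀ + E * (Real.exp E * (Φ₀ + S)) + S := by
  have hT' : (0 : ℝ) < T := by exact_mod_cast hT
  have hET : 0 ≤ E / T := by positivity
  have hM : ∀ m ≤ T, Φ m ≤ Real.exp E * (Φ₀ + S) := by
    intro m hm
    have h1 := le_pow_mul_add_sum hET hs (fun k hk => (h k hk).trans (sub_le_self _ (hg k))) hm
    have h2 : ∑ k ∈ Finset.range m, s' k ≤ S :=
      (Finset.sum_le_sum_of_subset_of_nonneg (Finset.range_mono hm) fun k _ _ => hs k).trans hS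
    have h3 : (1 + E / T) ^ m ≤ Real.exp E := by
      calc (1 + E / T) ^ m ≤ (1 + E / T) ^ T := pow_le_pow_right₀ (by linarith) hm
        _ ≤ (Real.exp (E / T)) ^ T := by
            refine pow_le_pow_left₀ (by linarith) ?_ T
            have := Real.add_one_le_exp (E / T)
            linarith
        _ = Real.exp E := by rw [← Real.exp_nat_mul, mul_div_cancel₀ _ hT'.ne']
    have h4 : 0 ≤ Φ 0 + ∑ k ∈ Finset.range m, s' k :=
      add_nonneg (hΦ 0) (Finset.sum_nonneg fun k _ => hs k)
    calc Φ m ≤ _ := h1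
      _ ≤ Real.exp E * (Φ 0 + ∑ k ∈ Finset.range m, s' k) := mul_le_mul_of_nonneg_right h3 h4
      _ ≤ _ := mul_le_mul_of_nonneg_left (add_le_add hΦ0 h2) (Real.exp_pos E).le
  refine ⟨hM, ?_⟩
  set M := Real.exp E * (Φ₀ + S)
  have h2 : ∀ k ∈ Finset.range T, κ * g k ≤ (Φ k - Φ (k + 1)) + E / T * M + s' k := fun k hk => by
    have hk' := Finset.mem_range.1 hk
    have h3 := h k hk'
    have h4 := mul_le_mul_of_nonneg_left (hM k hk'.le) hET
    linarith
  rw [Finset.mul_sum]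
  refine (Finset.sum_le_sum h2).trans ?_
  rw [Finset.sum_add_distrib, Finset.sum_add_distrib, Finset.sum_range_sub', Finset.sum_const,
    Finset.card_range, nsmul_eq_mul]
  have h5 : (T : ℝ) * (E / T * M) = E * M := by field_simp
  rw [h5]
  linarith [hΦ T]

theorem exists_bound_of_small_ratio (hc : 0 < c) (hB : 0 ≤ B) (hD : 0 ≤ D) (hA : 0 ≤ A)
    (hs : 0 ≤ s) (hR : 0 ≤ R) :
    ∃ C : ℝ, 0 ≤ C ∧ ∀ (n p T : ℕ) (η : ℝ) (a W g : ℕ → ℝ),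
      DescentRecursion c B D A l s R N n p T η a W g → η * l ≤ 1 → (n : ℝ) / T ≤ 1 →
      B * (n / T) ≤ c / 2 →
      ∑ k ∈ Finset.range T, g k ≤ C * (√p * √T) ∧ a T ≤ C ∧
        ∑ k ∈ Finset.range T, W k ≤ C * n := by
  obtain ⟨lam, hlam0, hlamc⟩ : ∃ lam : ℝ, 0 ≤ lam ∧ lam * (c / 2) = A + D :=
    ⟨2 * (A + D) / c, by positivity, by field_simp⟩
  obtain ⟨E, hE⟩ : ∃ E, E = D + 2 * lam * B := ⟨_, rfl⟩
  have hE0 : 0 ≤ E := by rw [hE]; positivity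
  obtain ⟨S, hS⟩ : ∃ S, S = E + (E * (2 * s * √N) + A * (2 * s)) := ⟨_, rfl⟩
  have hS0 : 0 ≤ S := by rw [hS]; positivity
  obtain ⟨Φ₀, hΦ₀⟩ : ∃ Φ₀, Φ₀ = R + lam * 2 * R := ⟨_, rfl⟩
  have hΦ₀0 : 0 ≤ Φ₀ := by rw [hΦ₀]; positivity
  obtain ⟨M, hM⟩ : ∃ M, M = Real.exp E * (Φ₀ + S) := ⟨_, rfl⟩
  have hM0 : 0 ≤ M := by rw [hM]; positivity
  obtain ⟨C₁, hC₁⟩ : ∃ C₁, C₁ = 2 * (Φ₀ + E * M + S) := ⟨_, rfl⟩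
  obtain ⟨C₃, hC₃⟩ : ∃ C₃, C₃ = 2 / c * (R + B * (1 + M) + B * (2 * s * √N)) := ⟨_, rfl⟩
  have hC₁0 : 0 ≤ C₁ := by rw [hC₁]; positivity
  have hC₃0 : 0 ≤ C₃ := by rw [hC₃]; positivity
  refine ⟨C₁ + M + C₃, by positivity, ?_⟩
  intro n p T η a W g h hηl hnT hBn
  have hT := h.T_pos
  have hη := h.η_pos
  have hWr : ∀ k, 0 ≤ lam * (η + 1 / T) * W k := fun k => by
    have := h.W_nonneg k
    positivity
  have hΦ0 : a 0 + lam * (η + 1 / T) * W 0 ≤ Φ₀ := by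
    have hn1 : (1 : ℝ) ≤ n := by exact_mod_cast h.one_le_n
    have hT1 : (1 : ℝ) ≤ T := by exact_mod_cast h.one_le_T
    have hη1 : η ≤ 1 := (le_mul_of_one_le_right hη.le hn1).trans h.η_mul_n_le
    have hT1' : 1 / (T : ℝ) ≤ 1 := by rw [div_le_one hT]; exact hT1
    have h2 : lam * (η + 1 / T) * W 0 ≤ lam * 2 * R := by
      have := h.W_zero
      have := h.W_nonneg 0
      gcongr
      linarith
    rw [hΦ₀]
    linarith [h.a_zero]
  obtain ⟨hΦM, hG⟩ := perturbed_descent_bound (Φ := fun k => a k + lam * (η + 1 / T) * W k)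
    (s' := fun k => E / T + (E / T + η * A) * smoothingTerm s n p k) (g := g) (κ := η / 2)
    (Nat.lt_of_lt_of_le Nat.zero_lt_one h.one_le_T) hE0
    (fun k => by have := smoothingTerm_nonneg hs n p k; positivity)
    (fun k => mul_nonneg (half_pos hη).le (h.g_nonneg k))
    (fun k => add_nonneg (h.a_nonneg k) (hWr k)) hΦ0
    (hS ▸ h.sum_noise_le hs hA hE0)
    (h.potential_step hs hB hD hA hlam0 hlamc hηl hnT hBn hE)
  have haM : ∀ m ≤ T, a m ≤ M := fun m hm => by
    have h1 := hΦM m hm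
    have h2 := hWr m
    rw [hM]
    linarith
  refine ⟨?_, ?_, ?_⟩
  · have h6 : ∑ k ∈ Finset.range T, g k ≤ C₁ / η := by
      rw [le_div_iff₀ hη, hC₁, hM]
      linarith
    -- In fact `1 / η = √p * √T / √n`; the factor `1 / √n` is given up.
    have h7 : 1 / η ≤ √p * √T := by
      rw [div_le_iff₀ hη, mul_comm, h.η_eq]
      exact h.one_le_sqrt_n
    calc _ ≤ C₁ * (1 / η) := by rwa [mul_one_div]
      _ ≤ C₁ * (√p * √T) := by gcongr
      _ ≤ _ := by
        gcongr
        linarith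
  · linarith [haM T le_rfl]
  · refine (h.sum_W_le hc hs hB hR hBn haM).trans ?_
    rw [← hC₃]
    have := h.n_pos
    gcongr
    linarith

/-- From `ε T < n` and `n³ < p T ≤ N T²` one gets `T ≤ N / ε³`. With boundedly many iterations, a
growth factor `K` per step is harmless. -/
theorem exists_bound_of_large_ratio (hc : 0 < c) (hB : 0 ≤ B) (hD : 0 ≤ D) (hA : 0 ≤ A)
    (hl : 0 ≤ l) (hs : 0 ≤ s) (hR : 0 ≤ R) (hN : 0 ≤ N) {ε : ℝ} (hε : 0 < ε) :
    ∃ C : ℝ, 0 ≤ C ∧ ∀ (n p T : ℕ) (η : ℝ) (a W g : ℕ → ℝ),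
      DescentRecursion c B D A l s R N n p T η a W g → ε < (n : ℝ) / T →
      ∑ k ∈ Finset.range T, g k ≤ C * (√p * √T) ∧ a T ≤ C ∧
        ∑ k ∈ Finset.range T, W k ≤ C * n := by
  set T₀ := N / ε ^ 3 with hT₀
  have hT₀0 : 0 ≤ T₀ := by positivity
  set β := s * √(N * T₀) with hβ
  have hβ0 : 0 ≤ β := by positivity
  set K := 1 + A + (B + D) * (N + 1) with hK
  have hK1 : 1 ≤ K := by
    have : 0 ≤ (B + D) * (N + 1) := by positivity
    linarith
  set M := K ^ ⌈T₀⌉₊ * (R + R + 1 + β) with hM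
  have hM0 : 0 ≤ M := by positivity
  refine ⟨2 * l * T₀ * M + M + T₀ * M, by positivity, ?_⟩
  intro n p T η a W g h hnT
  have hn := h.n_pos
  have hp := h.p_pos
  have hT := h.T_pos
  have hn1 : (1 : ℝ) ≤ n := by exact_mod_cast h.one_le_n
  have hp1 : (1 : ℝ) ≤ p := by exact_mod_cast h.one_le_p
  have hT1 : (1 : ℝ) ≤ T := by exact_mod_cast h.one_le_T
  have hn3 : (n : ℝ) ^ 3 ≤ N * T * T := h.cube_lt.le.trans (by gcongr; exact h.p_le)
  have hTT₀ : (T : ℝ) ≤ T₀ := by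
    have h1 : ε * T ≤ n := ((lt_div_iff₀ hT).1 hnT).le
    have h2 : (ε * T) ^ 3 ≤ N * T * T := (by gcongr : (ε * T) ^ 3 ≤ (n : ℝ) ^ 3).trans hn3
    rw [hT₀, le_div_iff₀ (by positivity)]
    have h3 : T * ε ^ 3 * (T * T : ℝ) ≤ N * (T * T) := by linarith
    exact le_of_mul_le_mul_right h3 (by positivity)
  -- Otherwise `(N + 1)³ T ≤ N`, impossible for `T ≥ 1`.
  have hq : (n : ℝ) / T ≤ N + 1 := by
    by_contra hcon
    rw [not_le, lt_div_iff₀ hT] at hcon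
    have h1 : ((N + 1) * T) ^ 3 ≤ N * T * T :=
      (by gcongr : ((N + 1) * T) ^ 3 ≤ (n : ℝ) ^ 3).trans hn3
    have h2 : ((N + 1) * T : ℝ) ^ 3 = (N + 1) ^ 3 * T * (T * T) := by ring
    have h3 : N * T * T = N * (T * T) := by ring
    rw [h2, h3] at h1
    have h4 : (N + 1) ^ 3 * T ≤ N := le_of_mul_le_mul_right h1 (by positivity)
    have h5 : N + 1 ≤ (N + 1) ^ 3 := le_self_pow₀ (by linarith) (by norm_num)
    nlinarith
  have hb : ∀ k, smoothingTerm s n p k ≤ β := by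
    intro k
    unfold smoothingTerm
    rw [hβ]
    gcongr
    have h1 : 1 ≤ √(n : ℝ) := h.one_le_sqrt_n
    have h2 : 1 ≤ √((k : ℝ) + 1) := by
      rw [Real.one_le_sqrt]
      linarith [(Nat.cast_nonneg k : (0 : ℝ) ≤ k)]
    refine (div_le_self (by positivity) (one_le_mul_of_one_le_of_one_le h1 h2)).trans ?_
    exact Real.sqrt_le_sqrt (h.p_le.trans (by gcongr))
  -- Including the constants `1 + β` makes the growth inequality homogeneous.
  set U := fun k => a k + W k + 1 + β with hU
  have hstep : ∀ k < T, U (k + 1) ≤ K * U k := by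
    intro k hk
    have h1 := h.W_step k hk
    have h2 := h.a_growth k hk
    have ha := h.a_nonneg k
    have hW := h.W_nonneg k
    have h3 : 1 + a k + W k + smoothingTerm s n p k ≤ U k := by
      simp only [hU]
      linarith [hb k]
    have h0 : 0 ≤ U k := by
      simp only [hU]
      linarith
    have h4 : B * (n / T) * (1 + a k + W k + smoothingTerm s n p k) ≤ B * (N + 1) * U k := by
      have := smoothingTerm_nonneg hs n p k
      gcongr
    have h5 : D * (n / T) * (1 + a k + W k + smoothingTerm s n p k) ≤ D * (N + 1) * U k := by
      have := smoothingTerm_nonneg hs n p k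
      gcongr
    have h6 : 0 ≤ A * (W k + 1 + β) := by positivity
    have h7 : 0 ≤ c * W k := by positivity
    have h8 : K * U k = (1 + A) * U k + (B * (N + 1) * U k + D * (N + 1) * U k) := by
      rw [hK]
      ring
    have h9 : (1 + A) * U k = (1 + A) * a k + A * (W k + 1 + β) + (W k + 1 + β) := by
      simp only [hU]
      ring
    rw [h8, h9]
    have h10 : U (k + 1) = a (k + 1) + W (k + 1) + 1 + β := rfl
    rw [h10]
    linarith
  have hUM : ∀ m ≤ T, U m ≤ M := by
    have h1 : ∀ m ≤ T, U m ≤ K ^ m * U 0 := by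
      intro m
      induction m with
      | zero => intro _; simp
      | succ m ih =>
        intro hm
        calc U (m + 1) ≤ K * U m := hstep m (by omega)
          _ ≤ K * (K ^ m * U 0) := by
            gcongr
            exact ih (by omega)
          _ = _ := by ring
    intro m hm
    have h2 : m ≤ ⌈T₀⌉₊ := by
      have : (m : ℝ) ≤ ⌈T₀⌉₊ :=
        ((Nat.cast_le.2 hm).trans hTT₀).trans (Nat.le_ceil T₀)
      exact_mod_cast this
    have h3 : U 0 ≤ R + R + 1 + β := by
      simp only [hU]
      linarith [h.a_zero, h.W_zero]
    have h4 : 0 ≤ U 0 := by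
      simp only [hU]
      linarith [h.a_nonneg 0, h.W_nonneg 0]
    calc U m ≤ K ^ m * U 0 := h1 m hm
      _ ≤ K ^ ⌈T₀⌉₊ * (R + R + 1 + β) := by gcongr
  have haM : ∀ m ≤ T, a m ≤ M := fun m hm => by
    have h1 := hUM m hm
    simp only [hU] at h1
    linarith [h.W_nonneg m]
  have hWM : ∀ m ≤ T, W m ≤ M := fun m hm => by
    have h1 := hUM m hm
    simp only [hU] at h1
    linarith [h.a_nonneg m]
  have hlM : 0 ≤ 2 * l * T₀ * M := by positivity
  have hTM : 0 ≤ T₀ * M := by positivity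
  refine ⟨?_, ?_, ?_⟩
  · have h1 : ∑ k ∈ Finset.range T, g k ≤ ∑ _k ∈ Finset.range T, 2 * l * M := by
      refine Finset.sum_le_sum fun k hk => (h.g_le k).trans ?_
      gcongr
      exact haM k (Finset.mem_range.1 hk).le
    rw [Finset.sum_const, Finset.card_range, nsmul_eq_mul] at h1
    have h2 : (T : ℝ) * (2 * l * M) ≤ T₀ * (2 * l * M) := by gcongr
    have h3 : 1 ≤ √(p : ℝ) * √T :=
      one_le_mul_of_one_le_of_one_le (Real.one_le_sqrt.2 hp1) (Real.one_le_sqrt.2 hT1)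
    calc _ ≤ 2 * l * T₀ * M + M + T₀ * M := by linarith
      _ ≤ _ := le_mul_of_one_le_right (by positivity) h3
  · linarith [haM T le_rfl]
  · have h1 : ∑ k ∈ Finset.range T, W k ≤ ∑ _k ∈ Finset.range T, M :=
      Finset.sum_le_sum fun k hk => hWM k (Finset.mem_range.1 hk).le
    rw [Finset.sum_const, Finset.card_range, nsmul_eq_mul] at h1
    have h2 : (T : ℝ) * M ≤ T₀ * M := by gcongr
    calc _ ≤ 2 * l * T₀ * M + M + T₀ * M := by linarith
      _ ≤ _ := le_mul_of_one_le_right (by positivity) hn1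

theorem exists_descentRecursion_bound (hc : 0 < c) (hB : 0 ≤ B) (hD : 0 ≤ D) (hA : 0 ≤ A)
    (hl : 0 < l) (hs : 0 ≤ s) (hR : 0 ≤ R) (hN : 0 ≤ N) :
    ∃ C : ℝ, 0 ≤ C ∧ ∀ (n p T : ℕ) (η : ℝ) (a W g : ℕ → ℝ),
      DescentRecursion c B D A l s R N n p T η a W g →
      ∑ k ∈ Finset.range T, g k ≤ C * (√p * √T) ∧ a T ≤ C ∧
        ∑ k ∈ Finset.range T, W k ≤ C * n := by
  -- The three entries give `n / T ≤ 1`, `η * l ≤ 1` (as `η² ≤ n / T`) and `B * (n / T) ≤ c / 2`; `B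
  -- + 1` avoids a division by zero.
  set ε := min 1 (min (1 / l ^ 2) (c / (2 * (B + 1)))) with hε
  have hε0 : 0 < ε := by positivity
  obtain ⟨C₁, hC₁, h₁⟩ := exists_bound_of_small_ratio (l := l) (N := N) hc hB hD hA hs hR
  obtain ⟨C₂, hC₂, h₂⟩ := exists_bound_of_large_ratio hc hB hD hA hl.le hs hR hN hε0
  refine ⟨C₁ + C₂, by positivity, ?_⟩
  intro n p T η a W g h
  rcases le_or_gt ((n : ℝ) / T) ε with hle | hlt
  · have hp1 : (1 : ℝ) ≤ p := by exact_mod_cast h.one_le_p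
    have hn0 := h.n_pos
    have hT0 := h.T_pos
    have hηl : η * l ≤ 1 := by
      have h3 : η ^ 2 ≤ 1 / l ^ 2 := by
        rw [h.η_sq, mul_comm, ← div_div]
        exact (div_le_self (by positivity) hp1).trans
          (hle.trans ((min_le_right _ _).trans (min_le_left _ _)))
      have h4 : (η * l) ^ 2 ≤ 1 := by
        rw [mul_pow]
        rwa [le_div_iff₀ (by positivity)] at h3
      nlinarith [mul_pos h.η_pos hl]
    have hBn : B * (n / T) ≤ c / 2 := by
      calc B * ((n : ℝ) / T) ≤ (B + 1) * (c / (2 * (B + 1))) := by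
            have := hle.trans ((min_le_right _ _).trans (min_le_right _ _))
            gcongr
            linarith
        _ = c / 2 := by field_simp
    obtain ⟨hg, ha, hW⟩ := h₁ n p T η a W g h hηl (hle.trans (min_le_left _ _)) hBn
    refine ⟨hg.trans ?_, by linarith, hW.trans ?_⟩
    · gcongr
      linarith
    · gcongr
      linarith
  · obtain ⟨hg, ha, hW⟩ := h₂ n p T η a W g h hlt
    refine ⟨hg.trans ?_, by linarith, hW.trans ?_⟩
    · gcongr
      linarith
    · gcongr
      linarith

end Recursion

/-! ### Deviations from the average. -/

section Deviation

variable {n p : ℕ}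

/-- The stacked vector of the deviations from the average. -/
noncomputable def deviation (x : Fin n → EuclideanSpace ℝ (Fin p)) : BlockVec n p :=
  WithLp.toLp 2 fun i => x i - avg x

theorem sum_eq_smul_avg (hn : 0 < n) (x : Fin n → EuclideanSpace ℝ (Fin p)) :
    ∑ i, x i = (n : ℝ) • avg x := by
  have hn' : (n : ℝ) ≠ 0 := by exact_mod_cast hn.ne'
  rw [avg, smul_smul, mul_one_div_cancel hn', one_smul]

theorem sum_deviation (hn : 0 < n) (x : Fin n → EuclideanSpace ℝ (Fin p)) :
    ∑ i, deviation x i = 0 := by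
  change ∑ i, (x i - avg x) = 0
  rw [Finset.sum_sub_distrib, sum_eq_smul_avg hn x, Finset.sum_const, Finset.card_univ,
    Fintype.card_fin, ← Nat.cast_smul_eq_nsmul ℝ, sub_self]

theorem normSq_deviation (hn : 0 < n) (x : Fin n → EuclideanSpace ℝ (Fin p)) :
    ‖deviation x‖ ^ 2 = n * consensusError x := by
  have hn' : (n : ℝ) ≠ 0 := by exact_mod_cast hn.ne'
  rw [PiLp.norm_sq_eq_of_L2, consensusError, ← mul_assoc, mul_one_div_cancel hn', one_mul]
  rfl

theorem normSq_deviation_le (hn : 0 < n) (x : Fin n → EuclideanSpace ℝ (Fin p)) :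
    ‖deviation x‖ ^ 2 ≤ ∑ i, ‖x i‖ ^ 2 := by
  have h1 : ∀ i, ‖x i - avg x‖ ^ 2 =
      ‖x i‖ ^ 2 - 2 * inner ℝ (x i) (avg x) + ‖avg x‖ ^ 2 := fun i => norm_sub_sq_real _ _
  have h2 : ∑ i, inner ℝ (x i) (avg x) = n * ‖avg x‖ ^ 2 := by
    rw [← sum_inner, sum_eq_smul_avg hn, inner_smul_left, real_inner_self_eq_norm_sq, conj_trivial]
  rw [PiLp.norm_sq_eq_of_L2]
  change ∑ i, ‖x i - avg x‖ ^ 2 ≤ _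
  simp only [h1]
  rw [Finset.sum_add_distrib, Finset.sum_sub_distrib, ← Finset.mul_sum, h2, Finset.sum_const,
    Finset.card_univ, Fintype.card_fin, nsmul_eq_mul]
  have : 0 ≤ (n : ℝ) * ‖avg x‖ ^ 2 := by positivity
  linarith

theorem deviation_eq (x : Fin n → EuclideanSpace ℝ (Fin p)) :
    deviation x = WithLp.toLp 2 x - WithLp.toLp 2 fun _ => avg x := rfl

theorem blockMap_deviation (A : Matrix (Fin n) (Fin n) ℝ)
    (x : Fin n → EuclideanSpace ℝ (Fin p)) :
    blockMap (weightedLaplacian A) (deviation x) =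
      blockMap (weightedLaplacian A) (WithLp.toLp 2 x) := by
  rw [deviation_eq, map_sub, blockMap_const, sub_zero]

end Deviation

/-! ### The iteration in terms of average, deviation and dual potential. -/

section Dynamics

variable {n p : ℕ} {G : SimpleGraph (Fin n)} {A : Matrix (Fin n) (Fin n) ℝ} {α β η κ₁ h : ℝ}
  {x v g : Fin n → EuclideanSpace ℝ (Fin p)} {u : BlockVec n p}

theorem isPSDWith_blockMap (hA : IsWeightedAdjMatrix G A) :
    IsPSDWith (blockMap (p := p) (weightedLaplacian A)) (specRad (weightedLaplacian A)) where
  symm := inner_blockMap_comm hA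
  nonneg x := by
    rw [inner_blockMap_eq_sum]
    exact Finset.sum_nonneg fun k _ => dotProduct_weightedLaplacian_nonneg hA _
  le := inner_blockMap_le hA
  normSq_le := normSq_blockMap_le hA

theorem avg_primal_step (hA : IsWeightedAdjMatrix G A) (hv : ∑ i, v i = 0) :
    avg (fun i => x i - η • (α • (∑ j, weightedLaplacian A i j • x j) + β • v i + g i)) =
      avg x - η • avg g := by
  have h1 : ∑ i, ∑ j, weightedLaplacian A i j • x j = 0 := sum_blockMap hA (WithLp.toLp 2 x)
  simp only [avg, Finset.sum_sub_distrib, ← Finset.smul_sum, Finset.sum_add_distrib, h1, hv,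
    smul_zero, zero_add, smul_sub]
  rw [smul_comm η]

/-- The Laplacian kills constant vectors and `v` is the image of `u`, so the consensus and dual
terms combine into one application of the Laplacian, with step `h`. -/
theorem deviation_primal_step (hA : IsWeightedAdjMatrix G A) (hv : ∑ i, v i = 0)
    (hu : blockMap (weightedLaplacian A) u = WithLp.toLp 2 v) (hα : η * α = h * κ₁)
    (hβ : η * β = h) :
    deviation (fun i => x i - η • (α • (∑ j, weightedLaplacian A i j • x j) + β • v i + g i)) =
      deviation x - h • blockMap (weightedLaplacian A) (κ₁ • deviation x + u) -
        η • deviation g := by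
  rw [map_add, map_smul, blockMap_deviation, hu, smul_add, smul_smul, ← hα, ← hβ]
  refine PiLp.ext fun i => ?_
  simp only [deviation, PiLp.sub_apply, PiLp.add_apply, PiLp.smul_apply, blockMap_apply,
    avg_primal_step hA hv]
  module

theorem dual_step (hu : blockMap (weightedLaplacian A) u = WithLp.toLp 2 v) (hβ : η * β = h) :
    blockMap (weightedLaplacian A) (u + h • deviation x) =
      WithLp.toLp 2 fun i => v i + (η * β) • ∑ j, weightedLaplacian A i j • x j := by
  rw [map_add, map_smul, blockMap_deviation, hu, hβ]
  rfl

variable {gr : ℕ → (Fin n → EuclideanSpace ℝ (Fin p)) → Fin n → EuclideanSpace ℝ (Fin p)}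
  {x₀ v₀ : Fin n → EuclideanSpace ℝ (Fin p)} {u₀ : BlockVec n p}

/-- The potential of the dual variables along a primal trajectory. -/
noncomputable def dualPotential (h : ℝ) (u₀ : BlockVec n p)
    (x : ℕ → Fin n → EuclideanSpace ℝ (Fin p)) (k : ℕ) : BlockVec n p :=
  u₀ + h • ∑ l ∈ Finset.range k, deviation (x l)

theorem dualPotential_succ (h : ℝ) (u₀ : BlockVec n p)
    (x : ℕ → Fin n → EuclideanSpace ℝ (Fin p)) (k : ℕ) :
    dualPotential h u₀ x (k + 1) = dualPotential h u₀ x k + h • deviation (x k) := by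
  rw [dualPotential, Finset.sum_range_succ, smul_add, ← add_assoc]
  rfl

theorem sum_dualPotential (hn : 0 < n) (hu₀ : ∑ i, u₀ i = 0)
    (x : ℕ → Fin n → EuclideanSpace ℝ (Fin p)) (k : ℕ) : ∑ i, dualPotential h u₀ x k i = 0 := by
  induction k with
  | zero => simpa [dualPotential] using hu₀
  | succ k ih =>
    simp only [dualPotential_succ, PiLp.add_apply, PiLp.smul_apply, Finset.sum_add_distrib, ih,
      ← Finset.smul_sum, sum_deviation hn, smul_zero, add_zero]

/-- The dual recursion is the image of the potential's recursion under the Laplacian. As the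
potential is an explicit sum of past deviations, its integrability follows from that of the
iterates. -/
theorem blockMap_dualPotential (hu₀ : blockMap (weightedLaplacian A) u₀ = WithLp.toLp 2 v₀)
    (hβ : η * β = h) (k : ℕ) :
    blockMap (weightedLaplacian A)
        (dualPotential h u₀ (fun k => (zodiac (weightedLaplacian A) α β η gr x₀ v₀ k).1) k) =
      WithLp.toLp 2 (zodiac (weightedLaplacian A) α β η gr x₀ v₀ k).2 := by
  induction k with
  | zero => simpa [dualPotential, zodiac] using hu₀
  | succ k ih =>
    rw [dualPotential_succ]
    exact dual_step ih hβ

theorem sum_zodiac_dual (hA : IsWeightedAdjMatrix G A) (hv₀ : ∑ i, v₀ i = 0) (k : ℕ) :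
    ∑ i, (zodiac (weightedLaplacian A) α β η gr x₀ v₀ k).2 i = 0 := by
  induction k with
  | zero => exact hv₀
  | succ k ih =>
    have h1 : ∑ i, ∑ j, weightedLaplacian A i j •
        (zodiac (weightedLaplacian A) α β η gr x₀ v₀ k).1 j = 0 :=
      sum_blockMap hA (WithLp.toLp 2 (zodiac (weightedLaplacian A) α β η gr x₀ v₀ k).1)
    simp only [zodiac, Finset.sum_add_distrib, ih, ← Finset.smul_sum, h1, smul_zero, add_zero]

theorem avg_zodiac_succ (hA : IsWeightedAdjMatrix G A) (hv₀ : ∑ i, v₀ i = 0) (k : ℕ) :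
    avg (zodiac (weightedLaplacian A) α β η gr x₀ v₀ (k + 1)).1 =
      avg (zodiac (weightedLaplacian A) α β η gr x₀ v₀ k).1 -
        η • avg (gr k (zodiac (weightedLaplacian A) α β η gr x₀ v₀ k).1) :=
  avg_primal_step hA (sum_zodiac_dual hA hv₀ k)

theorem deviation_zodiac_succ (hA : IsWeightedAdjMatrix G A) (hv₀ : ∑ i, v₀ i = 0)
    (hu₀ : blockMap (weightedLaplacian A) u₀ = WithLp.toLp 2 v₀)
    (hα : η * α = h * κ₁) (hβ : η * β = h) (k : ℕ) :
    deviation (zodiac (weightedLaplacian A) α β η gr x₀ v₀ (k + 1)).1 =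
      deviation (zodiac (weightedLaplacian A) α β η gr x₀ v₀ k).1 -
        h • blockMap (weightedLaplacian A)
          (κ₁ • deviation (zodiac (weightedLaplacian A) α β η gr x₀ v₀ k).1 +
            dualPotential h u₀ (fun k => (zodiac (weightedLaplacian A) α β η gr x₀ v₀ k).1) k) -
        η • deviation (gr k (zodiac (weightedLaplacian A) α β η gr x₀ v₀ k).1) :=
  deviation_primal_step hA (sum_zodiac_dual hA hv₀ k) (blockMap_dualPotential hu₀ hβ k) hα hβ

end Dynamics

/-! ### Measurability of the iterates. -/

section Measurability

variable {n p : ℕ} {Ξ Ω : Type*} [MeasurableSpace Ξ]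
  {F : Fin n → EuclideanSpace ℝ (Fin p) → Ξ → ℝ}

/-- The gradient estimates of the algorithm at a given outcome. -/
noncomputable def zodiacGrad (F : Fin n → EuclideanSpace ℝ (Fin p) → Ξ → ℝ) (o : DiffScheme)
    (nc : ℕ) (δ : Fin n → Fin p → ℕ → ℝ) (ξ : Fin n → ℕ → Ω → Ξ)
    (S : Fin n → ℕ → Ω → Finset (Fin p)) (ω : Ω) (k : ℕ)
    (x : Fin n → EuclideanSpace ℝ (Fin p)) (i : Fin n) : EuclideanSpace ℝ (Fin p) :=
  coordGradEst o nc (fun y => F i y (ξ i k ω)) (fun j => δ i j k) (S i k ω) (x i)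

/-- Measurability is asked of the draws before `k` only, and for an arbitrary σ-algebra on `Ω`, so
that the one generated by the past can be inserted. -/
theorem measurable_zodiac [MeasurableSpace Ω]
    (hF : ∀ i, Measurable fun q : EuclideanSpace ℝ (Fin p) × Ξ => F i q.1 q.2)
    (L : Matrix (Fin n) (Fin n) ℝ) (α β η : ℝ) (o : DiffScheme) (nc : ℕ)
    (δ : Fin n → Fin p → ℕ → ℝ) (ξ : Fin n → ℕ → Ω → Ξ)
    (S : Fin n → ℕ → Ω → Finset (Fin p)) (x₀ v₀ : Fin n → EuclideanSpace ℝ (Fin p)) (k : ℕ)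
    (hξS : ∀ i, ∀ l < k, Measurable (fun ω => (ξ i l ω, S i l ω))) :
    Measurable fun ω => zodiac L α β η (zodiacGrad F o nc δ ξ S ω) x₀ v₀ k := by
  induction k with
  | zero => exact measurable_const
  | succ k ih =>
    have h1 := ih fun i l hl => hξS i l (by omega)
    have hx : ∀ i, Measurable fun ω => (zodiac L α β η (zodiacGrad F o nc δ ξ S ω) x₀ v₀ k).1 i :=
      fun i => (measurable_pi_apply i).comp (measurable_fst.comp h1)
    have hv : ∀ i, Measurable fun ω => (zodiac L α β η (zodiacGrad F o nc δ ξ S ω) x₀ v₀ k).2 i :=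
      fun i => (measurable_pi_apply i).comp (measurable_snd.comp h1)
    have hLx : ∀ i, Measurable fun ω => ∑ j, L i j •
        (zodiac L α β η (zodiacGrad F o nc δ ξ S ω) x₀ v₀ k).1 j := fun i =>
      Finset.measurable_fun_sum _ fun j _ => (hx j).const_smul (L i j)
    have hg : ∀ i, Measurable fun ω => zodiacGrad F o nc δ ξ S ω k
        (zodiac L α β η (zodiacGrad F o nc δ ξ S ω) x₀ v₀ k).1 i := fun i =>
      measurable_coordGradEst (hF i) o nc (fun j => δ i j k) (hx i)
        (hξS i k (by omega)).fst (hξS i k (by omega)).snd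
    refine Measurable.prodMk (measurable_pi_lambda _ fun i => ?_)
      (measurable_pi_lambda _ fun i => ?_)
    · exact (hx i).sub
        (((((hLx i).const_smul α).add ((hv i).const_smul β)).add (hg i)).const_smul η)
    · exact (hv i).add ((hLx i).const_smul (η * β))

end Measurability

/-! ### Independence of the present draws from the past. -/

section Freshness

variable {n p : ℕ} {Ξ Ω : Type*} [MeasurableSpace Ξ] [MeasurableSpace Ω]
  {F : Fin n → EuclideanSpace ℝ (Fin p) → Ξ → ℝ} {μ : Fin n → Measure Ξ} {P : Measure Ω}
  {nc : ℕ} {ξ : Fin n → ℕ → Ω → Ξ} {S : Fin n → ℕ → Ω → Finset (Fin p)} {c ζ σ₂ : ℝ}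

theorem IsSampling.measurable_pair (hs : IsSampling P μ nc ξ S) (a : Fin n × ℕ) :
    Measurable fun ω => (ξ a.1 a.2 ω, S a.1 a.2 ω) :=
  (hs.measurable_sample a.1 a.2).prodMk (hs.measurable_coord a.1 a.2)

variable [IsProbabilityMeasure P]

theorem IsSampling.isFreshSample (hs : IsSampling P μ nc ξ S)
    (hF : ∀ i, Measurable fun q : EuclideanSpace ℝ (Fin p) × Ξ => F i q.1 q.2)
    (L : Matrix (Fin n) (Fin n) ℝ) (α β η : ℝ) (o : DiffScheme)
    (δ : Fin n → Fin p → ℕ → ℝ) (x₀ v₀ : Fin n → EuclideanSpace ℝ (Fin p)) (k : ℕ)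
    (hx : ∀ i, MemLp (fun ω =>
      (zodiac L α β η (zodiacGrad F o nc δ ξ S ω) x₀ v₀ k).1 i) 2 P) :
    IsFreshSample P μ nc (fun i => P.map (S i k))
      (fun ω => (zodiac L α β η (zodiacGrad F o nc δ ξ S ω) x₀ v₀ k).1)
      (fun i ω => (ξ i k ω, S i k ω)) := by
  let Y : Fin n × ℕ → Ω → Ξ × Finset (Fin p) := fun a ω => (ξ a.1 a.2 ω, S a.1 a.2 ω)
  have hY : ∀ a, Measurable (Y a) := hs.measurable_pair
  have hYm : ∀ (U : Set (Fin n × ℕ)), ∀ a ∈ U,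
      Measurable[⨆ a ∈ U, MeasurableSpace.comap (Y a) inferInstance] (Y a) := fun U a ha =>
    Measurable.mono (comap_measurable (Y a)) (le_iSup₂_of_le a ha le_rfl) le_rfl
  have hpast : ∀ (U : Set (Fin n × ℕ)), (∀ i, ∀ l < k, (i, l) ∈ U) →
      Measurable[⨆ a ∈ U, MeasurableSpace.comap (Y a) inferInstance]
        (fun ω => (zodiac L α β η (zodiacGrad F o nc δ ξ S ω) x₀ v₀ k).1) := fun U hU => by
    -- Here the σ-algebra generated by the draws in `U` replaces the ambient one.
    let : MeasurableSpace Ω := ⨆ a ∈ U, MeasurableSpace.comap (Y a) inferInstance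
    exact measurable_fst.comp (measurable_zodiac hF L α β η o nc δ ξ S x₀ v₀ k
      fun i l hl => hYm U (i, l) (hU i l hl))
  refine ⟨measurable_fst.comp (measurable_zodiac hF L α β η o nc δ ξ S x₀ v₀ k
    fun i l _ => hY (i, l)), hx, fun i => hY (i, k), fun i => ?_, fun i => ?_, fun i j => ?_,
    fun i => ?_, fun i j hij => ?_⟩
  · infer_instance
  · rw [(indepFun_iff_map_prod_eq_prod_map_map (hs.measurable_sample i k).aemeasurable
      (hs.measurable_coord i k).aemeasurable).1 (hs.indep_pair i k), hs.law_sample]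
  · rw [map_measureReal_apply (hs.measurable_coord i k) (measurableSet_mem_finset j)]
    exact hs.uniform_coord i k j
  · refine indepFun_of_measurable_iSup hY hs.indep_all (T := {a | a.2 < k}) (b := (i, k))
      (hpast _ fun i l hl => hl) ?_
    exact lt_irrefl k
  -- The past enlarged by the present draw of agent `j`, which still misses that of agent `i`.
  · refine indepFun_of_measurable_iSup hY hs.indep_all (T := {a | a.2 < k ∨ a = (j, k)})
      (b := (i, k)) ?_ ?_
    · exact Measurable.prodMk (hpast _ fun i l hl => Or.inl hl) (hYm _ (j, k) (Or.inr rfl))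
    · rintro (h1 | h1)
      · exact lt_irrefl k h1
      · exact hij (Prod.mk.inj h1).1

theorem memLp_zodiac (hs : IsSampling P μ nc ξ S) (hF : CostAssumptions F μ c ζ σ₂)
    (hnc : 0 < nc) (L : Matrix (Fin n) (Fin n) ℝ) (α β η : ℝ) (o : DiffScheme)
    {δ : Fin n → Fin p → ℕ → ℝ} (hδ : ∀ i j k, 0 < δ i j k)
    (x₀ v₀ : Fin n → EuclideanSpace ℝ (Fin p)) (k : ℕ) :
    (∀ i, MemLp (fun ω => (zodiac L α β η (zodiacGrad F o nc δ ξ S ω) x₀ v₀ k).1 i) 2 P) ∧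
      ∀ i, MemLp (fun ω => (zodiac L α β η (zodiacGrad F o nc δ ξ S ω) x₀ v₀ k).2 i) 2 P := by
  induction k with
  | zero => exact ⟨fun i => memLp_const _, fun i => memLp_const _⟩
  | succ k ih =>
    have hfresh := hs.isFreshSample hF.measurable L α β η o δ x₀ v₀ k ih.1
    -- Only finiteness matters here, and for every `k`, whereas the quantitative bound on `δ` is
    -- available for `k ≤ T` only; any common bound will do.
    have hD : ∀ i j, δ i j k ^ 2 ≤ ∑ i, ∑ j, δ i j k ^ 2 := fun i j =>
      (Finset.single_le_sum (f := fun j => δ i j k ^ 2) (fun j _ => sq_nonneg _)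
        (Finset.mem_univ j)).trans (Finset.single_le_sum (f := fun i => ∑ j, δ i j k ^ 2)
          (fun i _ => Finset.sum_nonneg fun j _ => sq_nonneg _) (Finset.mem_univ i))
    have hg := fun i => (memLp_sampleGrad hF hnc o (fun i j => hδ i j k) hD hfresh i).1
    have hLx : ∀ i, MemLp (fun ω => ∑ j, L i j •
        (zodiac L α β η (zodiacGrad F o nc δ ξ S ω) x₀ v₀ k).1 j) 2 P := fun i =>
      memLp_finsetSum _ fun j _ => (ih.1 j).const_smul (L i j)
    refine ⟨fun i => ?_, fun i => ?_⟩
    · exact (ih.1 i).sub (((((hLx i).const_smul α).add ((ih.2 i).const_smul β)).add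
        (hg i)).const_smul η)
    · exact (ih.2 i).add ((hLx i).const_smul (η * β))

end Freshness

/-! ### Expected contraction of the Lyapunov function. -/

section Potential

variable {n p : ℕ} {Ω : Type*} [MeasurableSpace Ω] {P : Measure Ω}

theorem memLp_deviation {X : Ω → Fin n → EuclideanSpace ℝ (Fin p)}
    (hX : ∀ i, MemLp (fun ω => X ω i) 2 P) : MemLp (fun ω => deviation (X ω)) 2 P :=
  MemLp.of_eval_piLp fun i => (hX i).sub (memLp_avg hX)

theorem memLp_dualPotential [IsFiniteMeasure P] {X : Ω → ℕ → Fin n → EuclideanSpace ℝ (Fin p)}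
    (hX : ∀ k i, MemLp (fun ω => X ω k i) 2 P) (h : ℝ) (u₀ : BlockVec n p) (k : ℕ) :
    MemLp (fun ω => dualPotential h u₀ (X ω) k) 2 P :=
  (memLp_const u₀).add ((memLp_finsetSum (Finset.range k) fun l _ =>
    memLp_deviation (hX l)).const_smul h)

theorem LinearMap.comp_memLp {H : Type*} [NormedAddCommGroup H] [NormedSpace ℝ H]
    [FiniteDimensional ℝ H] (Λ : H →ₗ[ℝ] H) {u : Ω → H} (hu : MemLp u 2 P) :
    MemLp (fun ω => Λ (u ω)) 2 P :=
  (LinearMap.toContinuousLinearMap Λ).comp_memLp' hu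

theorem integrable_lyapunov {H : Type*} [NormedAddCommGroup H] [InnerProductSpace ℝ H]
    [FiniteDimensional ℝ H] (Λ : H →ₗ[ℝ] H) (κ₁ : ℝ) {y u : Ω → H} (hy : MemLp y 2 P)
    (hu : MemLp u 2 P) : Integrable (fun ω => lyapunov Λ κ₁ (y ω) (u ω)) P :=
  ((hy.integrable_normSq.const_mul (1 / 2)).add (integrable_inner_of_memLp hy hu)).add
    ((integrable_inner_of_memLp hu (Λ.comp_memLp hu)).const_mul ((1 + κ₁) / 2))

theorem integral_lyapunov_step_le {Λ : BlockVec n p →ₗ[ℝ] BlockVec n p} {κ₁ h c K η : ℝ}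
    (hn : 0 < n) (hK : 0 ≤ K)
    (hstep : ∀ y u w : BlockVec n p, ∑ i, y i = 0 → ∑ i, u i = 0 →
      lyapunov Λ κ₁ (y - h • Λ (κ₁ • y + u) - w) (u + h • y) ≤
        (1 - c) * lyapunov Λ κ₁ y u + K * ‖w‖ ^ 2)
    {X Y g : Ω → Fin n → EuclideanSpace ℝ (Fin p)} {u : Ω → BlockVec n p}
    (hX : ∀ i, MemLp (fun ω => X ω i) 2 P) (hY : ∀ i, MemLp (fun ω => Y ω i) 2 P)
    (hg : ∀ i, MemLp (fun ω => g ω i) 2 P) (hu : MemLp u 2 P) (hu0 : ∀ ω, ∑ i, u ω i = 0)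
    (hXY : ∀ ω, deviation (Y ω) =
      deviation (X ω) - h • Λ (κ₁ • deviation (X ω) + u ω) - η • deviation (g ω)) :
    ∫ ω, lyapunov Λ κ₁ (deviation (Y ω)) (u ω + h • deviation (X ω)) ∂P ≤
      (1 - c) * ∫ ω, lyapunov Λ κ₁ (deviation (X ω)) (u ω) ∂P +
        K * η ^ 2 * ∑ i, ∫ ω, ‖g ω i‖ ^ 2 ∂P := by
  have hdX := memLp_deviation hX
  have hI := integrable_lyapunov Λ κ₁ hdX hu
  have hI' := integrable_lyapunov Λ κ₁ (memLp_deviation hY) (hu.add (hdX.const_smul h))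
  have hgi : Integrable (fun ω => ∑ i, ‖g ω i‖ ^ 2) P :=
    integrable_finsetSum _ fun i _ => (hg i).integrable_normSq
  rw [← integral_finsetSum _ fun i _ => (hg i).integrable_normSq, ← integral_const_mul,
    ← integral_add_mul (hI.const_mul _) hgi]
  refine integral_mono hI' (integrable_add_mul (hI.const_mul _) hgi _) fun ω => ?_
  have h1 := hstep (deviation (X ω)) (u ω) (η • deviation (g ω)) (sum_deviation hn _) (hu0 ω)
  rw [← hXY, norm_smul, mul_pow, Real.norm_eq_abs, sq_abs, ← mul_assoc] at h1
  refine h1.trans ?_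
  gcongr
  exact normSq_deviation_le hn _

end Potential

/-- The gradient is controlled by the gap and the consensus error by the Lyapunov function, which
closes the system in `a` and `W`. One coefficient is used for all terms, at the price of extra
nonnegative ones. -/
theorem noise_le_of_le {p : ℕ} {c c₀ σ₁ σ₂ a W G E b S : ℝ} (hc : 0 ≤ c) (hc₀ : 0 < c₀)
    (ha : 0 ≤ a) (hW : 0 ≤ W) (hb : 0 ≤ b) (hG : G ≤ 2 * c * a) (hE : c₀ * E ≤ W)
    (hS : S ≤ p * (4 * σ₁ ^ 2 + 12 * (G + σ₂ ^ 2 + c ^ 2 * E) + c ^ 2 * b)) :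
    S ≤ p * ((4 * σ₁ ^ 2 + 12 * σ₂ ^ 2 + 24 * c + 12 * c ^ 2 / c₀ + c ^ 2) *
      (1 + a + W + b)) := by
  have hE' : E ≤ W / c₀ := by rwa [le_div_iff₀' hc₀]
  refine hS.trans ?_
  gcongr
  have h1 : 4 * σ₁ ^ 2 + 12 * (G + σ₂ ^ 2 + c ^ 2 * E) + c ^ 2 * b ≤
      4 * σ₁ ^ 2 + 12 * (2 * c * a + σ₂ ^ 2 + c ^ 2 * (W / c₀)) + c ^ 2 * b := by gcongr
  have h2 : (4 * σ₁ ^ 2 + 12 * σ₂ ^ 2 + 24 * c + 12 * c ^ 2 / c₀ + c ^ 2) * (1 + a + W + b) -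
      (4 * σ₁ ^ 2 + 12 * (2 * c * a + σ₂ ^ 2 + c ^ 2 * (W / c₀)) + c ^ 2 * b) =
      (4 * σ₁ ^ 2 + 12 * σ₂ ^ 2) * (a + W + b) + 24 * c * (1 + W + b) +
        12 * c ^ 2 / c₀ * (1 + a + b) + c ^ 2 * (1 + a + W) := by ring
  have h3 : 0 ≤ (4 * σ₁ ^ 2 + 12 * σ₂ ^ 2) * (a + W + b) + 24 * c * (1 + W + b) +
        12 * c ^ 2 / c₀ * (1 + a + b) + c ^ 2 * (1 + a + W) := by positivity
  linarith

theorem mul_sq_smoothing (κδ : ℝ) {n p : ℕ} (hp : 0 < p) (k : ℕ) :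
    p * (κδ / ((p : ℝ) ^ (1 / 4 : ℝ) * (n : ℝ) ^ (1 / 4 : ℝ) *
      ((k : ℝ) + 1) ^ (1 / 4 : ℝ))) ^ 2 = smoothingTerm (κδ ^ 2) n p k := by
  have hsq : ∀ x : ℝ, 0 ≤ x → (x ^ (1 / 4 : ℝ)) ^ 2 = √x := fun x hx => by
    rw [← Real.rpow_natCast, ← Real.rpow_mul hx, Real.sqrt_eq_rpow]
    norm_num
  have hp' : (0 : ℝ) < p := by exact_mod_cast hp
  have hs : √(p : ℝ) ^ 2 = p := Real.sq_sqrt hp'.le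
  have hs0 : 0 < √(p : ℝ) := Real.sqrt_pos.2 hp'
  rw [div_pow, mul_pow, mul_pow, hsq _ hp'.le, hsq _ (Nat.cast_nonneg n), hsq _ (by positivity),
    smoothingTerm, ← hs, Real.sqrt_sq hs0.le]
  field_simp

theorem minPosEigenvalue_le_specRad {n : ℕ} {G : SimpleGraph (Fin n)}
    {A : Matrix (Fin n) (Fin n) ℝ} (hA : IsWeightedAdjMatrix G A) (hG : G.Connected)
    (hn : 2 ≤ n) : minPosEigenvalue (weightedLaplacian A) ≤ specRad (weightedLaplacian A) := by
  let a : Fin n := ⟨0, by omega⟩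
  let b : Fin n := ⟨1, by omega⟩
  have hab : a ≠ b := by simp [a, b, Fin.ext_iff]
  -- Any nonzero zero-sum vector can serve to compare the lower and the upper bound on the quadratic
  -- form.
  let x : Fin n → ℝ := Pi.single a 1 - Pi.single b 1
  have hx : ∑ i, x i = 0 := by simp [x, Finset.sum_sub_distrib]
  have hx0 : 0 < dotProduct x x := by
    have : x ≠ 0 := fun h0 => by simpa [x, hab] using congrFun h0 a
    exact lt_of_le_of_ne (Finset.sum_nonneg fun i _ => mul_self_nonneg (x i))
      fun h0 => this (dotProduct_self_eq_zero.1 h0.symm)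
  exact le_of_mul_le_mul_right
    ((minPosEigenvalue_mul_le hA hG hx).trans (dotProduct_weightedLaplacian_le hA x)) hx0

/-! ### From one-step estimates to the scalar recursion. -/

section Assembly

variable {n p : ℕ} {Ξ Ω : Type*} [MeasurableSpace Ξ] [MeasurableSpace Ω]
  {F : Fin n → EuclideanSpace ℝ (Fin p) → Ξ → ℝ} {μ : Fin n → Measure Ξ} {P : Measure Ω}

/-- The mean optimality gap of a random point. -/
noncomputable def meanGap (F : Fin n → EuclideanSpace ℝ (Fin p) → Ξ → ℝ) (μ : Fin n → Measure Ξ)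
    (P : Measure Ω) (z : Ω → EuclideanSpace ℝ (Fin p)) : ℝ :=
  ∫ ω, globalCost F μ (z ω) ∂P - ⨅ y, globalCost F μ y

/-- The mean squared norm of the gradient of the global cost at a random point. -/
noncomputable def meanGradSq (F : Fin n → EuclideanSpace ℝ (Fin p) → Ξ → ℝ)
    (μ : Fin n → Measure Ξ) (P : Measure Ω) (z : Ω → EuclideanSpace ℝ (Fin p)) : ℝ :=
  ∫ ω, ‖∇ (globalCost F μ) (z ω)‖ ^ 2 ∂P

theorem meanGradSq_nonneg (z : Ω → EuclideanSpace ℝ (Fin p)) : 0 ≤ meanGradSq F μ P z :=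
  integral_nonneg fun _ => sq_nonneg _

variable [IsProbabilityMeasure P]

theorem meanGap_nonneg {c ζ σ₂ : ℝ} (hF : CostAssumptions F μ c ζ σ₂) (hn : 0 < n)
    {z : Ω → EuclideanSpace ℝ (Fin p)} (hz : MemLp z 2 P) : 0 ≤ meanGap F μ P z := by
  have h := integral_mono (μ := P) (integrable_const (⨅ y, globalCost F μ y))
    ((hF.smooth_globalCost hn).1.integrable_comp hz) fun ω => ciInf_le hF.bddBelow (z ω)
  simp only [integral_const, probReal_univ, one_smul] at h
  exact sub_nonneg.2 h

theorem meanGradSq_le {c ζ σ₂ : ℝ} (hF : CostAssumptions F μ c ζ σ₂) (hc : 0 < c) (hn : 0 < n)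
    {z : Ω → EuclideanSpace ℝ (Fin p)} (hz : MemLp z 2 P) :
    meanGradSq F μ P z ≤ 2 * c * meanGap F μ P z := by
  have hs := (hF.smooth_globalCost hn).1
  have h1 : Integrable (fun ω => 2 * c * (globalCost F μ (z ω) - ⨅ y, globalCost F μ y)) P :=
    ((hs.integrable_comp hz).sub (integrable_const _)).const_mul _
  have h := integral_mono (μ := P) (hs.memLp_gradient hz).integrable_normSq h1 fun ω =>
    hs.normSq_gradient_le hc (fun x => ciInf_le hF.bddBelow x) (z ω)
  rw [integral_const_mul, integral_sub (hs.integrable_comp hz) (integrable_const _)] at h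
  simp only [integral_const, probReal_univ, one_smul] at h
  exact h

variable {nc T : ℕ} {τ : ℕ → Fin n → Measure (Finset (Fin p))}
  {X : ℕ → Ω → Fin n → EuclideanSpace ℝ (Fin p)} {Z : ℕ → Fin n → Ω → Ξ × Finset (Fin p)}
  {u : ℕ → Ω → BlockVec n p} {Λ : BlockVec n p →ₗ[ℝ] BlockVec n p}
  {Lf ζ σ₁ σ₂ κ₁ s h c K c₀ C₀ R N η : ℝ} {d : ℕ → Fin n → Fin p → ℝ} {D : ℕ → ℝ}
  {o : DiffScheme}

/-- Here `W k` is the expected Lyapunov function divided by `n`, and `η² p = n / T` absorbs the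
factor `p` of the second moments; in the descent inequality the `1 / n` from independence cancels
this `n`. The coefficient `Lf ^ 2 * (1 / c₀ + 1) + Lf` is large enough for both inequalities on the
gap: the first needs the `Lf ^ 2` part, the crude one the bound `g / 2 ≤ Lf * a`. -/
theorem descentRecursion_of_isFreshSample (hn : 1 ≤ n) (hp : 1 ≤ p) (hT : 1 ≤ T)
    (hnpT : (n : ℝ) ^ 3 < p * T) (hN : (p : ℝ) ≤ N * T) (hLf : 0 < Lf)
    (hF : CostAssumptions F μ Lf ζ σ₂) (hσ₁ : (p : ℝ) * ζ ^ 2 ≤ σ₁ ^ 2) (hnc : 1 ≤ nc)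
    (hη : 0 < η) (hη2 : η ^ 2 = n / (p * T)) (hd : ∀ k i j, 0 < d k i j)
    (hdD : ∀ k < T, ∀ i j, d k i j ^ 2 ≤ D k) (hD : ∀ k, p * D k = smoothingTerm s n p k)
    (hs : 0 ≤ s) (hZ : ∀ k, IsFreshSample P μ nc (τ k) (X k) (Z k))
    (hu : ∀ k, MemLp (u k) 2 P) (hu0 : ∀ k ω, ∑ i, u k ω i = 0)
    (hXavg : ∀ k ω, avg (X (k + 1) ω) =
      avg (X k ω) - η • avg fun i => sampleGrad F o nc (d k) (X k) (Z k) i ω)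
    (hXdev : ∀ k ω, deviation (X (k + 1) ω) =
      deviation (X k ω) - h • Λ (κ₁ • deviation (X k ω) + u k ω) -
        η • deviation fun i => sampleGrad F o nc (d k) (X k) (Z k) i ω)
    (hu_succ : ∀ k ω, u (k + 1) ω = u k ω + h • deviation (X k ω))
    (hcons : ∫ ω, consensusError (X 0 ω) ∂P ≤ R)
    (hdual : (1 / (n : ℝ)) * ∫ ω, ‖Λ (u 0 ω)‖ ^ 2 ∂P ≤ R)
    (hgap : meanGap F μ P (fun ω => avg (X 0 ω)) ≤ R)
    (hK : 0 ≤ K) (hc₀ : 0 < c₀) (hC₀ : 0 ≤ C₀)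
    (hstep : ∀ y u w : BlockVec n p, ∑ i, y i = 0 → ∑ i, u i = 0 →
      c₀ * ‖y‖ ^ 2 ≤ lyapunov Λ κ₁ y u ∧
      lyapunov Λ κ₁ y u ≤ C₀ * (‖y‖ ^ 2 + ‖Λ u‖ ^ 2) ∧
      lyapunov Λ κ₁ (y - h • Λ (κ₁ • y + u) - w) (u + h • y) ≤
        (1 - c) * lyapunov Λ κ₁ y u + K * ‖w‖ ^ 2) :
    ∃ W : ℕ → ℝ, (∀ k, c₀ * ∫ ω, consensusError (X k ω) ∂P ≤ W k) ∧
      DescentRecursion c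
        (K * (4 * σ₁ ^ 2 + 12 * σ₂ ^ 2 + 24 * Lf + 12 * Lf ^ 2 / c₀ + Lf ^ 2))
        ((Lf + 1) / 2 * (4 * σ₁ ^ 2 + 12 * σ₂ ^ 2 + 24 * Lf + 12 * Lf ^ 2 / c₀ + Lf ^ 2))
        (Lf ^ 2 * (1 / c₀ + 1) + Lf) Lf s (R + 2 * C₀ * R) N n p T η
        (fun k => meanGap F μ P fun ω => avg (X k ω)) W
        (fun k => meanGradSq F μ P fun ω => avg (X k ω)) := by
  have hn' : (0 : ℝ) < n := by exact_mod_cast hn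
  have hp' : (0 : ℝ) < p := by exact_mod_cast hp
  have hT' : (0 : ℝ) < T := by exact_mod_cast hT
  have hR : 0 ≤ R := (integral_nonneg fun ω => consensusError_nonneg (X 0 ω)).trans hcons
  have hX := fun k => (hZ k).memLp
  have havg : ∀ k, MemLp (fun ω => avg (X k ω)) 2 P := fun k => memLp_avg (hX k)
  have hdX := fun k => memLp_deviation (hX k)
  have hI := fun k => integrable_lyapunov Λ κ₁ (hdX k) (hu k)
  have hE := fun k => memLp_consensus (hX k)
  set E : ℕ → ℝ := fun k => ∫ ω, consensusError (X k ω) ∂P with hEdef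
  set W : ℕ → ℝ := fun k =>
    1 / (n : ℝ) * ∫ ω, lyapunov Λ κ₁ (deviation (X k ω)) (u k ω) ∂P with hWdef
  set a : ℕ → ℝ := fun k => meanGap F μ P fun ω => avg (X k ω) with hadef
  set g : ℕ → ℝ := fun k => meanGradSq F μ P fun ω => avg (X k ω) with hgdef
  set A₂ := 4 * σ₁ ^ 2 + 12 * σ₂ ^ 2 + 24 * Lf + 12 * Lf ^ 2 / c₀ + Lf ^ 2 with hA₂
  have hA₂0 : 0 ≤ A₂ := by positivity
  set M : ℕ → ℝ := fun k =>
    1 / (n : ℝ) * ∑ i, ∫ ω, ‖sampleGrad F o nc (d k) (X k) (Z k) i ω‖ ^ 2 ∂P with hMdef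
  have hE0 : ∀ k, 0 ≤ E k := fun k => integral_nonneg fun ω => consensusError_nonneg _
  have hEW : ∀ k, c₀ * E k ≤ W k := fun k => by
    have h1 : n * (c₀ * E k) ≤ ∫ ω, lyapunov Λ κ₁ (deviation (X k ω)) (u k ω) ∂P := by
      rw [hEdef, ← integral_const_mul, ← integral_const_mul]
      refine integral_mono (((hE k).const_mul _).const_mul _) (hI k) fun ω => ?_
      have h2 := (hstep (deviation (X k ω)) (u k ω) 0 (sum_deviation hn _) (hu0 k ω)).1
      rw [normSq_deviation hn] at h2
      linarith
    simp only [hWdef]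
    rw [one_div, inv_mul_eq_div, le_div_iff₀' hn']
    exact h1
  have hW0 : ∀ k, 0 ≤ W k := fun k => (mul_nonneg hc₀.le (hE0 k)).trans (hEW k)
  have ha0 : ∀ k, 0 ≤ a k := fun k => meanGap_nonneg hF hn (havg k)
  have hga : ∀ k, g k ≤ 2 * Lf * a k := fun k => meanGradSq_le hF hLf hn (havg k)
  have hM : ∀ k < T, M k ≤ p * (A₂ * (1 + a k + W k + smoothingTerm s n p k)) := fun k hk =>
    noise_le_of_le hLf.le hc₀ (ha0 k) (hW0 k) (smoothingTerm_nonneg hs n p k) (hga k) (hEW k)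
      (hD k ▸ avg_integral_normSq_sampleGrad_le hF hn hnc o (hd k) (hdD k hk) (hZ k) hσ₁)
  have hηM : ∀ k < T, η ^ 2 * M k ≤
      n / T * (A₂ * (1 + a k + W k + smoothingTerm s n p k)) := fun k hk => by
    calc η ^ 2 * M k ≤ η ^ 2 * (p * (A₂ * (1 + a k + W k + smoothingTerm s n p k))) := by
          gcongr
          exact hM k hk
      _ = _ := by rw [hη2]; field_simp
  refine ⟨W, hEW, ⟨hn, hp, hT, hnpT, hN, hη, hη2, ha0, hW0, fun k => meanGradSq_nonneg _, hga,
    ?_, ?_, fun k hk => ?_, fun hηl k hk => ?_, fun k hk => ?_⟩⟩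
  · have : 0 ≤ 2 * C₀ * R := by positivity
    linarith
  · have hΛu : Integrable (fun ω => ‖Λ (u 0 ω)‖ ^ 2) P :=
      (Λ.comp_memLp (hu 0)).integrable_normSq
    have h1 : ∫ ω, lyapunov Λ κ₁ (deviation (X 0 ω)) (u 0 ω) ∂P ≤
        C₀ * (n * E 0 + ∫ ω, ‖Λ (u 0 ω)‖ ^ 2 ∂P) := by
      rw [hEdef, ← integral_const_mul, ← integral_add ((hE 0).const_mul _) hΛu,
        ← integral_const_mul]
      refine integral_mono (hI 0) ((((hE 0).const_mul _).add hΛu).const_mul _) fun ω => ?_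
      have h2 := (hstep (deviation (X 0 ω)) (u 0 ω) 0 (sum_deviation hn _) (hu0 0 ω)).2.1
      rwa [normSq_deviation hn] at h2
    calc W 0 ≤ 1 / n * (C₀ * (n * E 0 + ∫ ω, ‖Λ (u 0 ω)‖ ^ 2 ∂P)) := by
          exact mul_le_mul_of_nonneg_left h1 (by positivity)
      _ = C₀ * (E 0 + 1 / n * ∫ ω, ‖Λ (u 0 ω)‖ ^ 2 ∂P) := by field_simp
      _ ≤ C₀ * (R + R) := by gcongr
      _ ≤ _ := by linarith
  · have h1 := integral_lyapunov_step_le (P := P) (X := X k) (Y := X (k + 1))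
      (g := fun ω i => sampleGrad F o nc (d k) (X k) (Z k) i ω) (u := u k) hn hK
      (fun y u w hy hu => (hstep y u w hy hu).2.2) (hX k) (hX (k + 1))
      (fun i => (memLp_sampleGrad hF hnc o (hd k) (hdD k hk) (hZ k) i).1) (hu k) (hu0 k) (hXdev k)
    simp only [← hu_succ] at h1
    calc W (k + 1) ≤ 1 / (n : ℝ) * ((1 - c) * ∫ ω, lyapunov Λ κ₁ (deviation (X k ω)) (u k ω) ∂P +
          K * η ^ 2 * ∑ i, ∫ ω, ‖sampleGrad F o nc (d k) (X k) (Z k) i ω‖ ^ 2 ∂P) := by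
          exact mul_le_mul_of_nonneg_left h1 (by positivity)
      _ = (1 - c) * W k + K * (η ^ 2 * M k) := by
          rw [hWdef, hMdef]
          ring
      _ ≤ (1 - c) * W k +
          K * (n / T * (A₂ * (1 + a k + W k + smoothingTerm s n p k))) :=
          add_le_add_right (mul_le_mul_of_nonneg_left (hηM k hk) hK) _
      _ = _ := by ring
  · have h1 := integral_globalCost_step_le hF hLf hn hnc hp o (hd k) (hdD k hk) (hZ k) hη.le hηl
    simp only [← hXavg] at h1
    have h2 : Lf ^ 2 * (E k + p * D k) ≤
        (Lf ^ 2 * (1 / c₀ + 1) + Lf) * (W k + smoothingTerm s n p k) := by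
      have h3 : E k ≤ 1 / c₀ * W k := by
        rw [one_div, inv_mul_eq_div, le_div_iff₀' hc₀]
        exact hEW k
      rw [hD]
      have h4 := smoothingTerm_nonneg hs n p k
      have h5 := hW0 k
      calc _ ≤ Lf ^ 2 * (1 / c₀ * W k + smoothingTerm s n p k) := by gcongr
        _ ≤ Lf ^ 2 * (1 / c₀ * W k + smoothingTerm s n p k) +
            (Lf ^ 2 * (W k + 1 / c₀ * smoothingTerm s n p k) +
              Lf * (W k + smoothingTerm s n p k)) := le_add_of_nonneg_right (by positivity)
        _ = _ := by ring
    have h3 : Lf * η ^ 2 / (2 * n) * M k ≤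
        (Lf + 1) / 2 * A₂ / T * (1 + a k + W k + smoothingTerm s n p k) := by
      have h4 := smoothingTerm_nonneg hs n p k
      have h5 := hW0 k
      have h6 := ha0 k
      calc _ = Lf / (2 * n) * (η ^ 2 * M k) := by ring
        _ ≤ Lf / (2 * n) * (n / T * (A₂ * (1 + a k + W k + smoothingTerm s n p k))) :=
            mul_le_mul_of_nonneg_left (hηM k hk) (by positivity)
        _ = Lf / 2 * A₂ / T * (1 + a k + W k + smoothingTerm s n p k) := by field_simp
        _ ≤ _ := by
            gcongr
            linarith
    have h4 := mul_le_mul_of_nonneg_left h2 hη.le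
    simp only [hadef, hgdef, meanGap, meanGradSq]
    simp only [hMdef, hadef, meanGap] at h3
    linarith
  · have h1 := integral_globalCost_step_le' hF hLf hn hnc o (hd k) (hdD k hk) (hZ k) η
    simp only [← hXavg] at h1
    have h2 : 1 / 2 * g k ≤ (Lf ^ 2 * (1 / c₀ + 1) + Lf) * a k := by
      have h3 : 0 ≤ Lf ^ 2 * (1 / c₀ + 1) * a k := mul_nonneg (by positivity) (ha0 k)
      linarith [hga k]
    have h3 : (Lf + 1) / 2 * η ^ 2 * M k ≤
        (Lf + 1) / 2 * A₂ * (n / T) * (1 + a k + W k + smoothingTerm s n p k) := by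
      calc _ = (Lf + 1) / 2 * (η ^ 2 * M k) := by ring
        _ ≤ (Lf + 1) / 2 * (n / T * (A₂ * (1 + a k + W k + smoothingTerm s n p k))) :=
            mul_le_mul_of_nonneg_left (hηM k hk) (by positivity)
        _ = _ := by ring
    simp only [hadef, hgdef, meanGap, meanGradSq] at h2 h3 ⊢
    simp only [hMdef] at h3
    linarith

end Assembly

/-! ### The recursion for the algorithm itself. -/

section Algorithm

variable {n p : ℕ} {Ξ Ω : Type*} [MeasurableSpace Ξ] [MeasurableSpace Ω]
  {F : Fin n → EuclideanSpace ℝ (Fin p) → Ξ → ℝ} {μ : Fin n → Measure Ξ} {P : Measure Ω}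
  [IsProbabilityMeasure P] {nc T : ℕ} {G : SimpleGraph (Fin n)} {A : Matrix (Fin n) (Fin n) ℝ}
  {ξ : Fin n → ℕ → Ω → Ξ} {S : Fin n → ℕ → Ω → Finset (Fin p)}
  {Lf ζ σ₁ σ₂ κ₁ κδ h c K c₀ C₀ R N α β η : ℝ} {δ : Fin n → Fin p → ℕ → ℝ} {o : DiffScheme}
  {x₀ v₀ : Fin n → EuclideanSpace ℝ (Fin p)}

theorem exists_descentRecursion_zodiac (hA : IsWeightedAdjMatrix G A) (hG : G.Connected)
    (hn : 2 ≤ n) (hp : 1 ≤ p) (hT : 1 ≤ T) (hnpT : (n : ℝ) ^ 3 < p * T) (hN : (p : ℝ) ≤ N * T)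
    (hLf : 0 < Lf) (hF : CostAssumptions F μ Lf ζ σ₂) (hσ₁ : (p : ℝ) * ζ ^ 2 ≤ σ₁ ^ 2)
    (hnc : 1 ≤ nc) (hs : IsSampling P μ nc ξ S) (hη : 0 < η) (hη2 : η ^ 2 = n / (p * T))
    (hα : η * α = h * κ₁) (hβ : η * β = h) (hδ : ∀ i j k, 0 < δ i j k)
    (hδT : ∀ i j, ∀ k ≤ T, δ i j k ≤ κδ /
      ((p : ℝ) ^ (1 / 4 : ℝ) * (n : ℝ) ^ (1 / 4 : ℝ) * ((k : ℝ) + 1) ^ (1 / 4 : ℝ)))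
    (hv₀ : ∑ i, v₀ i = 0) (hx₀R : consensusError x₀ ≤ R)
    (hv₀R : (1 / (n : ℝ)) * ∑ i, ‖v₀ i‖ ^ 2 ≤ R)
    (hfR : globalCost F μ (avg x₀) - (⨅ y, globalCost F μ y) ≤ R)
    (hK : 0 ≤ K) (hc₀ : 0 < c₀) (hC₀ : 0 ≤ C₀)
    (hstep : ∀ y u w : BlockVec n p, ∑ i, y i = 0 → ∑ i, u i = 0 →
      c₀ * ‖y‖ ^ 2 ≤ lyapunov (blockMap (weightedLaplacian A)) κ₁ y u ∧
      lyapunov (blockMap (weightedLaplacian A)) κ₁ y u ≤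
        C₀ * (‖y‖ ^ 2 + ‖blockMap (weightedLaplacian A) u‖ ^ 2) ∧
      lyapunov (blockMap (weightedLaplacian A)) κ₁
          (y - h • blockMap (weightedLaplacian A) (κ₁ • y + u) - w) (u + h • y) ≤
        (1 - c) * lyapunov (blockMap (weightedLaplacian A)) κ₁ y u + K * ‖w‖ ^ 2) :
    ∃ W : ℕ → ℝ,
      (∀ k, c₀ * ∫ ω, consensusError
        (zodiacX (weightedLaplacian A) α β η F o nc δ ξ S x₀ v₀ k ω) ∂P ≤ W k) ∧
      DescentRecursion c
        (K * (4 * σ₁ ^ 2 + 12 * σ₂ ^ 2 + 24 * Lf + 12 * Lf ^ 2 / c₀ + Lf ^ 2))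
        ((Lf + 1) / 2 * (4 * σ₁ ^ 2 + 12 * σ₂ ^ 2 + 24 * Lf + 12 * Lf ^ 2 / c₀ + Lf ^ 2))
        (Lf ^ 2 * (1 / c₀ + 1) + Lf) Lf (κδ ^ 2) (R + 2 * C₀ * R) N n p T η
        (fun k => meanGap F μ P fun ω =>
          avg (zodiacX (weightedLaplacian A) α β η F o nc δ ξ S x₀ v₀ k ω)) W
        (fun k => meanGradSq F μ P fun ω =>
          avg (zodiacX (weightedLaplacian A) α β η F o nc δ ξ S x₀ v₀ k ω)) := by
  have hn0 : 0 < n := by omega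
  -- The potential starts at a solution of `L u₀ = v₀`. The bound on the initial Lyapunov function
  -- involves `‖L u₀‖`, hence the given bound on `v₀`.
  obtain ⟨u₀, hu₀, huv⟩ := exists_blockMap_eq hA hG hn (v := WithLp.toLp 2 v₀) hv₀
  have hX := fun k => (memLp_zodiac hs hF hnc (weightedLaplacian A) α β η o hδ x₀ v₀ k).1
  refine descentRecursion_of_isFreshSample (τ := fun k i => P.map (S i k))
    (X := fun k ω => (zodiac (weightedLaplacian A) α β η (zodiacGrad F o nc δ ξ S ω) x₀ v₀ k).1)
    (Z := fun k i ω => (ξ i k ω, S i k ω))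
    (u := fun k ω => dualPotential h u₀
      (fun k => (zodiac (weightedLaplacian A) α β η (zodiacGrad F o nc δ ξ S ω) x₀ v₀ k).1) k)
    (Λ := blockMap (weightedLaplacian A)) (h := h) (κ₁ := κ₁) (d := fun k i j => δ i j k)
    (D := fun k => (κδ / ((p : ℝ) ^ (1 / 4 : ℝ) * (n : ℝ) ^ (1 / 4 : ℝ) *
      ((k : ℝ) + 1) ^ (1 / 4 : ℝ))) ^ 2) (o := o)
    hn0 hp hT hnpT hN hLf hF hσ₁ hnc hη hη2 (fun k i j => hδ i j k) (fun k hk i j => ?_)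
    (fun k => mul_sq_smoothing κδ hp k) (sq_nonneg κδ)
    (fun k => hs.isFreshSample hF.measurable (weightedLaplacian A) α β η o δ x₀ v₀ k (hX k))
    (fun k => memLp_dualPotential hX h u₀ k) (fun k ω => sum_dualPotential hn0 hu₀ _ k)
    (fun k ω => avg_zodiac_succ hA hv₀ k)
    (fun k ω => deviation_zodiac_succ hA hv₀ huv hα hβ k)
    (fun k ω => dualPotential_succ h u₀ _ k) ?_ ?_ ?_ hK hc₀ hC₀ hstep
  · exact pow_le_pow_left₀ (hδ i j k).le (hδT i j k hk.le) 2
  · simpa [zodiac] using hx₀R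
  · have h1 : ‖(WithLp.toLp 2 v₀ : BlockVec n p)‖ ^ 2 = ∑ i, ‖v₀ i‖ ^ 2 :=
      PiLp.norm_sq_eq_of_L2 _ _
    simp only [dualPotential, Finset.range_zero, Finset.sum_empty, smul_zero, add_zero, huv, h1,
      integral_const, probReal_univ, one_smul]
    exact hv₀R
  · simpa [meanGap, zodiac] using hfR

end Algorithm

/-! ### Parameters, the constant `C`, and the conclusion. -/

theorem contraction_condition {n : ℕ} {G : SimpleGraph (Fin n)} {A : Matrix (Fin n) (Fin n) ℝ}
    (hA : IsWeightedAdjMatrix G A) (hn : 2 ≤ n) {κ₁ κ₂ : ℝ} (hκ₂ : 0 < κ₂)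
    (h : κ₂ < min (((κ₁ - 1) * minPosEigenvalue (weightedLaplacian A) - 1) /
      (specRad (weightedLaplacian A) + (2 * κ₁ ^ 2 + 1) *
        specRad (weightedLaplacian A * weightedLaplacian A) + 1)) (1 / 5)) :
    κ₂ < 1 / 5 ∧ κ₂ * (specRad (weightedLaplacian A) +
      (2 * κ₁ ^ 2 + 1) * specRad (weightedLaplacian A) ^ 2 + 1) <
        (κ₁ - 1) * minPosEigenvalue (weightedLaplacian A) - 1 := by
  have h1 := specRad_sq_le (isHermitian_weightedLaplacian hA) (by omega)
  have h2 : 0 ≤ specRad (weightedLaplacian A) := ENNReal.toReal_nonneg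
  have h3 := h.trans_le (min_le_left _ _)
  refine ⟨h.trans_le (min_le_right _ _), ?_⟩
  set r := specRad (weightedLaplacian A)
  set r' := specRad (weightedLaplacian A * weightedLaplacian A)
  have h4 : 0 < r + (2 * κ₁ ^ 2 + 1) * r' + 1 := by
    have : 0 ≤ r' := ENNReal.toReal_nonneg
    positivity
  rw [lt_div_iff₀ h4] at h3
  refine lt_of_le_of_lt ?_ h3
  gcongr

theorem step_size_identities {n p T : ℕ} (hn : 0 < n) (hp : 0 < p) (hT : 0 < T)
    {κ₁ κ₂ α β η : ℝ} (hκ₂ : 0 < κ₂) (hα : α = κ₁ * β)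
    (hβ : β = κ₂ * √((p : ℝ) * (T : ℝ)) / √(n : ℝ)) (hη : η = κ₂ / β) :
    0 < η ∧ η ^ 2 = n / (p * T) ∧ η * α = κ₂ * κ₁ ∧ η * β = κ₂ := by
  have hn' : (0 : ℝ) < n := by exact_mod_cast hn
  have hpT : (0 : ℝ) < p * T := by positivity
  have h1 : 0 < √(n : ℝ) := Real.sqrt_pos.2 hn'
  have h2 : 0 < √((p : ℝ) * (T : ℝ)) := Real.sqrt_pos.2 hpT
  have hβ0 : 0 < β := by rw [hβ]; positivity
  have hηβ : η * β = κ₂ := by rw [hη, div_mul_cancel₀ _ hβ0.ne']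
  refine ⟨by rw [hη]; positivity, ?_, by rw [hα, mul_left_comm, hηβ, mul_comm], hηβ⟩
  have h3 : η = √(n : ℝ) / √((p : ℝ) * (T : ℝ)) := by
    rw [hη, hβ]
    field_simp
  rw [h3, div_pow, Real.sq_sqrt hn'.le, Real.sq_sqrt hpT.le]

/-- Partial sums of a nonnegative sequence dominate its terms and are monotone; adding `1` makes
them positive. -/
theorem exists_monotone_majorant {K : ℕ → ℝ} (hK : ∀ N, 0 ≤ K N) :
    ∃ C : ℝ → ℝ, Monotone C ∧ (∀ r, 0 < C r) ∧ ∀ r, K ⌈r⌉₊ ≤ C r := by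
  refine ⟨fun r => ∑ m ∈ Finset.range (⌈r⌉₊ + 1), K m + 1, fun r s hrs => ?_, fun r => ?_,
    fun r => ?_⟩
  · have h := Nat.ceil_mono hrs
    exact add_le_add_left (Finset.sum_le_sum_of_subset_of_nonneg
      (Finset.range_mono (by omega)) fun i _ _ => hK i) 1
  · exact add_pos_of_nonneg_of_pos (Finset.sum_nonneg fun i _ => hK i) one_pos
  · have h := Finset.single_le_sum (f := K) (s := Finset.range (⌈r⌉₊ + 1)) (fun i _ => hK i)
      (Finset.mem_range.2 (Nat.lt_succ_self _))
    exact h.trans (le_add_of_nonneg_right zero_le_one)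

/-- The coefficient `C` of the `O`-terms is fixed once the scalars in the first line are: it depends
neither on the cost functions, the samples and the graph (other than through the two spectral
quantities `ρ`, `ρ₂`), nor on `n`, `p`, `T` other than through `C (p / T)`, with `C` nondecreasing.
As `p / T ≤ p`, it is bounded by the constant `C p` for a problem of dimension `p`, for all
`n` and all `T > n ^ 3 / p`, and by the absolute constant `C 1` as soon as `T ≥ p`.
`R` bounds the initial data. -/
theorem theorem1 (Lf σ₁ σ₂ κ₁ κ₂ κδ ρ ρ₂ R : ℝ) (hLf : 0 < Lf) (hκδ : 0 < κδ) :
    ∃ C : ℝ → ℝ, Monotone C ∧ (∀ r, 0 < C r) ∧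
      ∀ (n p T : ℕ), 2 ≤ n → 1 ≤ p → (n : ℝ) ^ 3 / (p : ℝ) < (T : ℝ) →
      -- the communication graph
      ∀ (G : SimpleGraph (Fin n)) (A L : Matrix (Fin n) (Fin n) ℝ), G.Connected →
      IsWeightedAdjMatrix G A → L = weightedLaplacian A →
      specRad L = ρ → minPosEigenvalue L = ρ₂ →
      -- the ranges of the parameters
      1 / minPosEigenvalue L + 1 < κ₁ →
      0 < κ₂ →
      κ₂ < min (((κ₁ - 1) * minPosEigenvalue L - 1) /
          (specRad L + (2 * κ₁ ^ 2 + 1) * specRad (L * L) + 1)) (1 / 5) →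
      -- the cost functions
      ∀ (Ξ : Type*) [MeasurableSpace Ξ] (F : Fin n → EuclideanSpace ℝ (Fin p) → Ξ → ℝ)
        (μ : Fin n → Measure Ξ) (ζ : ℝ),
      CostAssumptions F μ Lf ζ σ₂ → (p : ℝ) * ζ ^ 2 ≤ σ₁ ^ 2 →
      -- the randomness of the algorithm
      ∀ (Ω : Type*) [MeasurableSpace Ω] (P : Measure Ω) [IsProbabilityMeasure P] (nc : ℕ),
      1 ≤ nc → nc ≤ p →
      ∀ (ξ : Fin n → ℕ → Ω → Ξ) (S : Fin n → ℕ → Ω → Finset (Fin p)),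
      IsSampling P μ nc ξ S →
      -- the step sizes, the smoothing parameters, the initial values and the iterates
      ∀ (α β η : ℝ), α = κ₁ * β → β = κ₂ * Real.sqrt ((p : ℝ) * (T : ℝ)) / Real.sqrt (n : ℝ) →
      η = κ₂ / β →
      ∀ (δ : Fin n → Fin p → ℕ → ℝ), (∀ i j k, 0 < δ i j k) →
      (∀ i j, ∀ k ≤ T, δ i j k ≤ κδ /
        ((p : ℝ) ^ (1 / 4 : ℝ) * (n : ℝ) ^ (1 / 4 : ℝ) * ((k : ℝ) + 1) ^ (1 / 4 : ℝ))) →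
      ∀ (o : DiffScheme) (x₀ v₀ : Fin n → EuclideanSpace ℝ (Fin p)),
      ∑ i, v₀ i = 0 →
      consensusError x₀ ≤ R → (1 / (n : ℝ)) * ∑ i, ‖v₀ i‖ ^ 2 ≤ R →
      globalCost F μ (avg x₀) - (⨅ y, globalCost F μ y) ≤ R →
      ∀ (x : ℕ → Ω → Fin n → EuclideanSpace ℝ (Fin p)),
      x = zodiacX L α β η F o nc δ ξ S x₀ v₀ →
      -- the three bounds
      ((∀ k < T, Integrable (fun ω => ‖∇ (globalCost F μ) (avg (x k ω))‖ ^ 2) P) ∧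
        (1 / (T : ℝ)) * ∑ k ∈ Finset.range T, ∫ ω, ‖∇ (globalCost F μ) (avg (x k ω))‖ ^ 2 ∂P ≤
          C ((p : ℝ) / (T : ℝ)) * (Real.sqrt (p : ℝ) / Real.sqrt (T : ℝ)) +
            C ((p : ℝ) / (T : ℝ)) * ((n : ℝ) / (T : ℝ))) ∧
      (Integrable (fun ω => globalCost F μ (avg (x T ω))) P ∧
        (∫ ω, globalCost F μ (avg (x T ω)) ∂P) - (⨅ y, globalCost F μ y) ≤
          C ((p : ℝ) / (T : ℝ))) ∧
      ((∀ k < T, Integrable (fun ω => consensusError (x k ω)) P) ∧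
        (1 / (T : ℝ)) * ∑ k ∈ Finset.range T, ∫ ω, consensusError (x k ω) ∂P ≤
          C ((p : ℝ) / (T : ℝ)) * ((n : ℝ) / (T : ℝ))) := by
  -- The constant has to be chosen before any graph is given. If the scalars violate what every
  -- admissible problem implies, there is no such problem and any `C` will do.
  by_cases hsc : 0 < κ₂ ∧ κ₂ < 1 / 5 ∧ 0 < ρ₂ ∧ ρ₂ ≤ ρ ∧
      κ₂ * (ρ + (2 * κ₁ ^ 2 + 1) * ρ ^ 2 + 1) < (κ₁ - 1) * ρ₂ - 1 ∧ 0 ≤ R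
  swap
  · refine ⟨fun _ => 1, monotone_const, fun _ => one_pos, ?_⟩
    rintro n p T hn - - G A _ hG hA rfl rfl rfl - hκ₂ hκ
    intro Ξ _ F μ ζ _ _ Ω _ P _ nc _ _ ξ S _ α β η _ _ _ δ _ _ o x₀ v₀ _ hx₀ _ _ x _
    have h := contraction_condition hA hn hκ₂ hκ
    exact absurd ⟨hκ₂, h.1, minPosEigenvalue_pos hA hG hn, minPosEigenvalue_le_specRad hA hG hn,
      h.2, (consensusError_nonneg x₀).trans hx₀⟩ hsc
  obtain ⟨hκ₂, hκ₂5, hρ₂, hρ, hcond, hR⟩ := hsc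
  obtain ⟨c, K, c₀, C₀, hc, hc1, hK, hc₀, hC₀, hlyap⟩ :=
    exists_lyapunov_contraction hκ₂ hκ₂5 hρ₂ hρ hcond
  have hbound := fun N : ℕ => exists_descentRecursion_bound (c := c)
    (B := K * (4 * σ₁ ^ 2 + 12 * σ₂ ^ 2 + 24 * Lf + 12 * Lf ^ 2 / c₀ + Lf ^ 2))
    (D := (Lf + 1) / 2 * (4 * σ₁ ^ 2 + 12 * σ₂ ^ 2 + 24 * Lf + 12 * Lf ^ 2 / c₀ + Lf ^ 2))
    (A := Lf ^ 2 * (1 / c₀ + 1) + Lf) (l := Lf) (s := κδ ^ 2) (R := R + 2 * C₀ * R) (N := N)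
    hc (by positivity) (by positivity) (by positivity) hLf (by positivity) (by positivity)
    (by positivity)
  choose Cb hCb0 hCb using hbound
  -- The second summand covers the consensus error, which is bounded by `W / c₀`.
  obtain ⟨C, hCmono, hCpos, hCb_le⟩ := exists_monotone_majorant
    (K := fun N => Cb N + Cb N / c₀) fun N => add_nonneg (hCb0 N) (div_nonneg (hCb0 N) hc₀.le)
  refine ⟨C, hCmono, hCpos, ?_⟩
  rintro n p T hn hp hnpT G A _ hG hA rfl rfl rfl - - -
  intro Ξ _ F μ ζ hF hσ₁ Ω _ P _ nc hnc _ ξ S hs α β η hα hβ hη δ hδ hδT o x₀ v₀ hv₀ hx₀R hv₀R hfR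
    x hx
  have hn' : (0 : ℝ) < n := by exact_mod_cast (by omega : 0 < n)
  have hp' : (0 : ℝ) < p := by exact_mod_cast hp
  have hT' : (0 : ℝ) < T := lt_of_le_of_lt (by positivity) hnpT
  have hT : 1 ≤ T := by exact_mod_cast hT'
  rw [div_lt_iff₀' hp'] at hnpT
  obtain ⟨hη0, hη2, hηα, hηβ⟩ := step_size_identities (by omega) hp hT hκ₂ hα hβ hη
  -- The integer `N` of the recursion is `p / T` rounded up.
  have hN : (p : ℝ) ≤ (⌈(p : ℝ) / T⌉₊ : ℝ) * T := (div_le_iff₀ hT').1 (Nat.le_ceil _)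
  have hu_succ : ∀ y u : BlockVec n p, ∑ i, y i = 0 → ∑ i, u i = 0 →
      ∑ i, (u + κ₂ • y) i = 0 := fun y u hy hu => by
    simp only [PiLp.add_apply, PiLp.smul_apply, Finset.sum_add_distrib, ← Finset.smul_sum, hy, hu,
      smul_zero, add_zero]
  obtain ⟨W, hW, hrec⟩ := exists_descentRecursion_zodiac (o := o) hA hG hn hp hT hnpT hN hLf hF hσ₁
    hnc hs hη0 hη2 hηα hηβ hδ hδT hv₀ hx₀R hv₀R hfR hK hc₀ hC₀
    fun y u w hy hu => hlyap (BlockVec n p) (blockMap (weightedLaplacian A))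
      (isPSDWith_blockMap hA) y u w (minPosEigenvalue_mul_normSq_le hA hG hy)
      (minPosEigenvalue_mul_normSq_le hA hG hu)
      (minPosEigenvalue_mul_normSq_le hA hG (hu_succ y u hy hu))
  rw [← hx] at hW hrec
  obtain ⟨hg, ha, hWsum⟩ := hCb _ n p T η _ W _ hrec
  have hC := hCb_le ((p : ℝ) / T)
  have hCb' := hCb0 ⌈(p : ℝ) / T⌉₊
  have hdiv : 0 ≤ Cb ⌈(p : ℝ) / T⌉₊ / c₀ := div_nonneg hCb' hc₀.le
  have hX : ∀ k i, MemLp (fun ω => x k ω i) 2 P := fun k i => by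
    rw [hx]
    exact (memLp_zodiac hs hF hnc (weightedLaplacian A) α β η o hδ x₀ v₀ k).1 i
  have hsm := (hF.smooth_globalCost (by omega)).1
  have havg := fun k => memLp_avg (hX k)
  refine ⟨⟨fun k _ => (hsm.memLp_gradient (havg k)).integrable_normSq, ?_⟩,
    ⟨hsm.integrable_comp (havg T), ?_⟩, ⟨fun k _ => memLp_consensus (hX k), ?_⟩⟩
  · have h1 : 0 ≤ C ((p : ℝ) / T) * ((n : ℝ) / T) := mul_nonneg (hCpos _).le (by positivity)
    -- The first of the two terms already dominates; in the regime `n / T > ε` this is because `T`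
    -- is bounded.
    refine le_trans ?_ (le_add_of_nonneg_right h1)
    calc _ ≤ 1 / (T : ℝ) * (Cb ⌈(p : ℝ) / T⌉₊ * (√p * √T)) := by
          gcongr
          exact hg
      _ = Cb ⌈(p : ℝ) / T⌉₊ * (√p / √T) := by
          have h2 : √(T : ℝ) ^ 2 = T := Real.sq_sqrt hT'.le
          have h3 : 0 < √(T : ℝ) := Real.sqrt_pos.2 hT'
          rw [← h2, Real.sqrt_sq h3.le]
          field_simp
      _ ≤ _ := by
          gcongr
          linarith
  · refine le_trans ha (le_trans ?_ hC)
    linarith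
  · have h1 : ∑ k ∈ Finset.range T, ∫ ω, consensusError (x k ω) ∂P ≤
        Cb ⌈(p : ℝ) / T⌉₊ / c₀ * n := by
      rw [div_mul_eq_mul_div, le_div_iff₀' hc₀, Finset.mul_sum]
      exact (Finset.sum_le_sum fun k _ => hW k).trans hWsum
    calc _ ≤ 1 / (T : ℝ) * (Cb ⌈(p : ℝ) / T⌉₊ / c₀ * n) := by gcongr
      _ = Cb ⌈(p : ℝ) / T⌉₊ / c₀ * (n / T) := by ring
      _ ≤ _ := by
          gcongr
          linarith
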